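/- Let $p>1$ and let $\sigma_p$ be the singular measure $d\sigma_p(y,s)=\delta(s-|y|^p)\,|y|^{\frac{p-2}{6}}\,dy\,ds$ on the curve $s=|y|^p$ in $\mathbb{R}^2$. Let ${\bf C}_p$ be the optimal (smallest) constant in the inequality $$\|f\sigma_p\ast f\sigma_p\ast f\sigma_p\|_{L^2(\mathbb{R}^2)}\le {\bf C}_p^3\,\|f\|_{L^2(\mathbb{R})}^3,\qquad f\in L^2(\mathbb{R})\ \text{(complex-valued)}.$$ An extremizer is a nonzero $f\in L^2(\mathbb{R})$ for which equality holds; an extremizing sequence is a sequence of nonzero $f_n\in L^2(\mathbb{R})$ with $\|f_n\sigma_p\ast f_n\sigma_p\ast f_n\sigma_p\|_{L^2(\mathbb{R}^2)}/\|f_n\|_{L^2(\mathbb{R})}^3\to{\bf C}_p^3$. A sequence $\{f_n\}\subset L^2(\mathbb{R})$ concentrates at $y_0\in\mathbb{R}$ if for all $\varepsilon,\rho>0$ there is $N$ such that $\int_{|y-y_0|\ge\rho}|f_n(y)|^2\,dy<\varepsilon\|f_n\|_{L^2(\mathbb{R})}^2$ for all $n\ge N$. (a) If $${\bf C}_p^6>\frac{2\pi}{\sqrt3\,p(p-1)},$$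 then every extremizing sequence $\{f_n\}$ of nonnegative functions is precompact after normalization and scaling, that is, there are $a_n>0$ such that the set of functions $g_n(y)=a_n^{1/2}f_n(a_ny)/\|f_n\|_{L^2(\mathbb{R})}$, $n\in\mathbb{N}$, is relatively compact in $L^2(\mathbb{R})$. Moreover, in this case extremizers exist. (b) If ${\bf C}_p^6=\frac{2\pi}{\sqrt3\,p(p-1)}$, then for every $y_0\in\mathbb{R}$ there is an extremizing sequence which concentrates at $y_0$. -/

import Mathlib

open MeasureTheory Filter Topology
open scoped ENNReal

noncomputable section

namespace PowerCurve

/-- The singular measure `dσ_p(y, s) = δ(s - |y|^p) |y|^((p-2)/6) dy ds` on the plane: the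
push-forward of `|y|^((p-2)/6) dy` under the parametrization `y ↦ (y, |y|^p)` of the curve. -/
def sigma (p : ℝ) : Measure (ℝ × ℝ) :=
  Measure.map (fun y : ℝ => (y, |y| ^ p))
    (volume.withDensity fun y : ℝ => ENNReal.ofReal (|y| ^ ((p - 2) / 6)))

/-- The (locally finite complex) measure `fσ_p ∗ fσ_p ∗ fσ_p` on the plane is absolutely continuous
with respect to Lebesgue measure, with density `h`. As usual, the convolution of measures
`μ₁ ∗ μ₂ ∗ μ₃` integrates `φ` to `∫∫∫ φ(z₁ + z₂ + z₃) dμ₁(z₁) dμ₂(z₂) dμ₃(z₃)`. For `1 < p` and `f`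
in `L²` the triple integral converges absolutely, because `φ` has compact support and all three
points lie on the curve `s = |y|^p`. -/
def IsTripleConvDensity (p : ℝ) (f : ℝ → ℂ) (h : ℝ × ℝ → ℂ) : Prop :=
  LocallyIntegrable h volume ∧
    ∀ φ : ℝ × ℝ → ℂ, Continuous φ → HasCompactSupport φ →
      ∫ z, φ z * h z =
        ∫ z : (ℝ × ℝ) × (ℝ × ℝ) × (ℝ × ℝ),
          φ (z.1 + z.2.1 + z.2.2) * (f z.1.1 * f z.2.1.1 * f z.2.2.1)
            ∂((sigma p).prod ((sigma p).prod (sigma p)))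

/-- The norm `‖fσ_p ∗ fσ_p ∗ fσ_p‖_{L²(ℝ²)}`: the `L²` norm of the density (which is unique up to
null sets), and `∞` if there is no density. -/
def tripleConvNorm (p : ℝ) (f : ℝ → ℂ) : ℝ≥0∞ :=
  ⨅ (h : ℝ × ℝ → ℂ) (_ : IsTripleConvDensity p f h), eLpNorm h 2 volume

/-- The optimal constant `C_p` in `‖fσ_p ∗ fσ_p ∗ fσ_p‖_{L²(ℝ²)} ≤ C_p³ ‖f‖³_{L²(ℝ)}`. -/
def optimalConst (p : ℝ) : ℝ≥0∞ :=
  sInf {C : ℝ≥0∞ | ∀ f : Lp ℂ 2 (volume : Measure ℝ), tripleConvNorm p f ≤ C ^ 3 * ‖f‖ₑ ^ 3}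

/-- `f` is an extremizer: a nonzero `L²` function for which equality holds in the inequality. -/
def IsExtremizer (p : ℝ) (f : Lp ℂ 2 (volume : Measure ℝ)) : Prop :=
  f ≠ 0 ∧ tripleConvNorm p f = optimalConst p ^ 3 * ‖f‖ₑ ^ 3

/-- `f` is an extremizing sequence: a sequence of nonzero `L²` functions along which the ratio of
the two sides of the inequality tends to its optimal value. -/
def IsExtremizingSeq (p : ℝ) (f : ℕ → Lp ℂ 2 (volume : Measure ℝ)) : Prop :=
  (∀ n, f n ≠ 0) ∧
    Tendsto (fun n => tripleConvNorm p (f n) / ‖f n‖ₑ ^ 3) atTop (𝓝 (optimalConst p ^ 3))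

/-- All terms of the sequence are nonnegative real functions almost everywhere. -/
def IsNonnegSeq (f : ℕ → Lp ℂ 2 (volume : Measure ℝ)) : Prop :=
  ∀ n, ∀ᵐ y : ℝ, 0 ≤ (f n y).re ∧ (f n y).im = 0

/-- The sequence is precompact in `L²(ℝ)` after normalization and scaling: for suitable `aₙ > 0`,
the functions `gₙ(y) = aₙ^(1/2) fₙ(aₙ y) / ‖fₙ‖` form a relatively compact subset of `L²(ℝ)`. -/
def IsPrecompactModScaling (f : ℕ → Lp ℂ 2 (volume : Measure ℝ)) : Prop :=
  ∃ (a : ℕ → ℝ) (g : ℕ → Lp ℂ 2 (volume : Measure ℝ)),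
    (∀ n, 0 < a n) ∧
    (∀ n, ∀ᵐ y : ℝ, g n y = ((√(a n) / ‖f n‖ : ℝ) : ℂ) * f n (a n * y)) ∧
    IsCompact (closure (Set.range g))

/-- The sequence concentrates at the point `y₀`. -/
def ConcentratesAt (f : ℕ → Lp ℂ 2 (volume : Measure ℝ)) (y₀ : ℝ) : Prop :=
  ∀ ε > 0, ∀ ρ > 0, ∃ N : ℕ, ∀ n ≥ N,
    ∫ y in {y : ℝ | ρ ≤ |y - y₀|}, ‖f n y‖ ^ 2 < ε * ‖f n‖ ^ 2

end PowerCurve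

end

/-!
The triple convolution `fσ_p ∗ fσ_p ∗ fσ_p` is handled by duality. Integrated against `ψ`, it gives
`∫ f(y₁) f(y₂) f(y₃) ψ(curveSum p y) weight p y dy`, so by Cauchy–Schwarz a bound `K` for the density
of the push-forward of `weight p ^ 2 dy` under `curveSum p`, on a part `E` of space (`CurveBound`),
bounds the contribution of `E` to the norm by `√K ‖f‖³`. Polar coordinates in the planes of constant
sum turn such bounds into integrals over a circle, because along each ray the convex function
`∑ |yᵢ|^p` is controlled through its derivative. The density is bounded on the whole space
(`exists_curveBound_univ`), which makes the convolution a bounded operator `convOp`. More precisely,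
`concConst p = 2π / (√3 p (p - 1))`, up to any `ε`, suffices where the three abscissae are equal up
to a small relative error (`exists_curveBound_closeSet`), and an arbitrarily small bound where they
are not comparable (`exists_curveBound_farSet`). What remains are comparable abscissae two of which
are separated, and their contribution is small unless `f` has a substantial scale-invariant average
`∫ |f(v)| |v|^(-1/2) dv` over some annulus (`exists_sepSet_le`).

Consequently, above the critical constant the members of an extremizing sequence have such averages
bounded below (`exists_annMass_gt`). A dilation moves the annulus to unit size, and as the functions
are nonnegative the average is then the inner product with a fixed function, so the rescaled
sequence has a nonzero weak limit `g` along a subsequence. The remainders `r n` tend weakly to zero,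
and `g * g * r n`, `g * r n * r n` tend to zero in norm (`tendsto_tripleConv_of_weak`): after
truncation to bounded supports, Plancherel's theorem turns the convolution into the product of the
Fourier extensions, of which the one of `r n` tends to zero pointwise and boundedly. With `s = ‖g‖²`
the optimal inequality for `g` and for `r n` gives `1 ≤ s³ + (1 - s)³`, hence `s = 1`, and the
convergence is strong (`tendsto_of_weakTendsto`). The limit is an extremizer; nonnegative extremizing
sequences exist because replacing `f` by `|f|` does not decrease the norm of the convolution.

In the case of equality, it suffices that Gaussians of width `1 / k` centred at `1` reach `concConst p`
in the limit. Their triple convolution is bounded below by pairing it with a Gaussian that is adapted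
to the osculating parabola of the curve (`pairing_sq_le`); after rescaling, the pairing converges by
dominated convergence to the value for the parabola (`tendsto_pairing`), and the limiting
quotient is the critical constant (`gaussian_ratio`). Dilations preserve the quotients and carry the
point `1` to any `y₀ ≠ 0`; dilation factors tending to infinity carry it to `0`
(`exists_extremizing_concentratesAt`).
-/

noncomputable section

namespace PowerCurve

/-! ### One-dimensional changes of variable along convex functions -/

lemma lintegral_comp_mul_deriv_pos_le {k k' : ℝ → ℝ} (hk : ∀ s, HasDerivAt k (k' s) s)
    (hm : Monotone k') (g : ℝ → ℝ≥0∞) :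
    ∫⁻ s in {s | 0 < k' s}, g (k s) * ENNReal.ofReal |k' s| ≤ ∫⁻ t, g t := by
  have hmeas : MeasurableSet {s | 0 < k' s} := measurableSet_lt measurable_const hm.measurable
  have hconv : Convex ℝ {s | 0 < k' s} := by
    apply Set.OrdConnected.convex
    exact ⟨fun x hx y _ z hz => lt_of_lt_of_le hx (hm hz.1)⟩
  have hinj : Set.InjOn k {s | 0 < k' s} := by
    refine (strictMonoOn_of_deriv_pos hconv (fun s _ => (hk s).continuousAt.continuousWithinAt)
      ?_).injOn
    intro s hs
    rw [(hk s).deriv]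
    exact (interior_subset hs : s ∈ {s | 0 < k' s})
  have := lintegral_image_eq_lintegral_abs_deriv_mul hmeas
    (fun s _ => (hk s).hasDerivWithinAt) hinj g
  calc _ = ∫⁻ s in {s | 0 < k' s}, ENNReal.ofReal |k' s| * g (k s) := by simp_rw [mul_comm]
    _ = _ := this.symm
    _ ≤ _ := setLIntegral_le_lintegral _ _

/-- A function with monotone derivative is injective on each of the sets where the derivative is
positive and negative, which makes the change of variable at most two-to-one. -/
lemma lintegral_comp_mul_deriv_le {k k' : ℝ → ℝ} (hk : ∀ s, HasDerivAt k (k' s) s)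
    (hm : Monotone k') (g : ℝ → ℝ≥0∞) :
    ∫⁻ s, g (k s) * ENNReal.ofReal |k' s| ≤ 2 * ∫⁻ t, g t := by
  have hP : MeasurableSet {s | 0 < k' s} := measurableSet_lt measurable_const hm.measurable
  have hN : MeasurableSet {s | k' s < 0} := measurableSet_lt hm.measurable measurable_const
  have hneg : ∫⁻ s in {s | k' s < 0}, g (k s) * ENNReal.ofReal |k' s| ≤ ∫⁻ t, g t := by
    have h1 : ∀ s, HasDerivAt (fun s => k (-s)) (-(k' (-s))) s := fun s => by
      have := (hk (-s)).comp s (hasDerivAt_neg s)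
      rw [mul_neg_one] at this
      exact this
    have h2 := lintegral_comp_mul_deriv_pos_le h1
      (fun x y hxy => neg_le_neg (hm (neg_le_neg hxy))) g
    have hN' : MeasurableSet {s | 0 < -k' (-s)} := measurableSet_lt measurable_const
      ((hm.measurable.comp measurable_neg).neg)
    rw [← lintegral_indicator hN', ← lintegral_neg_eq_self] at h2
    rw [← lintegral_indicator hN]
    refine le_trans (le_of_eq (lintegral_congr fun s => ?_)) h2
    by_cases h : k' s < 0 <;> simp [Set.indicator, h]
  calc ∫⁻ s, g (k s) * ENNReal.ofReal |k' s|
      = ∫⁻ s in {s | 0 < k' s} ∪ {s | k' s < 0}, g (k s) * ENNReal.ofReal |k' s| := by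
        rw [← lintegral_indicator (hP.union hN)]
        refine lintegral_congr fun s => ?_
        by_cases h : k' s = 0
        · simp [Set.indicator, h]
        · rw [Set.indicator_of_mem]
          exact (lt_or_gt_of_ne h).symm
    _ ≤ _ := lintegral_union_le _ _ _
    _ ≤ (∫⁻ t, g t) + ∫⁻ t, g t :=
        add_le_add (lintegral_comp_mul_deriv_pos_le hk hm g) hneg
    _ = _ := (two_mul _).symm

/-! ### Sums of three points of the curve -/

/-- The derivative `p |y|^(p-2) y` of `|y|^p`. -/
def slope (p y : ℝ) : ℝ := p * |y| ^ (p - 2) * y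

/-- The projection to the plane of the sum of the three points of the curve with abscissae `y`. -/
def curveSum (p : ℝ) (y : ℝ × ℝ × ℝ) : ℝ × ℝ :=
  (y.1 + y.2.1 + y.2.2, |y.1| ^ p + |y.2.1| ^ p + |y.2.2| ^ p)

/-- The product of the three densities `|yᵢ|^((p-2)/6)`. -/
def weight (p : ℝ) (y : ℝ × ℝ × ℝ) : ℝ :=
  |y.1| ^ ((p - 2) / 6) * |y.2.1| ^ ((p - 2) / 6) * |y.2.2| ^ ((p - 2) / 6)

/-- The `p`-norm of the three abscissae. -/
def size (p : ℝ) (y : ℝ × ℝ × ℝ) : ℝ := (|y.1| ^ p + |y.2.1| ^ p + |y.2.2| ^ p) ^ (1 / p)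

/-- The push-forward under `curveSum p` of `weight p ^ 2` times Lebesgue measure on `E` is at most
`K` times Lebesgue measure on the plane. -/
def CurveBound (p : ℝ) (E : Set (ℝ × ℝ × ℝ)) (K : ℝ≥0∞) : Prop :=
  ∀ g : ℝ × ℝ → ℝ≥0∞, Measurable g →
    ∫⁻ y in E, g (curveSum p y) * ENNReal.ofReal (weight p y ^ 2) ≤ K * ∫⁻ z, g z

lemma hasDerivAt_abs_rpow_slope {p : ℝ} (hp : 1 < p) (y : ℝ) :
    HasDerivAt (fun y : ℝ => |y| ^ p) (slope p y) y := hasDerivAt_abs_rpow y hp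

lemma slope_neg (p y : ℝ) : slope p (-y) = -slope p y := by simp [slope]

lemma slope_of_pos {p y : ℝ} (hy : 0 < y) : slope p y = p * y ^ (p - 1) := by
  rw [slope, abs_of_pos hy, mul_assoc, ← Real.rpow_add_one hy.ne']
  ring_nf

lemma slope_zero (p : ℝ) : slope p 0 = 0 := by simp [slope]

lemma slope_of_nonneg {p y : ℝ} (hp : 1 < p) (hy : 0 ≤ y) : slope p y = p * y ^ (p - 1) := by
  rcases hy.eq_or_lt with rfl | h
  · rw [slope_zero, Real.zero_rpow (by linarith), mul_zero]
  · exact slope_of_pos h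

lemma slope_mul {p c : ℝ} (hc : 0 < c) (y : ℝ) :
    slope p (c * y) = c ^ (p - 1) * slope p y := by
  rw [slope, slope, abs_mul, Real.mul_rpow (abs_nonneg _) (abs_nonneg _), abs_of_pos hc]
  have : c ^ (p - 1) = c ^ (p - 2) * c := by
    rw [← Real.rpow_add_one hc.ne']; ring_nf
  rw [this]; ring

lemma slope_strictMono {p : ℝ} (hp : 1 < p) : StrictMono (slope p) := by
  have h0 : StrictMonoOn (slope p) (Set.Ici 0) := by
    intro x hx y hy hxy
    rw [slope_of_nonneg hp hx, slope_of_nonneg hp hy]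
    have := Real.rpow_lt_rpow hx hxy (by linarith : 0 < p - 1)
    nlinarith
  exact strictMono_of_odd_strictMonoOn_nonneg (slope_neg p) h0

lemma continuous_slope {p : ℝ} (hp : 1 < p) : Continuous (slope p) := by
  have h : slope p = fun y => if 0 ≤ y then p * |y| ^ (p - 1) else -(p * |y| ^ (p - 1)) := by
    funext y
    split_ifs with hy
    · rw [slope_of_nonneg hp hy, abs_of_nonneg hy]
    · push Not at hy
      have := slope_neg p (-y)
      rw [neg_neg] at this
      rw [this, slope_of_nonneg hp (by linarith), abs_of_neg hy]
  have hc : Continuous fun y : ℝ => p * |y| ^ (p - 1) :=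
    continuous_const.mul (continuous_abs.rpow_const fun _ => Or.inr (by linarith))
  rw [h]
  refine Continuous.if_le hc hc.neg continuous_const continuous_id ?_
  rintro y rfl
  simp [Real.zero_rpow (by linarith : p - 1 ≠ 0)]

lemma hasDerivAt_abs_rpow_line {p : ℝ} (hp : 1 < p) (a b s : ℝ) :
    HasDerivAt (fun s => |a + s * b| ^ p) (b * slope p (a + s * b)) s := by
  have h1 : HasDerivAt (fun s : ℝ => a + s * b) b s := by
    simpa using ((hasDerivAt_id s).mul_const b).const_add a
  have := (hasDerivAt_abs_rpow_slope hp (a + s * b)).comp s h1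
  rw [mul_comm b]; exact this

lemma monotone_slope_line {p : ℝ} (hp : 1 < p) (a b : ℝ) :
    Monotone fun s => b * slope p (a + s * b) := by
  intro s s' hs
  rcases le_total 0 b with hb | hb
  · exact mul_le_mul_of_nonneg_left ((slope_strictMono hp).monotone (by nlinarith)) hb
  · exact mul_le_mul_of_nonpos_left ((slope_strictMono hp).monotone (by nlinarith)) hb

@[fun_prop]
lemma measurable_curveSum (p : ℝ) : Measurable (curveSum p) := by
  unfold curveSum; fun_prop

@[fun_prop]
lemma measurable_weight (p : ℝ) : Measurable (weight p) := by
  unfold weight; fun_prop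

@[fun_prop]
lemma measurable_size (p : ℝ) : Measurable (size p) := by
  unfold size; fun_prop

/-- Integration over space, one line at a time: the lines have the direction `e` with
`e₁ + e₂ + e₃ = 0`, along which the first coordinate of `curveSum p` is constant and the second one
is convex. The bound `hE` controls the weight `W` by the derivative along the line, with a factor
that may depend on the line through `V` and on the point through its size. -/
lemma lintegral_lines_le {p : ℝ} (hp : 1 < p) {E : Set (ℝ × ℝ × ℝ)} (hEm : MeasurableSet E)
    (Y : ℝ → ℝ → ℝ → ℝ × ℝ × ℝ) (V : ℝ × ℝ × ℝ → ℝ) (e : ℝ × ℝ × ℝ)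
    (hYint : ∀ G : ℝ × ℝ × ℝ → ℝ≥0∞, Measurable G →
      ∫⁻ y, G y = ∫⁻ ξ, ∫⁻ v, ∫⁻ s, G (Y ξ v s))
    (hY : ∀ ξ v s, Y ξ v s = Y ξ v 0 + s • e) (hV : ∀ ξ v s, V (Y ξ v s) = v)
    (hξ : ∀ ξ v s, (Y ξ v s).1 + (Y ξ v s).2.1 + (Y ξ v s).2.2 = ξ)
    (B : ℝ → ℝ → ℝ≥0∞) (hBm : Measurable (Function.uncurry B)) {K : ℝ≥0∞}
    (hB : ∀ t, 0 ≤ t → ∫⁻ v, B v t ≤ K)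
    {W : ℝ × ℝ × ℝ → ℝ≥0∞} (hW : Measurable W) (hE : ∀ y ∈ E, W y ≤ B (V y) (size p y) *
      ENNReal.ofReal |e.1 * slope p y.1 + e.2.1 * slope p y.2.1 + e.2.2 * slope p y.2.2|)
    {g : ℝ × ℝ → ℝ≥0∞} (hg : Measurable g) :
    ∫⁻ y in E, g (curveSum p y) * W y ≤ 2 * K * ∫⁻ z, g z := by
  rw [← lintegral_indicator hEm, hYint _ (by
    refine Measurable.indicator ?_ hEm
    fun_prop)]
  have hline : ∀ ξ v, ∫⁻ s, E.indicator (fun y => g (curveSum p y) * W y) (Y ξ v s) ≤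
      2 * ∫⁻ τ, g (ξ, τ) * B v (|τ| ^ (1 / p)) := by
    intro ξ v
    set q := Y ξ v 0 with hq
    have hc : ∀ s, Y ξ v s = (q.1 + s * e.1, q.2.1 + s * e.2.1, q.2.2 + s * e.2.2) := by
      intro s; rw [hY]; simp [Prod.ext_iff, hq]
    have hd := hasDerivAt_abs_rpow_line hp
    have hmono := monotone_slope_line hp
    have key := lintegral_comp_mul_deriv_le
      (k := fun s => |q.1 + s * e.1| ^ p + |q.2.1 + s * e.2.1| ^ p + |q.2.2 + s * e.2.2| ^ p)
      (fun s => ((hd q.1 e.1 s).add (hd q.2.1 e.2.1 s)).add (hd q.2.2 e.2.2 s))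
      (((hmono q.1 e.1).add (hmono q.2.1 e.2.1)).add (hmono q.2.2 e.2.2))
      (fun τ => g (ξ, τ) * B v (|τ| ^ (1 / p)))
    refine le_trans (lintegral_mono fun s => ?_) key
    by_cases hs : Y ξ v s ∈ E
    · rw [Set.indicator_of_mem hs]
      have h1 := hE _ hs
      have h2 : curveSum p (Y ξ v s) = (ξ, |q.1 + s * e.1| ^ p + |q.2.1 + s * e.2.1| ^ p +
          |q.2.2 + s * e.2.2| ^ p) := by
        unfold curveSum; rw [hξ, hc]
      have h3 : size p (Y ξ v s) = |(|q.1 + s * e.1| ^ p + |q.2.1 + s * e.2.1| ^ p +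
          |q.2.2 + s * e.2.2| ^ p)| ^ (1 / p) := by
        rw [abs_of_nonneg (by positivity), size, hc]
      rw [hV, h3] at h1
      rw [h2, mul_assoc]
      gcongr
      simpa [hc] using h1
    · rw [Set.indicator_of_notMem hs]; exact zero_le
  have hpow : Measurable fun τ : ℝ => |τ| ^ (1 / p) := by fun_prop
  -- on the line the size is `τ^(1/p)`, so that the integral over `v` is taken at fixed size
  calc _ ≤ ∫⁻ ξ, ∫⁻ v, 2 * ∫⁻ τ, g (ξ, τ) * B v (|τ| ^ (1 / p)) :=
        lintegral_mono fun ξ => lintegral_mono fun v => hline ξ v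
    _ = ∫⁻ ξ, 2 * ∫⁻ τ, g (ξ, τ) * ∫⁻ v, B v (|τ| ^ (1 / p)) := by
        refine lintegral_congr fun ξ => ?_
        have hm : Measurable fun z : ℝ × ℝ => g (ξ, z.2) * B z.1 (|z.2| ^ (1 / p)) := by
          refine (hg.comp (by fun_prop)).mul (hBm.comp (measurable_fst.prodMk
            (hpow.comp measurable_snd)))
        rw [lintegral_const_mul _ hm.lintegral_prod_right', lintegral_lintegral_swap
          hm.aemeasurable]
        congr 1
        refine lintegral_congr fun τ => ?_
        have : Measurable fun v => B v (|τ| ^ (1 / p)) :=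
          hBm.comp (measurable_id.prodMk measurable_const)
        exact lintegral_const_mul (g (ξ, τ)) this
    _ ≤ ∫⁻ ξ, 2 * ∫⁻ τ, g (ξ, τ) * K := by
        gcongr with ξ τ
        exact hB _ (by positivity)
    _ = 2 * K * ∫⁻ z, g z := by
        rw [Measure.volume_eq_prod, lintegral_prod _ hg.aemeasurable, ← lintegral_const_mul]
        · refine lintegral_congr fun ξ => ?_
          have : Measurable fun τ => g (ξ, τ) := hg.comp (by fun_prop)
          rw [lintegral_mul_const _ this]; ring
        · exact hg.lintegral_prod_right'

lemma lintegral_triple {G : ℝ × ℝ × ℝ → ℝ≥0∞} (hG : Measurable G) :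
    ∫⁻ y, G y = ∫⁻ a, ∫⁻ b, ∫⁻ c, G (a, b, c) := by
  rw [Measure.volume_eq_prod, lintegral_prod _ hG.aemeasurable]
  refine lintegral_congr fun a => ?_
  rw [Measure.volume_eq_prod, lintegral_prod]
  exact (hG.comp (by fun_prop)).aemeasurable

/-- Lines on which the first abscissa is fixed. -/
lemma lintegral_fst_le {p : ℝ} (hp : 1 < p) {E : Set (ℝ × ℝ × ℝ)} (hEm : MeasurableSet E)
    (B : ℝ → ℝ → ℝ≥0∞) (hBm : Measurable (Function.uncurry B)) {K : ℝ≥0∞}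
    (hB : ∀ t, 0 ≤ t → ∫⁻ v, B v t ≤ K) {W : ℝ × ℝ × ℝ → ℝ≥0∞} (hW : Measurable W)
    (hE : ∀ y ∈ E, W y ≤ B y.1 (size p y) *
      ENNReal.ofReal |slope p y.2.2 - slope p y.2.1|)
    {g : ℝ × ℝ → ℝ≥0∞} (hg : Measurable g) :
    ∫⁻ y in E, g (curveSum p y) * W y ≤ 2 * K * ∫⁻ z, g z := by
  refine lintegral_lines_le hp hEm (fun ξ v s => (v, ξ - v - s, s)) (fun y => y.1) (0, -1, 1)
    ?_ ?_ ?_ ?_ B hBm hB hW ?_ hg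
  · intro G hG
    rw [lintegral_triple hG]
    calc ∫⁻ a, ∫⁻ b, ∫⁻ c, G (a, b, c)
        = ∫⁻ a, ∫⁻ c, ∫⁻ b, G (a, b, c) := by
          refine lintegral_congr fun a => ?_
          rw [lintegral_lintegral_swap]
          exact (hG.comp (by fun_prop)).aemeasurable
      _ = ∫⁻ a, ∫⁻ c, ∫⁻ ξ, G (a, ξ - a - c, c) := by
          refine lintegral_congr fun a => lintegral_congr fun c => ?_
          rw [← lintegral_sub_right_eq_self _ (a + c)]
          simp_rw [sub_sub]
      _ = ∫⁻ a, ∫⁻ ξ, ∫⁻ c, G (a, ξ - a - c, c) := by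
          refine lintegral_congr fun a => ?_
          rw [lintegral_lintegral_swap]
          exact (hG.comp (by fun_prop)).aemeasurable
      _ = _ := by
          rw [lintegral_lintegral_swap]
          have : Measurable fun z : (ℝ × ℝ) × ℝ => G (z.1.1, z.1.2 - z.1.1 - z.2, z.2) :=
            hG.comp (by fun_prop)
          exact this.lintegral_prod_right'.aemeasurable
  · intro ξ v s; ext <;> simp; ring
  · intro ξ v s; rfl
  · intro ξ v s; simp only; ring
  · intro y hy
    refine (hE y hy).trans (le_of_eq ?_)
    congr 3; ring

lemma curveBound_of_fst {p : ℝ} (hp : 1 < p) {E : Set (ℝ × ℝ × ℝ)} (hEm : MeasurableSet E)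
    (B : ℝ → ℝ → ℝ≥0∞) (hBm : Measurable (Function.uncurry B)) {K : ℝ≥0∞}
    (hB : ∀ t, 0 ≤ t → ∫⁻ v, B v t ≤ K)
    (hE : ∀ y ∈ E, ENNReal.ofReal (weight p y ^ 2) ≤ B y.1 (size p y) *
      ENNReal.ofReal |slope p y.2.2 - slope p y.2.1|) :
    CurveBound p E (2 * K) :=
  fun _ hg => lintegral_fst_le hp hEm B hBm hB (by fun_prop) hE hg

/-- Lines on which the difference of the last two abscissae is fixed. -/
lemma curveBound_of_sub {p : ℝ} (hp : 1 < p) {E : Set (ℝ × ℝ × ℝ)} (hEm : MeasurableSet E)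
    (B : ℝ → ℝ → ℝ≥0∞) (hBm : Measurable (Function.uncurry B)) {K : ℝ≥0∞}
    (hB : ∀ t, 0 ≤ t → ∫⁻ v, B v t ≤ K)
    (hE : ∀ y ∈ E, ENNReal.ofReal (weight p y ^ 2) ≤ B (y.2.1 - y.2.2) (size p y) *
      ENNReal.ofReal |slope p y.2.1 + slope p y.2.2 - 2 * slope p y.1|) :
    CurveBound p E (2 * K) := by
  refine fun g hg => lintegral_lines_le hp hEm (fun ξ v s => (ξ - v - 2 * s, s + v, s))
    (fun y => y.2.1 - y.2.2) (-2, 1, 1) ?_ ?_ ?_ ?_ B hBm hB (by fun_prop) ?_ hg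
  · intro G hG
    rw [lintegral_triple hG]
    calc ∫⁻ a, ∫⁻ b, ∫⁻ c, G (a, b, c)
        = ∫⁻ a, ∫⁻ c, ∫⁻ b, G (a, b, c) := by
          refine lintegral_congr fun a => ?_
          rw [lintegral_lintegral_swap]
          exact (hG.comp (by fun_prop)).aemeasurable
      _ = ∫⁻ a, ∫⁻ c, ∫⁻ v, G (a, c + v, c) := by
          refine lintegral_congr fun a => lintegral_congr fun c => ?_
          rw [← lintegral_add_left_eq_self _ c]
      _ = ∫⁻ a, ∫⁻ v, ∫⁻ c, G (a, c + v, c) := by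
          refine lintegral_congr fun a => ?_
          rw [lintegral_lintegral_swap]
          exact (hG.comp (by fun_prop)).aemeasurable
      _ = ∫⁻ v, ∫⁻ a, ∫⁻ c, G (a, c + v, c) := by
          rw [lintegral_lintegral_swap]
          have : Measurable fun z : (ℝ × ℝ) × ℝ => G (z.1.1, z.2 + z.1.2, z.2) :=
            hG.comp (by fun_prop)
          exact this.lintegral_prod_right'.aemeasurable
      _ = ∫⁻ v, ∫⁻ c, ∫⁻ a, G (a, c + v, c) := by
          refine lintegral_congr fun a => ?_
          rw [lintegral_lintegral_swap]
          exact (hG.comp (by fun_prop)).aemeasurable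
      _ = ∫⁻ v, ∫⁻ c, ∫⁻ ξ, G (ξ - v - 2 * c, c + v, c) := by
          refine lintegral_congr fun v => lintegral_congr fun c => ?_
          rw [← lintegral_sub_right_eq_self _ (v + 2 * c)]
          simp_rw [sub_sub]
      _ = ∫⁻ v, ∫⁻ ξ, ∫⁻ c, G (ξ - v - 2 * c, c + v, c) := by
          refine lintegral_congr fun a => ?_
          rw [lintegral_lintegral_swap]
          exact (hG.comp (by fun_prop)).aemeasurable
      _ = _ := by
          rw [lintegral_lintegral_swap]
          have : Measurable fun z : (ℝ × ℝ) × ℝ =>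
            G (z.1.2 - z.1.1 - 2 * z.2, z.2 + z.1.1, z.2) := hG.comp (by fun_prop)
          exact this.lintegral_prod_right'.aemeasurable
  · intro ξ v s; ext <;> simp <;> ring
  · intro ξ v s; simp
  · intro ξ v s; simp; ring
  · intro y hy
    refine (hE y hy).trans (le_of_eq ?_)
    congr 3; ring

/-! ### Polar coordinates in the planes of constant sum -/

lemma lintegral_comp_mul {k : ℝ} (hk : k ≠ 0) {f : ℝ → ℝ≥0∞} (hf : Measurable f) :
    ∫⁻ x, f x = ENNReal.ofReal |k| * ∫⁻ x, f (k * x) := by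
  conv_lhs => rw [← Real.smul_map_volume_mul_left hk]
  rw [lintegral_smul_measure, lintegral_map hf (by fun_prop), smul_eq_mul]

lemma lintegral_comp_mul_left {k : ℝ} (hk : 0 < k) {f : ℝ → ℝ≥0∞} (hf : Measurable f) :
    ∫⁻ x, f x = ENNReal.ofReal k * ∫⁻ x, f (k * x) := by
  rw [lintegral_comp_mul hk.ne' hf, abs_of_pos hk]

/-- Integration over the planes of constant sum `ξ`, with orthonormal coordinates `q` centred at the
diagonal point in each of them; `1/√3` is the distance between planes whose sums differ by one. -/
lemma lintegral_triple_rotate {G : ℝ × ℝ × ℝ → ℝ≥0∞} (hG : Measurable G) :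
    ∫⁻ y, G y = ENNReal.ofReal (1 / √3) * ∫⁻ ξ, ∫⁻ q : ℝ × ℝ,
      G (ξ / 3 + (√2 / 2 * q.1 + √6 / 6 * q.2), ξ / 3 + (-(√2 / 2) * q.1 + √6 / 6 * q.2),
        ξ / 3 + -2 * (√6 / 6) * q.2) := by
  have h6 : (0 : ℝ) < √6 / 6 := by positivity
  have h2 : (0 : ℝ) < √2 := by positivity
  have hconst : ENNReal.ofReal (1 / √3) = ENNReal.ofReal √2 * ENNReal.ofReal (√6 / 6) := by
    rw [← ENNReal.ofReal_mul h2.le]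
    congr 1
    have h36 : √6 = √3 * √2 := by rw [← Real.sqrt_mul (by norm_num)]; norm_num
    have h22 : √2 * √2 = 2 := Real.mul_self_sqrt (by norm_num)
    have h33 : √3 * √3 = 3 := Real.mul_self_sqrt (by norm_num)
    have : (√3 : ℝ) ≠ 0 := by positivity
    field_simp
    rw [h36]
    nlinarith
  have hplane : ∀ ξ : ℝ, ∫⁻ a, ∫⁻ b, G (a, b, ξ - a - b) = ENNReal.ofReal (1 / √3) *
      ∫⁻ q : ℝ × ℝ,
      G (ξ / 3 + (√2 / 2 * q.1 + √6 / 6 * q.2), ξ / 3 + (-(√2 / 2) * q.1 + √6 / 6 * q.2),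
        ξ / 3 + -2 * (√6 / 6) * q.2) := by
    intro ξ
    have hm1 : Measurable fun z : ℝ × ℝ => G (z.1 + z.2, z.1, ξ - (z.1 + z.2) - z.1) :=
      hG.comp (by fun_prop)
    have hm2 : Measurable fun z : ℝ × ℝ =>
      G (z.2 + √2 * z.1, z.2, ξ - (z.2 + √2 * z.1) - z.2) := hG.comp (by fun_prop)
    calc ∫⁻ a, ∫⁻ b, G (a, b, ξ - a - b)
        = ∫⁻ b, ∫⁻ a, G (a, b, ξ - a - b) := by
          rw [lintegral_lintegral_swap]
          exact (hG.comp (by fun_prop)).aemeasurable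
      _ = ∫⁻ b, ∫⁻ v, G (b + v, b, ξ - (b + v) - b) := by
          refine lintegral_congr fun b => ?_
          rw [← lintegral_add_left_eq_self _ b]
      _ = ∫⁻ v, ∫⁻ b, G (b + v, b, ξ - (b + v) - b) := by
          rw [lintegral_lintegral_swap]
          exact hm1.aemeasurable
      _ = ENNReal.ofReal √2 * ∫⁻ x, ∫⁻ b, G (b + √2 * x, b, ξ - (b + √2 * x) - b) := by
          rw [lintegral_comp_mul_left h2]
          exact hm1.lintegral_prod_left'
      _ = ENNReal.ofReal √2 * ∫⁻ x, ENNReal.ofReal (√6 / 6) * ∫⁻ z,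
            G (ξ / 3 + (√2 / 2 * x + √6 / 6 * z), ξ / 3 + (-(√2 / 2) * x + √6 / 6 * z),
              ξ / 3 + -2 * (√6 / 6) * z) := by
          congr 1
          refine lintegral_congr fun x => ?_
          rw [← lintegral_add_left_eq_self _ (ξ / 3 + -(√2 / 2) * x), lintegral_comp_mul_left h6]
          · congr 1
            refine lintegral_congr fun z => ?_
            congr 1
            simp only [Prod.mk.injEq]
            refine ⟨by ring, by ring, by ring⟩
          · exact hG.comp (by fun_prop)
      _ = _ := by
          have hm3 : Measurable fun q : ℝ × ℝ => G (ξ / 3 + (√2 / 2 * q.1 + √6 / 6 * q.2),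
            ξ / 3 + (-(√2 / 2) * q.1 + √6 / 6 * q.2), ξ / 3 + -2 * (√6 / 6) * q.2) :=
            hG.comp (by fun_prop)
          rw [lintegral_const_mul, hconst, ← mul_assoc, Measure.volume_eq_prod,
            lintegral_prod _ hm3.aemeasurable]
          exact hm3.lintegral_prod_right'
  calc ∫⁻ y, G y = ∫⁻ a, ∫⁻ b, ∫⁻ c, G (a, b, c) := lintegral_triple hG
    _ = ∫⁻ a, ∫⁻ b, ∫⁻ ξ, G (a, b, ξ - a - b) := by
        refine lintegral_congr fun a => lintegral_congr fun b => ?_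
        rw [← lintegral_sub_right_eq_self _ (a + b)]
        simp_rw [sub_sub]
    _ = ∫⁻ a, ∫⁻ ξ, ∫⁻ b, G (a, b, ξ - a - b) := by
        refine lintegral_congr fun a => ?_
        rw [lintegral_lintegral_swap]
        exact (hG.comp (by fun_prop)).aemeasurable
    _ = ∫⁻ ξ, ∫⁻ a, ∫⁻ b, G (a, b, ξ - a - b) := by
        rw [lintegral_lintegral_swap]
        have : Measurable fun z : (ℝ × ℝ) × ℝ => G (z.1.1, z.2, z.1.2 - z.1.1 - z.2) :=
          hG.comp (by fun_prop)
        exact this.lintegral_prod_right'.aemeasurable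
    _ = _ := by
        simp_rw [hplane]
        rw [lintegral_const_mul]
        have : Measurable fun z : ℝ × (ℝ × ℝ) =>
          G (z.1 / 3 + (√2 / 2 * z.2.1 + √6 / 6 * z.2.2),
            z.1 / 3 + (-(√2 / 2) * z.2.1 + √6 / 6 * z.2.2), z.1 / 3 + -2 * (√6 / 6) * z.2.2) :=
          hG.comp (by fun_prop)
        exact this.lintegral_prod_right'

/-- The mean of the three abscissae. -/
def mean (y : ℝ × ℝ × ℝ) : ℝ := (y.1 + y.2.1 + y.2.2) / 3

/-- If the weight is at most `B` times the quotient of the radial derivative of `∑ |yᵢ|^p` by the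
radius, in the plane of constant sum with the diagonal point as origin, then integration in polar
coordinates gives the constant `2πB/√3`. -/
lemma curveBound_of_radial {p : ℝ} (hp : 1 < p) {E : Set (ℝ × ℝ × ℝ)} (hEm : MeasurableSet E)
    {B : ℝ} (hB : 0 ≤ B)
    (hE : ∀ y ∈ E, weight p y ^ 2 *
      ((y.1 - mean y) ^ 2 + (y.2.1 - mean y) ^ 2 + (y.2.2 - mean y) ^ 2) ≤
      B * (slope p y.1 * (y.1 - mean y) + slope p y.2.1 * (y.2.1 - mean y) +
        slope p y.2.2 * (y.2.2 - mean y))) :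
    CurveBound p E (ENNReal.ofReal (2 * Real.pi / √3 * B)) := by
  intro g hg
  set α : ℝ := √2 / 2 with hα
  set β : ℝ := √6 / 6 with hβ
  have hα2 : α ^ 2 = 1 / 2 := by rw [hα, div_pow, Real.sq_sqrt (by norm_num)]; norm_num
  have hβ2 : β ^ 2 = 1 / 6 := by rw [hβ, div_pow, Real.sq_sqrt (by norm_num)]; norm_num
  set G : ℝ × ℝ × ℝ → ℝ≥0∞ := E.indicator fun y => g (curveSum p y) *
    ENNReal.ofReal (weight p y ^ 2) with hG
  have hGm : Measurable G := by
    refine Measurable.indicator ?_ hEm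
    fun_prop
  rw [← lintegral_indicator hEm, lintegral_triple_rotate hGm]
  -- on a ray the Jacobian `r` is absorbed by the radial derivative of the sum of the powers
  have hray : ∀ ξ θ : ℝ, ∫⁻ r in Set.Ioi (0 : ℝ), ENNReal.ofReal r *
      G (ξ / 3 + (α * (r * Real.cos θ) + β * (r * Real.sin θ)),
        ξ / 3 + (-α * (r * Real.cos θ) + β * (r * Real.sin θ)),
        ξ / 3 + -2 * β * (r * Real.sin θ)) ≤ ENNReal.ofReal B * ∫⁻ τ, g (ξ, τ) := by
    intro ξ θ
    set u := α * Real.cos θ + β * Real.sin θ with hu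
    set v := -α * Real.cos θ + β * Real.sin θ with hv
    set w := -2 * β * Real.sin θ with hw
    have huvw : u + v + w = 0 := by rw [hu, hv, hw]; ring
    have hsq : u ^ 2 + v ^ 2 + w ^ 2 = 1 := by
      have : u ^ 2 + v ^ 2 + w ^ 2 = 2 * α ^ 2 * Real.cos θ ^ 2 + 6 * β ^ 2 * Real.sin θ ^ 2 := by
        rw [hu, hv, hw]; ring
      rw [this, hα2, hβ2]
      linarith [Real.sin_sq_add_cos_sq θ]
    have hd := hasDerivAt_abs_rpow_line hp
    have hmono := monotone_slope_line hp
    have hkm := ((hmono (ξ / 3) u).add (hmono (ξ / 3) v)).add (hmono (ξ / 3) w)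
    have key := lintegral_comp_mul_deriv_pos_le
      (k := fun s => |ξ / 3 + s * u| ^ p + |ξ / 3 + s * v| ^ p + |ξ / 3 + s * w| ^ p)
      (fun s => ((hd (ξ / 3) u s).add (hd (ξ / 3) v s)).add (hd (ξ / 3) w s))
      hkm (fun τ => g (ξ, τ))
    refine le_trans ?_ (mul_le_mul_right key (ENNReal.ofReal B))
    have hpos := measurableSet_lt (measurable_const (a := (0 : ℝ))) hkm.measurable
    rw [← lintegral_const_mul' _ _ ENNReal.ofReal_ne_top,
      ← lintegral_indicator measurableSet_Ioi, ← lintegral_indicator hpos]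
    refine lintegral_mono fun r => ?_
    by_cases hr : r ∈ Set.Ioi (0 : ℝ)
    swap
    · rw [Set.indicator_of_notMem hr]; exact zero_le
    have hr0 : 0 < r := hr
    rw [Set.indicator_of_mem hr]
    have hyy : (ξ / 3 + (α * (r * Real.cos θ) + β * (r * Real.sin θ)),
        ξ / 3 + (-α * (r * Real.cos θ) + β * (r * Real.sin θ)),
        ξ / 3 + -2 * β * (r * Real.sin θ)) = (ξ / 3 + r * u, ξ / 3 + r * v, ξ / 3 + r * w) := by
      rw [hu, hv, hw]; simp only [Prod.mk.injEq]
      refine ⟨by ring, by ring, by ring⟩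
    rw [hyy]
    set y : ℝ × ℝ × ℝ := (ξ / 3 + r * u, ξ / 3 + r * v, ξ / 3 + r * w) with hy
    by_cases hyE : y ∈ E
    swap
    · rw [hG, Set.indicator_of_notMem hyE, mul_zero]; exact zero_le
    have h1 := hE y hyE
    have hmean : mean y = ξ / 3 := by
      simp only [mean, hy]
      linear_combination (r / 3) * huvw
    rw [hmean] at h1
    simp only [hy, add_sub_cancel_left] at h1
    rw [← hy] at h1
    have h2 : (r * u) ^ 2 + (r * v) ^ 2 + (r * w) ^ 2 = r * r := by
      linear_combination r ^ 2 * hsq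
    set k' := u * slope p (ξ / 3 + r * u) + v * slope p (ξ / 3 + r * v) +
      w * slope p (ξ / 3 + r * w) with hk'
    have h3 : weight p y ^ 2 * r ≤ B * k' := by
      rw [h2] at h1
      have h4 : r * (weight p y ^ 2 * r) ≤ r * (B * k') := by rw [hk']; linarith
      exact le_of_mul_le_mul_left h4 hr0
    rw [hG, Set.indicator_of_mem hyE]
    have hcs : curveSum p y =
        (ξ, |ξ / 3 + r * u| ^ p + |ξ / 3 + r * v| ^ p + |ξ / 3 + r * w| ^ p) := by
      simp only [curveSum, hy, Prod.mk.injEq, and_true]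
      linear_combination r * huvw
    rw [hcs]
    have h5 : ENNReal.ofReal r * ENNReal.ofReal (weight p y ^ 2) ≤ ENNReal.ofReal (B * k') := by
      rw [← ENNReal.ofReal_mul hr0.le, mul_comm]
      exact ENNReal.ofReal_le_ofReal h3
    by_cases hkpos : 0 < k'
    · rw [Set.indicator_of_mem (by exact hkpos)]
      calc _ = g (ξ, |ξ / 3 + r * u| ^ p + |ξ / 3 + r * v| ^ p + |ξ / 3 + r * w| ^ p) *
            (ENNReal.ofReal r * ENNReal.ofReal (weight p y ^ 2)) := by ring
        _ ≤ g (ξ, |ξ / 3 + r * u| ^ p + |ξ / 3 + r * v| ^ p + |ξ / 3 + r * w| ^ p) *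
            ENNReal.ofReal (B * k') := by gcongr
        _ = _ := by
          have hab : |k'| = k' := abs_of_pos hkpos
          rw [ENNReal.ofReal_mul hB, ← hab, hk']; ring
    · have h6 : ENNReal.ofReal (B * k') = 0 :=
        ENNReal.ofReal_of_nonpos (mul_nonpos_of_nonneg_of_nonpos hB (not_lt.1 hkpos))
      rw [h6] at h5
      calc _ = g (ξ, |ξ / 3 + r * u| ^ p + |ξ / 3 + r * v| ^ p + |ξ / 3 + r * w| ^ p) *
            (ENNReal.ofReal r * ENNReal.ofReal (weight p y ^ 2)) := by ring
        _ = 0 := by rw [le_zero_iff.1 h5, mul_zero]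
        _ ≤ _ := zero_le
  have hpolar : ∀ ξ : ℝ, ∫⁻ q : ℝ × ℝ, G (ξ / 3 + (α * q.1 + β * q.2),
      ξ / 3 + (-α * q.1 + β * q.2), ξ / 3 + -2 * β * q.2) ≤
      ENNReal.ofReal (2 * Real.pi) * (ENNReal.ofReal B * ∫⁻ τ, g (ξ, τ)) := by
    intro ξ
    rw [← lintegral_comp_polarCoord_symm]
    have hm : Measurable fun q : ℝ × ℝ => ENNReal.ofReal q.1 *
        G (ξ / 3 + (α * (q.1 * Real.cos q.2) + β * (q.1 * Real.sin q.2)),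
          ξ / 3 + (-α * (q.1 * Real.cos q.2) + β * (q.1 * Real.sin q.2)),
          ξ / 3 + -2 * β * (q.1 * Real.sin q.2)) := by
      refine Measurable.mul (by fun_prop) (hGm.comp (by fun_prop))
    rw [polarCoord_target, Measure.volume_eq_prod, ← Measure.prod_restrict,
      lintegral_prod_symm]
    · simp only [polarCoord_symm_apply, smul_eq_mul]
      calc _ ≤ ∫⁻ θ in Set.Ioo (-Real.pi) Real.pi, ENNReal.ofReal B * ∫⁻ τ, g (ξ, τ) :=
            lintegral_mono fun θ => hray ξ θ
        _ = _ := by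
            rw [setLIntegral_const, Real.volume_Ioo, mul_comm]
            congr 2; ring
    · exact hm.aemeasurable
  calc _ ≤ ENNReal.ofReal (1 / √3) *
        ∫⁻ ξ, ENNReal.ofReal (2 * Real.pi) * (ENNReal.ofReal B * ∫⁻ τ, g (ξ, τ)) := by
        gcongr with ξ
        exact hpolar ξ
    _ = ENNReal.ofReal (1 / √3) * (ENNReal.ofReal (2 * Real.pi) * (ENNReal.ofReal B *
        ∫⁻ z, g z)) := by
        rw [lintegral_const_mul' _ _ ENNReal.ofReal_ne_top,
          lintegral_const_mul' _ _ ENNReal.ofReal_ne_top, Measure.volume_eq_prod,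
          lintegral_prod _ hg.aemeasurable]
    _ = _ := by
        rw [← mul_assoc, ← mul_assoc, ← ENNReal.ofReal_mul (by positivity),
          ← ENNReal.ofReal_mul (by positivity)]
        congr 2; ring

/-! ### Pointwise estimates for the weight and the slope -/

lemma rpow_le_of_mem_Icc {κ Y t : ℝ} (e : ℝ) (hκ : 0 < κ) (hY : 0 < Y)
    (h1 : κ * Y ≤ t) (h2 : t ≤ Y) : t ^ e ≤ κ ^ (-|e|) * Y ^ e := by
  have ht : 0 < t := lt_of_lt_of_le (by positivity) h1
  have hu : t = t / Y * Y := by field_simp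
  have hu0 : 0 < t / Y := by positivity
  have hu1 : t / Y ≤ 1 := (div_le_one hY).2 h2
  have hu2 : κ ≤ t / Y := (le_div_iff₀ hY).2 h1
  rw [hu, Real.mul_rpow hu0.le hY.le]
  gcongr
  calc (t / Y) ^ e ≤ (t / Y) ^ (-|e|) :=
        Real.rpow_le_rpow_of_exponent_ge hu0 hu1 (neg_abs_le e)
    _ ≤ κ ^ (-|e|) := Real.rpow_le_rpow_of_nonpos hκ hu2 (by simp)

lemma le_rpow_of_mem_Icc {κ Y t : ℝ} (e : ℝ) (hκ : 0 < κ) (hY : 0 < Y)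
    (h1 : κ * Y ≤ t) (h2 : t ≤ Y) : κ ^ |e| * Y ^ e ≤ t ^ e := by
  have ht : 0 < t := lt_of_lt_of_le (by positivity) h1
  have h := rpow_le_of_mem_Icc (-e) hκ hY h1 h2
  rw [abs_neg, Real.rpow_neg ht.le, Real.rpow_neg hκ.le, Real.rpow_neg hY.le, ← mul_inv] at h
  exact (inv_le_inv₀ (by positivity) (by positivity)).1 h

lemma weight_sq {p : ℝ} (y : ℝ × ℝ × ℝ) :
    weight p y ^ 2 = |y.1| ^ ((p - 2) / 3) * |y.2.1| ^ ((p - 2) / 3) * |y.2.2| ^ ((p - 2) / 3) := by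
  have h : ∀ x : ℝ, (|x| ^ ((p - 2) / 6)) ^ 2 = |x| ^ ((p - 2) / 3) := fun x => by
    rw [← Real.rpow_natCast, ← Real.rpow_mul (abs_nonneg x)]; congr 1; push_cast; ring
  rw [weight, mul_pow, mul_pow, h, h, h]

/-- The derivative of the slope is comparable to `Y^(p-2)` on `[κY, Y]`. -/
lemma slope_sub_mul_ge {p : ℝ} (hp : 1 < p) {κ Y x z : ℝ} (hκ : 0 < κ) (hY : 0 < Y)
    (hx : κ * Y ≤ x) (hx' : x ≤ Y) (hz : κ * Y ≤ z) (hz' : z ≤ Y) :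
    p * (p - 1) * (κ ^ |p - 2| * Y ^ (p - 2)) * (x - z) ^ 2 ≤
      (slope p x - slope p z) * (x - z) := by
  wlog hxz : z < x generalizing x z
  · rcases (not_lt.1 hxz).eq_or_lt with h | h
    · simp [h]
    · linarith [this hz hz' hx hx' h]
  have hκY : 0 < κ * Y := by positivity
  have hd : ∀ t : ℝ, 0 < t → HasDerivAt (slope p) (p * (p - 1) * t ^ (p - 2)) t := by
    intro t ht
    have h1 : HasDerivAt (fun t : ℝ => p * t ^ (p - 1)) (p * (p - 1) * t ^ (p - 2)) t := by
      have := (Real.hasDerivAt_rpow_const (p := p - 1) (Or.inl ht.ne')).const_mul p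
      rw [show p - 1 - 1 = p - 2 by ring, ← mul_assoc] at this
      exact this
    exact h1.congr_of_eventuallyEq
      ((eventually_gt_nhds ht).mono fun s hs => slope_of_pos hs)
  obtain ⟨t, ⟨ht1, ht2⟩, ht⟩ := exists_hasDerivAt_eq_slope (slope p)
    (fun t => p * (p - 1) * t ^ (p - 2)) hxz (continuous_slope hp).continuousOn
    (fun t ht => hd t (by linarith [ht.1]))
  have h2 := le_rpow_of_mem_Icc (p - 2) hκ hY (by linarith : κ * Y ≤ t) (by linarith)
  have h3 : slope p x - slope p z = p * (p - 1) * t ^ (p - 2) * (x - z) := by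
    have : x - z ≠ 0 := by linarith
    rw [ht]; field_simp
  have hpp : 0 < p * (p - 1) := by nlinarith
  rw [h3, mul_assoc _ (x - z) (x - z), ← sq]
  gcongr

/-- Quantitative strict monotonicity of the slope, by compactness and homogeneity. -/
lemma exists_slope_sub_ge {p : ℝ} (hp : 1 < p) {ρ : ℝ} (hρ : 0 < ρ) :
    ∃ c > 0, ∀ Y x z : ℝ, 0 < Y → |x| ≤ Y → |z| ≤ Y → ρ * Y ≤ |x - z| →
      c * Y ^ (p - 1) ≤ |slope p x - slope p z| := by
  set S : Set (ℝ × ℝ) := (Set.Icc (-1) 1 ×ˢ Set.Icc (-1) 1) ∩ {q | ρ ≤ |q.1 - q.2|} with hS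
  have hSc : IsCompact S := (isCompact_Icc.prod isCompact_Icc).inter_right
    (isClosed_le continuous_const (by fun_prop))
  have hcont : Continuous fun q : ℝ × ℝ => |slope p q.1 - slope p q.2| := by
    have := continuous_slope hp
    fun_prop
  have hmem : ∀ Y x z : ℝ, 0 < Y → |x| ≤ Y → |z| ≤ Y → ρ * Y ≤ |x - z| → (x / Y, z / Y) ∈ S := by
    intro Y x z hY hx hz hxz
    have h1 : ∀ x : ℝ, |x| ≤ Y → x / Y ∈ Set.Icc (-1 : ℝ) 1 := fun x hx => by
      rw [Set.mem_Icc, ← abs_le, abs_div, abs_of_pos hY]; exact (div_le_one hY).2 hx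
    refine ⟨⟨h1 x hx, h1 z hz⟩, ?_⟩
    simp only [Set.mem_ofPred_eq]
    rw [← sub_div, abs_div, abs_of_pos hY]
    exact (le_div_iff₀ hY).2 hxz
  rcases S.eq_empty_or_nonempty with hem | hne
  · refine ⟨1, one_pos, fun Y x z hY hx hz hxz => ?_⟩
    have := hmem Y x z hY hx hz hxz
    rw [hem] at this
    exact this.elim
  obtain ⟨q, hq, hmin⟩ := hSc.exists_isMinOn hne hcont.continuousOn
  refine ⟨|slope p q.1 - slope p q.2|, ?_, fun Y x z hY hx hz hxz => ?_⟩
  · have hne : q.1 ≠ q.2 := by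
      intro h
      have := hq.2
      simp only [Set.mem_ofPred_eq, h, sub_self, abs_zero] at this
      linarith
    exact abs_pos.2 (sub_ne_zero.2 fun h => hne ((slope_strictMono hp).injective h))
  · have h1 := hmin (hmem Y x z hY hx hz hxz)
    simp only [Set.mem_ofPred_eq] at h1
    have hx2 : slope p x = Y ^ (p - 1) * slope p (x / Y) := by
      rw [← slope_mul hY]; congr 1; field_simp
    have hz2 : slope p z = Y ^ (p - 1) * slope p (z / Y) := by
      rw [← slope_mul hY]; congr 1; field_simp
    rw [hx2, hz2, ← mul_sub, abs_mul, abs_of_pos (Real.rpow_pos_of_pos hY _), mul_comm]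
    gcongr

/-! ### Bounds for the push-forward measure on parts of space -/

lemma CurveBound.mono {p : ℝ} {E F : Set (ℝ × ℝ × ℝ)} {K L : ℝ≥0∞} (h : CurveBound p F L)
    (hEF : E ⊆ F) (hKL : L ≤ K) : CurveBound p E K := fun g hg =>
  (lintegral_mono_set hEF).trans ((h g hg).trans (by gcongr))

lemma CurveBound.union {p : ℝ} {E F : Set (ℝ × ℝ × ℝ)} {K L : ℝ≥0∞} (h : CurveBound p E K)
    (h' : CurveBound p F L) : CurveBound p (E ∪ F) (K + L) := fun g hg => by
  rw [add_mul]
  exact (lintegral_union_le _ _ _).trans (add_le_add (h g hg) (h' g hg))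

lemma measurePreserving_swapFst :
    MeasurePreserving (fun y : ℝ × ℝ × ℝ => (y.2.1, y.1, y.2.2)) volume volume := by
  refine ⟨by fun_prop, ?_⟩
  have h1 : (fun y : ℝ × ℝ × ℝ => (y.2.1, y.1, y.2.2)) =
    (MeasurableEquiv.prodAssoc : (ℝ × ℝ) × ℝ ≃ᵐ _) ∘ (Prod.map Prod.swap id) ∘
      (MeasurableEquiv.prodAssoc : (ℝ × ℝ) × ℝ ≃ᵐ _).symm := by
    funext y; rfl
  rw [h1]
  have ha : MeasurePreserving (MeasurableEquiv.prodAssoc : (ℝ × ℝ) × ℝ ≃ᵐ _) volume volume :=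
    volume_preserving_prodAssoc
  have hs : MeasurePreserving (Prod.map Prod.swap id : (ℝ × ℝ) × ℝ → (ℝ × ℝ) × ℝ)
      volume volume :=
    (Measure.measurePreserving_swap (μ := (volume : Measure ℝ)) (ν := (volume : Measure ℝ))).prod
      (MeasurePreserving.id volume)
  exact (ha.comp (hs.comp ha.symm)).map_eq

lemma measurableEmbedding_swapFst :
    MeasurableEmbedding (fun y : ℝ × ℝ × ℝ => (y.2.1, y.1, y.2.2)) :=
  MeasurableEmbedding.of_measurable_inverse (g := fun y : ℝ × ℝ × ℝ => (y.2.1, y.1, y.2.2))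
    (by fun_prop) (by
      have : Set.range (fun y : ℝ × ℝ × ℝ => (y.2.1, y.1, y.2.2)) = Set.univ :=
        Set.range_eq_univ.2 fun y => ⟨(y.2.1, y.1, y.2.2), rfl⟩
      rw [this]; exact MeasurableSet.univ) (by fun_prop) (fun y => rfl)

lemma measurePreserving_swapSnd :
    MeasurePreserving (fun y : ℝ × ℝ × ℝ => (y.1, y.2.2, y.2.1)) volume volume :=
  (MeasurePreserving.id volume).prod
    (Measure.measurePreserving_swap (μ := (volume : Measure ℝ)) (ν := (volume : Measure ℝ)))

lemma measurableEmbedding_swapSnd :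
    MeasurableEmbedding (fun y : ℝ × ℝ × ℝ => (y.1, y.2.2, y.2.1)) :=
  MeasurableEmbedding.of_measurable_inverse (g := fun y : ℝ × ℝ × ℝ => (y.1, y.2.2, y.2.1))
    (by fun_prop) (by
      have : Set.range (fun y : ℝ × ℝ × ℝ => (y.1, y.2.2, y.2.1)) = Set.univ :=
        Set.range_eq_univ.2 fun y => ⟨(y.1, y.2.2, y.2.1), rfl⟩
      rw [this]; exact MeasurableSet.univ) (by fun_prop) (fun y => rfl)

lemma curveSum_swapFst (p : ℝ) (y : ℝ × ℝ × ℝ) :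
    curveSum p (y.2.1, y.1, y.2.2) = curveSum p y := by
  simp only [curveSum, Prod.mk.injEq]; constructor <;> ring

lemma weight_swapFst (p : ℝ) (y : ℝ × ℝ × ℝ) : weight p (y.2.1, y.1, y.2.2) = weight p y := by
  simp only [weight]; ring

lemma curveSum_swapSnd (p : ℝ) (y : ℝ × ℝ × ℝ) :
    curveSum p (y.1, y.2.2, y.2.1) = curveSum p y := by
  simp only [curveSum, Prod.mk.injEq]; constructor <;> ring

lemma weight_swapSnd (p : ℝ) (y : ℝ × ℝ × ℝ) : weight p (y.1, y.2.2, y.2.1) = weight p y := by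
  simp only [weight]; ring

lemma CurveBound.swap_fst {p : ℝ} {E : Set (ℝ × ℝ × ℝ)} {K : ℝ≥0∞} (h : CurveBound p E K) :
    CurveBound p ((fun y : ℝ × ℝ × ℝ => (y.2.1, y.1, y.2.2)) ⁻¹' E) K := fun g hg => by
  refine le_trans (le_of_eq ?_) (h g hg)
  rw [← measurePreserving_swapFst.setLIntegral_comp_preimage_emb measurableEmbedding_swapFst]
  refine lintegral_congr fun y => ?_
  rw [curveSum_swapFst, weight_swapFst]

lemma CurveBound.swap_snd {p : ℝ} {E : Set (ℝ × ℝ × ℝ)} {K : ℝ≥0∞} (h : CurveBound p E K) :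
    CurveBound p ((fun y : ℝ × ℝ × ℝ => (y.1, y.2.2, y.2.1)) ⁻¹' E) K := fun g hg => by
  refine le_trans (le_of_eq ?_) (h g hg)
  rw [← measurePreserving_swapSnd.setLIntegral_comp_preimage_emb measurableEmbedding_swapSnd]
  refine lintegral_congr fun y => ?_
  rw [curveSum_swapSnd, weight_swapSnd]

lemma CurveBound.of_ae {p : ℝ} {E F : Set (ℝ × ℝ × ℝ)} {K : ℝ≥0∞} (h : CurveBound p F K)
    (hEF : ∀ᵐ y : ℝ × ℝ × ℝ, y ∈ E → y ∈ F) : CurveBound p E K := fun g hg =>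
  (lintegral_mono' (Measure.restrict_mono_ae hEF) le_rfl).trans (h g hg)

lemma ae_generic : ∀ᵐ y : ℝ × ℝ × ℝ, y.1 ≠ 0 ∧ y.2.1 ≠ 0 ∧ y.2.2 ≠ 0 ∧ y.2.1 ≠ y.2.2 := by
  have h1 : ∀ᵐ x : ℝ, x ≠ 0 := by simp [ae_iff]
  have h2 : ∀ᵐ q : ℝ × ℝ, q.1 ≠ q.2 := by
    rw [Measure.volume_eq_prod, Measure.ae_prod_iff_ae_ae]
    · refine Eventually.of_forall fun x => ?_
      simp [ae_iff]
    · exact (measurableSet_eq_fun (by fun_prop) (by fun_prop)).compl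
  have hf : ∀ᵐ y : ℝ × ℝ × ℝ, y.1 ≠ 0 := Measure.quasiMeasurePreserving_fst.ae h1
  have hs : ∀ᵐ y : ℝ × ℝ × ℝ, y.2.1 ≠ 0 ∧ y.2.2 ≠ 0 ∧ y.2.1 ≠ y.2.2 := by
    refine Measure.quasiMeasurePreserving_snd.ae (p := fun q : ℝ × ℝ => q.1 ≠ 0 ∧ q.2 ≠ 0 ∧
      q.1 ≠ q.2) ?_
    have h3 : ∀ᵐ q : ℝ × ℝ, q.1 ≠ 0 := Measure.quasiMeasurePreserving_fst.ae h1
    have h4 : ∀ᵐ q : ℝ × ℝ, q.2 ≠ 0 := Measure.quasiMeasurePreserving_snd.ae h1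
    filter_upwards [h2, h3, h4] with q h2 h3 h4 using ⟨h3, h4, h2⟩
  filter_upwards [hf, hs] with y h1 h2 using ⟨h1, h2.1, h2.2.1, h2.2.2⟩

lemma lintegral_abs_rpow_Icc {e A : ℝ} (he : -1 < e) (hA : 0 ≤ A) :
    ∫⁻ v in Set.Icc (-A) A, ENNReal.ofReal (|v| ^ e) = ENNReal.ofReal (2 * A ^ (e + 1) / (e + 1)) := by
  have hpos : ∫⁻ v in Set.Ioc 0 A, ENNReal.ofReal (|v| ^ e) =
      ENNReal.ofReal (A ^ (e + 1) / (e + 1)) := by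
    have hint := intervalIntegral.intervalIntegrable_rpow' (a := 0) (b := A) he
    rw [intervalIntegrable_iff_integrableOn_Ioc_of_le hA] at hint
    have h1 : ∫⁻ v in Set.Ioc 0 A, ENNReal.ofReal (|v| ^ e) =
        ∫⁻ v in Set.Ioc 0 A, ENNReal.ofReal (v ^ e) :=
      setLIntegral_congr_fun measurableSet_Ioc fun v hv => by rw [abs_of_pos hv.1]
    rw [h1, ← ofReal_integral_eq_lintegral_ofReal hint
      ((ae_restrict_iff' measurableSet_Ioc).2 (Eventually.of_forall fun v hv =>
        Real.rpow_nonneg hv.1.le _)), ← intervalIntegral.integral_of_le hA,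
      integral_rpow (Or.inl he), Real.zero_rpow (by linarith), sub_zero]
  have hneg : ∫⁻ v in Set.Ico (-A) 0, ENNReal.ofReal (|v| ^ e) =
      ENNReal.ofReal (A ^ (e + 1) / (e + 1)) := by
    rw [← hpos, ← lintegral_indicator measurableSet_Ioc, ← lintegral_indicator measurableSet_Ico,
      ← lintegral_neg_eq_self ((Set.Ioc 0 A).indicator _)]
    refine lintegral_congr fun v => ?_
    have : v ∈ Set.Ico (-A) 0 ↔ -v ∈ Set.Ioc 0 A := by
      simp only [Set.mem_Ico, Set.mem_Ioc]
      constructor <;> rintro ⟨h1, h2⟩ <;> constructor <;> linarith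
    by_cases hv : v ∈ Set.Ico (-A) 0
    · rw [Set.indicator_of_mem hv, Set.indicator_of_mem (this.1 hv), abs_neg]
    · rw [Set.indicator_of_notMem hv, Set.indicator_of_notMem (fun h => hv (this.2 h))]
  have hu : Set.Icc (-A) A =ᵐ[volume] (Set.Ico (-A) 0 ∪ Set.Ioc 0 A : Set ℝ) := by
    have h0 : ∀ᵐ v : ℝ, v ≠ 0 := by simp [ae_iff]
    filter_upwards [h0] with v hv
    apply propext
    change v ∈ Set.Icc (-A) A ↔ v ∈ (Set.Ico (-A) 0 ∪ Set.Ioc 0 A : Set ℝ)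
    simp only [Set.mem_Icc, Set.mem_union, Set.mem_Ico, Set.mem_Ioc]
    constructor
    · rintro ⟨h1, h2⟩
      rcases lt_or_gt_of_ne hv with h | h
      · exact Or.inl ⟨h1, h⟩
      · exact Or.inr ⟨h, h2⟩
    · rintro (⟨h1, h2⟩ | ⟨h1, h2⟩) <;> constructor <;> linarith
  rw [setLIntegral_congr hu, lintegral_union measurableSet_Ioc (by
    rw [Set.disjoint_left]; rintro v ⟨_, h1⟩ ⟨h2, _⟩; linarith), hneg, hpos, ← ENNReal.ofReal_add
    (by have : 0 < e + 1 := by linarith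
        positivity) (by have : 0 < e + 1 := by linarith
                        positivity)]
  congr 1; ring

/-- The homogeneous power-law factor in the estimates along lines. -/
def powerFactor (C e δ v t : ℝ) : ℝ≥0∞ :=
  (Set.Icc (-(δ * t)) (δ * t)).indicator (fun v => ENNReal.ofReal (C * |v| ^ e * t ^ (-e - 1))) v

lemma measurable_powerFactor (C e δ : ℝ) :
    Measurable (Function.uncurry (powerFactor C e δ)) := by
  have : Function.uncurry (powerFactor C e δ) =
      {q : ℝ × ℝ | -(δ * q.2) ≤ q.1 ∧ q.1 ≤ δ * q.2}.indicator
        (fun q => ENNReal.ofReal (C * |q.1| ^ e * q.2 ^ (-e - 1))) := by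
    funext q; rfl
  rw [this]
  refine Measurable.indicator (by fun_prop) ?_
  have h1 : MeasurableSet {q : ℝ × ℝ | -(δ * q.2) ≤ q.1} :=
    measurableSet_le (by fun_prop) (by fun_prop)
  have h2 : MeasurableSet {q : ℝ × ℝ | q.1 ≤ δ * q.2} :=
    measurableSet_le (by fun_prop) (by fun_prop)
  exact h1.inter h2

lemma lintegral_powerFactor_le {C e δ t : ℝ} (hC : 0 ≤ C) (he : -1 < e) (hδ : 0 ≤ δ) (ht : 0 ≤ t) :
    ∫⁻ v, powerFactor C e δ v t ≤ ENNReal.ofReal (C * (2 * δ ^ (e + 1) / (e + 1))) := by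
  have he1 : 0 < e + 1 := by linarith
  unfold powerFactor
  rw [lintegral_indicator measurableSet_Icc]
  have h1 : ∀ v : ℝ, ENNReal.ofReal (C * |v| ^ e * t ^ (-e - 1)) =
      ENNReal.ofReal (C * t ^ (-e - 1)) * ENNReal.ofReal (|v| ^ e) := fun v => by
    rw [← ENNReal.ofReal_mul (by positivity)]; congr 1; ring
  simp_rw [h1]
  rw [lintegral_const_mul' _ _ ENNReal.ofReal_ne_top, lintegral_abs_rpow_Icc he (by positivity),
    ← ENNReal.ofReal_mul (by positivity)]
  apply ENNReal.ofReal_le_ofReal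
  rw [Real.mul_rpow hδ ht]
  rcases ht.eq_or_lt with rfl | ht
  · rw [Real.zero_rpow he1.ne']; simp; positivity
  · have : t ^ (-e - 1) * t ^ (e + 1) = 1 := by
      rw [← Real.rpow_add ht]; ring_nf; exact Real.rpow_zero t
    have h2 : C * t ^ (-e - 1) * (2 * (δ ^ (e + 1) * t ^ (e + 1)) / (e + 1)) =
      C * (2 * δ ^ (e + 1) / (e + 1)) * (t ^ (-e - 1) * t ^ (e + 1)) := by ring
    rw [h2, this, mul_one]

lemma ofReal_le_powerFactor_mul {C e δ v t x s : ℝ} (hC : 0 ≤ C) (ht : 0 ≤ t)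
    (hv : |v| ≤ δ * t) (h : x ≤ C * |v| ^ e * t ^ (-e - 1) * s) :
    ENNReal.ofReal x ≤ powerFactor C e δ v t * ENNReal.ofReal s := by
  rw [powerFactor, Set.indicator_of_mem (Set.mem_Icc.2 (abs_le.1 hv)), ← ENNReal.ofReal_mul (by positivity)]
  exact ENNReal.ofReal_le_ofReal h

lemma size_nonneg (p : ℝ) (y : ℝ × ℝ × ℝ) : 0 ≤ size p y := by unfold size; positivity

lemma curveBound_of_fst_rpow {p : ℝ} (hp : 1 < p) {E : Set (ℝ × ℝ × ℝ)} (hEm : MeasurableSet E)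
    {C e δ : ℝ} (hC : 0 ≤ C) (he : -1 < e) (hδ : 0 ≤ δ)
    (hE : ∀ y ∈ E, |y.1| ≤ δ * size p y ∧ weight p y ^ 2 ≤
      C * |y.1| ^ e * size p y ^ (-e - 1) * |slope p y.2.2 - slope p y.2.1|) :
    CurveBound p E (2 * ENNReal.ofReal (C * (2 * δ ^ (e + 1) / (e + 1)))) :=
  curveBound_of_fst hp hEm _ (measurable_powerFactor C e δ)
    (fun _ ht => lintegral_powerFactor_le hC he hδ ht)
    fun y hy => ofReal_le_powerFactor_mul hC (size_nonneg p y) (hE y hy).1 (hE y hy).2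

lemma curveBound_of_sub_rpow {p : ℝ} (hp : 1 < p) {E : Set (ℝ × ℝ × ℝ)} (hEm : MeasurableSet E)
    {C e δ : ℝ} (hC : 0 ≤ C) (he : -1 < e) (hδ : 0 ≤ δ)
    (hE : ∀ y ∈ E, |y.2.1 - y.2.2| ≤ δ * size p y ∧ weight p y ^ 2 ≤
      C * |y.2.1 - y.2.2| ^ e * size p y ^ (-e - 1) *
        |slope p y.2.1 + slope p y.2.2 - 2 * slope p y.1|) :
    CurveBound p E (2 * ENNReal.ofReal (C * (2 * δ ^ (e + 1) / (e + 1)))) :=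
  curveBound_of_sub hp hEm _ (measurable_powerFactor C e δ)
    (fun _ ht => lintegral_powerFactor_le hC he hδ ht)
    fun y hy => ofReal_le_powerFactor_mul hC (size_nonneg p y) (hE y hy).1 (hE y hy).2

/-! ### Close, separated and far abscissae -/

/-- The largest absolute value of the three abscissae. -/
def maxAbs (y : ℝ × ℝ × ℝ) : ℝ := max |y.1| (max |y.2.1| |y.2.2|)

/-- The smallest absolute value of the three abscissae. -/
def minAbs (y : ℝ × ℝ × ℝ) : ℝ := min |y.1| (min |y.2.1| |y.2.2|)

/-- All three abscissae are equal up to the relative error `ρ`. -/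
def closeSet (ρ : ℝ) : Set (ℝ × ℝ × ℝ) :=
  {y | |y.1 - y.2.1| ≤ ρ * maxAbs y ∧ |y.1 - y.2.2| ≤ ρ * maxAbs y ∧
    |y.2.1 - y.2.2| ≤ ρ * maxAbs y}

/-- The abscissae are comparable, and the last two are separated. -/
def sepSet (ρ R : ℝ) : Set (ℝ × ℝ × ℝ) :=
  {y | ρ * maxAbs y < |y.2.1 - y.2.2| ∧ maxAbs y ≤ R * minAbs y}

/-- The abscissae are not comparable. -/
def farSet (R : ℝ) : Set (ℝ × ℝ × ℝ) := {y | R * minAbs y < maxAbs y}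

/-- The part of `farSet R` where the absolute values of the abscissae are ordered. -/
def farOrdSet (R : ℝ) : Set (ℝ × ℝ × ℝ) :=
  {y | |y.1| ≤ |y.2.1| ∧ |y.2.1| ≤ |y.2.2| ∧ R * |y.1| < |y.2.2|}

@[fun_prop]
lemma measurable_maxAbs : Measurable maxAbs := by unfold maxAbs; fun_prop

@[fun_prop]
lemma measurable_minAbs : Measurable minAbs := by unfold minAbs; fun_prop

lemma measurableSet_closeSet (ρ : ℝ) : MeasurableSet (closeSet ρ) :=
  (measurableSet_le (f := fun y : ℝ × ℝ × ℝ => |y.1 - y.2.1|) (by fun_prop) (by fun_prop)).inter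
    ((measurableSet_le (f := fun y : ℝ × ℝ × ℝ => |y.1 - y.2.2|) (by fun_prop) (by fun_prop)).inter
    (measurableSet_le (f := fun y : ℝ × ℝ × ℝ => |y.2.1 - y.2.2|) (by fun_prop) (by fun_prop)))

lemma measurableSet_sepSet (ρ R : ℝ) : MeasurableSet (sepSet ρ R) :=
  (measurableSet_lt (g := fun y : ℝ × ℝ × ℝ => |y.2.1 - y.2.2|) (by fun_prop) (by fun_prop)).inter
    (measurableSet_le (f := maxAbs) (g := fun y => R * minAbs y) (by fun_prop) (by fun_prop))

lemma measurableSet_farSet (R : ℝ) : MeasurableSet (farSet R) :=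
  measurableSet_lt (f := fun y => R * minAbs y) (g := maxAbs) (by fun_prop) (by fun_prop)

lemma measurableSet_farOrdSet (R : ℝ) : MeasurableSet (farOrdSet R) :=
  (measurableSet_le (f := fun y : ℝ × ℝ × ℝ => |y.1|) (g := fun y => |y.2.1|)
    (by fun_prop) (by fun_prop)).inter
    ((measurableSet_le (f := fun y : ℝ × ℝ × ℝ => |y.2.1|) (g := fun y => |y.2.2|)
      (by fun_prop) (by fun_prop)).inter
    (measurableSet_lt (f := fun y : ℝ × ℝ × ℝ => R * |y.1|) (g := fun y => |y.2.2|)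
      (by fun_prop) (by fun_prop)))

lemma abs_le_maxAbs (y : ℝ × ℝ × ℝ) :
    |y.1| ≤ maxAbs y ∧ |y.2.1| ≤ maxAbs y ∧ |y.2.2| ≤ maxAbs y :=
  ⟨le_max_left _ _, (le_max_left _ _).trans (le_max_right _ _),
    (le_max_right _ _).trans (le_max_right _ _)⟩

lemma minAbs_le_abs (y : ℝ × ℝ × ℝ) :
    minAbs y ≤ |y.1| ∧ minAbs y ≤ |y.2.1| ∧ minAbs y ≤ |y.2.2| :=
  ⟨min_le_left _ _, (min_le_right _ _).trans (min_le_left _ _),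
    (min_le_right _ _).trans (min_le_right _ _)⟩

lemma maxAbs_nonneg (y : ℝ × ℝ × ℝ) : 0 ≤ maxAbs y := (abs_nonneg _).trans (abs_le_maxAbs y).1

lemma maxAbs_le_size {p : ℝ} (hp : 1 < p) (y : ℝ × ℝ × ℝ) : maxAbs y ≤ size p y := by
  have hp0 : p ≠ 0 := by linarith
  have h1 : 0 ≤ |y.1| ^ p := by positivity
  have h2 : 0 ≤ |y.2.1| ^ p := by positivity
  have h3 : 0 ≤ |y.2.2| ^ p := by positivity
  have key : ∀ x : ℝ, |x| ^ p ≤ |y.1| ^ p + |y.2.1| ^ p + |y.2.2| ^ p → |x| ≤ size p y := by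
    intro x hx
    calc |x| = (|x| ^ p) ^ (1 / p) := by
          rw [← Real.rpow_mul (abs_nonneg x), mul_one_div_cancel hp0, Real.rpow_one]
      _ ≤ _ := by
          unfold size
          exact Real.rpow_le_rpow (by positivity) hx (by positivity)
  exact max_le (key _ (by linarith)) (max_le (key _ (by linarith)) (key _ (by linarith)))

lemma size_le_three_mul_maxAbs {p : ℝ} (hp : 1 < p) (y : ℝ × ℝ × ℝ) :
    size p y ≤ 3 * maxAbs y := by
  have hp0 : p ≠ 0 := by linarith
  have hY := maxAbs_nonneg y
  obtain ⟨h1, h2, h3⟩ := abs_le_maxAbs y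
  have key : ∀ x : ℝ, |x| ≤ maxAbs y → |x| ^ p ≤ maxAbs y ^ p := fun x hx =>
    Real.rpow_le_rpow (abs_nonneg x) hx (by linarith)
  have h4 : |y.1| ^ p + |y.2.1| ^ p + |y.2.2| ^ p ≤ (3 * maxAbs y) ^ p := by
    have h5 : (3 : ℝ) ≤ 3 ^ p := by
      calc (3 : ℝ) = 3 ^ (1 : ℝ) := (Real.rpow_one 3).symm
        _ ≤ 3 ^ p := Real.rpow_le_rpow_of_exponent_le (by norm_num) hp.le
    rw [Real.mul_rpow (by norm_num) hY]
    have h6 : 0 ≤ maxAbs y ^ p := by positivity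
    nlinarith [key _ h1, key _ h2, key _ h3]
  calc size p y ≤ ((3 * maxAbs y) ^ p) ^ (1 / p) := by
        unfold size
        exact Real.rpow_le_rpow (by positivity) h4 (by positivity)
    _ = _ := by rw [← Real.rpow_mul (by positivity), mul_one_div_cancel hp0, Real.rpow_one]

/-- The critical value of the sixth power of the optimal constant: the density at the diagonal of
the push-forward of `weight p ^ 2`, and the limit of the quotients for concentrating Gaussians. -/
def concConst (p : ℝ) : ℝ := 2 * Real.pi / (√3 * p * (p - 1))

lemma concConst_pos {p : ℝ} (hp : 1 < p) : 0 < concConst p := by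
  have : 0 < p - 1 := by linarith
  have := Real.pi_pos
  unfold concConst; positivity

/-- The hypothesis of `curveBound_of_radial` on `[κY, Y]³`, with a constant that tends to
`1 / (p (p - 1))` as `κ → 1`. -/
lemma radial_bound_of_pos {p : ℝ} (hp : 1 < p) {κ Y : ℝ} (hκ : 0 < κ) (hY : 0 < Y)
    {y : ℝ × ℝ × ℝ} (h1 : y.1 ∈ Set.Icc (κ * Y) Y) (h2 : y.2.1 ∈ Set.Icc (κ * Y) Y)
    (h3 : y.2.2 ∈ Set.Icc (κ * Y) Y) :
    weight p y ^ 2 * ((y.1 - mean y) ^ 2 + (y.2.1 - mean y) ^ 2 + (y.2.2 - mean y) ^ 2) ≤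
      (κ ^ (-|p - 2|) / κ ^ |p - 2| / (p * (p - 1))) *
      (slope p y.1 * (y.1 - mean y) + slope p y.2.1 * (y.2.1 - mean y) +
        slope p y.2.2 * (y.2.2 - mean y)) := by
  have hpp : 0 < p * (p - 1) := by nlinarith
  have hκY : 0 < κ * Y := by positivity
  have hc : mean y ∈ Set.Icc (κ * Y) Y := by
    simp only [Set.mem_Icc, mean] at *
    constructor <;> linarith
  have hw : weight p y ^ 2 ≤ κ ^ (-|p - 2|) * Y ^ (p - 2) := by
    have hb : ∀ x ∈ Set.Icc (κ * Y) Y, |x| ^ ((p - 2) / 3) ≤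
        κ ^ (-|(p - 2) / 3|) * Y ^ ((p - 2) / 3) := fun x hx => by
      rw [abs_of_pos (hκY.trans_le hx.1)]
      exact rpow_le_of_mem_Icc _ hκ hY hx.1 hx.2
    rw [weight_sq]
    calc _ ≤ (κ ^ (-|(p - 2) / 3|) * Y ^ ((p - 2) / 3)) * (κ ^ (-|(p - 2) / 3|) *
          Y ^ ((p - 2) / 3)) * (κ ^ (-|(p - 2) / 3|) * Y ^ ((p - 2) / 3)) := by
          gcongr
          exacts [hb _ h1, hb _ h2, hb _ h3]
      _ = (κ ^ (-|(p - 2) / 3|) * κ ^ (-|(p - 2) / 3|) * κ ^ (-|(p - 2) / 3|)) *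
          (Y ^ ((p - 2) / 3) * Y ^ ((p - 2) / 3) * Y ^ ((p - 2) / 3)) := by ring
      _ = _ := by
          rw [← Real.rpow_add hκ, ← Real.rpow_add hκ, ← Real.rpow_add hY, ← Real.rpow_add hY,
            abs_div, abs_of_pos (by norm_num : (0 : ℝ) < 3)]
          congr 2 <;> ring
  have hs : ∀ x ∈ Set.Icc (κ * Y) Y, p * (p - 1) * (κ ^ |p - 2| * Y ^ (p - 2)) *
      (x - mean y) ^ 2 ≤ (slope p x - slope p (mean y)) * (x - mean y) := fun x hx =>
    slope_sub_mul_ge hp hκ hY hx.1 hx.2 hc.1 hc.2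
  set N := (y.1 - mean y) ^ 2 + (y.2.1 - mean y) ^ 2 + (y.2.2 - mean y) ^ 2 with hN
  have hN0 : 0 ≤ N := by positivity
  set D := slope p y.1 * (y.1 - mean y) + slope p y.2.1 * (y.2.1 - mean y) +
        slope p y.2.2 * (y.2.2 - mean y) with hD
  have hsum : (y.1 - mean y) + (y.2.1 - mean y) + (y.2.2 - mean y) = 0 := by
    simp only [mean]; ring
  have hDN : p * (p - 1) * (κ ^ |p - 2| * Y ^ (p - 2)) * N ≤ D := by
    -- the deviations from the mean add up to zero, so the slope at the mean can be subtracted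
    have : D = (slope p y.1 - slope p (mean y)) * (y.1 - mean y) +
        (slope p y.2.1 - slope p (mean y)) * (y.2.1 - mean y) +
        (slope p y.2.2 - slope p (mean y)) * (y.2.2 - mean y) := by
      rw [hD]; linear_combination slope p (mean y) * hsum
    rw [this]
    have := hs _ h1
    have := hs _ h2
    have := hs _ h3
    rw [hN]; linarith
  have hk1 : 0 < κ ^ |p - 2| := by positivity
  calc weight p y ^ 2 * N ≤ κ ^ (-|p - 2|) * Y ^ (p - 2) * N := by gcongr
    _ = (κ ^ (-|p - 2|) / κ ^ |p - 2| / (p * (p - 1))) *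
        (p * (p - 1) * (κ ^ |p - 2| * Y ^ (p - 2)) * N) := by
        have : p - 1 ≠ 0 := by linarith
        have : p ≠ 0 := by linarith
        field_simp
    _ ≤ _ := by gcongr

lemma curveBound_closeSet {p : ℝ} (hp : 1 < p) {ρ : ℝ} (hρ : 0 < ρ) (hρ1 : ρ < 1) :
    CurveBound p (closeSet ρ)
      (ENNReal.ofReal ((1 - ρ) ^ (-|p - 2|) / (1 - ρ) ^ |p - 2| * concConst p)) := by
  have hpp : 0 < p * (p - 1) := by nlinarith
  have hκ : 0 < 1 - ρ := by linarith
  have h := curveBound_of_radial hp (measurableSet_closeSet ρ)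
    (B := (1 - ρ) ^ (-|p - 2|) / (1 - ρ) ^ |p - 2| / (p * (p - 1))) (by positivity) (by
      intro y hy
      obtain ⟨h12, h13, h23⟩ := hy
      set Y := maxAbs y with hY
      rcases (maxAbs_nonneg y).eq_or_lt with h0 | h0
      · obtain ⟨g1, g2, g3⟩ := abs_le_maxAbs y
        rw [← h0] at g1 g2 g3
        have e1 := abs_nonpos_iff.1 g1
        have e2 := abs_nonpos_iff.1 g2
        have e3 := abs_nonpos_iff.1 g3
        simp [mean, e1, e2, e3]
      obtain ⟨g1, g2, g3⟩ := abs_le_maxAbs y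
      rw [← hY] at g1 g2 g3 h0
      rw [abs_le] at h12 h13 h23 g1 g2 g3
      -- close abscissae have the same sign
      have hcase : (y.1 ∈ Set.Icc ((1 - ρ) * Y) Y ∧ y.2.1 ∈ Set.Icc ((1 - ρ) * Y) Y ∧
          y.2.2 ∈ Set.Icc ((1 - ρ) * Y) Y) ∨ (-y.1 ∈ Set.Icc ((1 - ρ) * Y) Y ∧
          -y.2.1 ∈ Set.Icc ((1 - ρ) * Y) Y ∧ -y.2.2 ∈ Set.Icc ((1 - ρ) * Y) Y) := by
        simp only [Set.mem_Icc]
        have hmax : |y.1| = Y ∨ |y.2.1| = Y ∨ |y.2.2| = Y := by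
          rw [hY, maxAbs]
          rcases max_choice |y.1| (max |y.2.1| |y.2.2|) with h | h
          · left; exact h.symm
          · rw [h]; right
            rcases max_choice |y.2.1| |y.2.2| with h | h
            · left; exact h.symm
            · right; exact h.symm
        rw [sub_mul, one_mul]
        generalize ρ * Y = d at h12 h13 h23 ⊢
        rcases hmax with h | h | h <;> rcases (abs_eq h0.le).1 h with h | h <;>
          first
          | (left; refine ⟨⟨?_, ?_⟩, ⟨?_, ?_⟩, ⟨?_, ?_⟩⟩ <;> linarith)
          | (right; refine ⟨⟨?_, ?_⟩, ⟨?_, ?_⟩, ⟨?_, ?_⟩⟩ <;> linarith)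
      rcases hcase with ⟨c1, c2, c3⟩ | ⟨c1, c2, c3⟩
      · exact radial_bound_of_pos hp hκ h0 c1 c2 c3
      · have := radial_bound_of_pos hp (y := (-y.1, -y.2.1, -y.2.2)) hκ h0 c1 c2 c3
        have hm : mean (-y.1, -y.2.1, -y.2.2) = -mean y := by simp only [mean]; ring
        have hw : weight p (-y.1, -y.2.1, -y.2.2) = weight p y := by simp [weight]
        simp only [hm, hw, slope_neg] at this
        convert this using 2 <;> ring)
  refine h.mono le_rfl (le_of_eq ?_)
  congr 1
  unfold concConst
  have : p - 1 ≠ 0 := by linarith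
  have : p ≠ 0 := by linarith
  field_simp

/-- Near the diagonal the push-forward is at most `concConst p` times Lebesgue measure, up to a
small error. -/
lemma exists_curveBound_closeSet {p : ℝ} (hp : 1 < p) {ε : ℝ} (hε : 0 < ε) :
    ∃ ρ > 0, CurveBound p (closeSet ρ) (ENNReal.ofReal (concConst p + ε)) := by
  have hc : Tendsto (fun ρ : ℝ => (1 - ρ) ^ (-|p - 2|) / (1 - ρ) ^ |p - 2| * concConst p)
      (𝓝[>] 0) (𝓝 (concConst p)) := by
    have h1 : ContinuousAt (fun ρ : ℝ => (1 - ρ) ^ (-|p - 2|) / (1 - ρ) ^ |p - 2| * concConst p)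
        0 := by
      refine ContinuousAt.mul (ContinuousAt.div ?_ ?_ (by simp)) continuousAt_const
      · exact ContinuousAt.rpow_const (by fun_prop) (Or.inl (by norm_num))
      · exact ContinuousAt.rpow_const (by fun_prop) (Or.inl (by norm_num))
    have h2 := h1.tendsto
    simp only [sub_zero, Real.one_rpow, div_one, one_mul] at h2
    exact h2.mono_left nhdsWithin_le_nhds
  have h2 := (hc.eventually (gt_mem_nhds (show concConst p < concConst p + ε by linarith))).and
    (Ioo_mem_nhdsGT (show (0 : ℝ) < 1 by norm_num))
  obtain ⟨ρ, h3, h4⟩ := h2.exists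
  exact ⟨ρ, h4.1, (curveBound_closeSet hp h4.1 h4.2).mono le_rfl (ENNReal.ofReal_le_ofReal h3.le)⟩

/-- Transfer of a bound by a power of the largest abscissa to one by a power of the size. -/
lemma le_mul_size_rpow {c P V U Y σ q m Δ w : ℝ} (hc : 0 < c) (hP : 0 ≤ P) (hV : 0 ≤ V)
    (hY : 0 < Y) (hYσ : Y ≤ σ) (hσY : σ ≤ 3 * Y)
    (hw : w ≤ P * V * U * (Y ^ q * Y ^ m)) (hΔ : c * (Y ^ m * U) ≤ Δ) (hU : 0 ≤ U) :
    w ≤ ((1 / 3) ^ (-|q|) / c * P) * V * σ ^ q * Δ := by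
  have h1 : Y ^ q ≤ (1 / 3) ^ (-|q|) * σ ^ q :=
    rpow_le_of_mem_Icc q (by norm_num) (by linarith) (by linarith) hYσ
  have hσ : 0 < σ := by linarith
  calc w ≤ P * V * U * (Y ^ q * Y ^ m) := hw
    _ ≤ P * V * U * (((1 / 3) ^ (-|q|) * σ ^ q) * Y ^ m) := by gcongr
    _ = ((1 / 3) ^ (-|q|) / c * P) * V * σ ^ q * (c * (Y ^ m * U)) := by field_simp
    _ ≤ _ := by gcongr

/-- For comparable abscissae the weight has size `Y^(p-2)`, and for separated ones the difference
of the slopes has size `Y^(p-1)`, where `Y = maxAbs y`. -/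
lemma exists_weight_sq_le_sepSet {p : ℝ} (hp : 1 < p) {ρ R : ℝ} (hρ : 0 < ρ) (hR : 1 ≤ R) :
    ∃ C ≥ 0, ∀ y ∈ sepSet ρ R, 0 < maxAbs y ∧
      weight p y ^ 2 * maxAbs y ≤ C * |slope p y.2.2 - slope p y.2.1| := by
  obtain ⟨c, hc, hslope⟩ := exists_slope_sub_ge hp hρ
  set P : ℝ := (1 / R) ^ (-|(p - 2) / 3|) * (1 / R) ^ (-|(p - 2) / 3|) *
    (1 / R) ^ (-|(p - 2) / 3|) with hP
  have hR0 : 0 < R := by linarith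
  have hP0 : 0 ≤ P := by positivity
  refine ⟨P / c, by positivity, ?_⟩
  rintro y ⟨h1, h2⟩
  obtain ⟨g1, g2, g3⟩ := abs_le_maxAbs y
  obtain ⟨m1, m2, m3⟩ := minAbs_le_abs y
  have hY : 0 < maxAbs y := by
    rcases (maxAbs_nonneg y).eq_or_lt with h | h
    · rw [← h] at h1 g2 g3
      have e2 := abs_nonpos_iff.1 g2
      have e3 := abs_nonpos_iff.1 g3
      rw [e2, e3] at h1
      simp at h1
    · exact h
  refine ⟨hY, ?_⟩
  have hb : ∀ x : ℝ, minAbs y ≤ |x| → |x| ≤ maxAbs y → |x| ^ ((p - 2) / 3) ≤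
      (1 / R) ^ (-|(p - 2) / 3|) * maxAbs y ^ ((p - 2) / 3) := fun x hx hx' => by
    refine rpow_le_of_mem_Icc _ (by positivity) hY ?_ hx'
    refine le_trans ?_ hx
    rw [one_div, inv_mul_le_iff₀ hR0]; exact h2
  have hs : c * maxAbs y ^ (p - 1) ≤ |slope p y.2.2 - slope p y.2.1| := by
    rw [abs_sub_comm]
    exact hslope _ _ _ hY g2 g3 h1.le
  rw [weight_sq]
  calc _ ≤ ((1 / R) ^ (-|(p - 2) / 3|) * maxAbs y ^ ((p - 2) / 3)) *
        ((1 / R) ^ (-|(p - 2) / 3|) * maxAbs y ^ ((p - 2) / 3)) *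
        ((1 / R) ^ (-|(p - 2) / 3|) * maxAbs y ^ ((p - 2) / 3)) * maxAbs y := by
        gcongr
        exacts [hb _ m1 g1, hb _ m2 g2, hb _ m3 g3]
    _ = P * (maxAbs y ^ ((p - 2) / 3) * maxAbs y ^ ((p - 2) / 3) *
        maxAbs y ^ ((p - 2) / 3) * maxAbs y) := by rw [hP]; ring
    _ = P / c * (c * maxAbs y ^ (p - 1)) := by
        rw [← Real.rpow_add hY, ← Real.rpow_add hY, ← Real.rpow_add_one hY.ne']
        rw [show (p - 2) / 3 + (p - 2) / 3 + (p - 2) / 3 + 1 = p - 1 by ring]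
        field_simp
    _ ≤ _ := by gcongr

lemma curveBound_sepSet {p : ℝ} (hp : 1 < p) {ρ R : ℝ} (hρ : 0 < ρ) (hR : 1 ≤ R) :
    ∃ K : ℝ≥0∞, K ≠ ∞ ∧ CurveBound p (sepSet ρ R) K := by
  obtain ⟨C, hC, hw⟩ := exists_weight_sq_le_sepSet hp hρ hR
  have h := curveBound_of_fst_rpow hp (measurableSet_sepSet ρ R) (C := 3 * C) (e := 0) (δ := 1)
    (by positivity) (by norm_num) zero_le_one (by
      intro y hy
      obtain ⟨hY, h1⟩ := hw y hy
      have hYσ := maxAbs_le_size hp y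
      have hσY := size_le_three_mul_maxAbs hp y
      have hσ : 0 < size p y := by linarith
      refine ⟨by linarith [(abs_le_maxAbs y).1], ?_⟩
      rw [Real.rpow_zero, show -(0 : ℝ) - 1 = -1 by norm_num, Real.rpow_neg_one]
      have h2 : weight p y ^ 2 * size p y ≤ 3 * C * |slope p y.2.2 - slope p y.2.1| := by
        nlinarith [sq_nonneg (weight p y)]
      rw [mul_one, mul_right_comm, ← div_eq_mul_inv, le_div_iff₀ hσ]
      exact h2)
  exact ⟨_, ENNReal.mul_ne_top (by norm_num) ENNReal.ofReal_ne_top, h⟩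

lemma maxAbs_eq_of_mem_farOrdSet {R : ℝ} {y : ℝ × ℝ × ℝ} (hy : y ∈ farOrdSet R) :
    maxAbs y = |y.2.2| := by
  obtain ⟨h1, h2, -⟩ := hy
  rw [maxAbs, max_eq_right h2, max_eq_right (h1.trans h2)]

/-- A bound by nonpositive powers of the two smaller abscissae, valid for all `p > 1`; the exponent
`min ((p - 2) / 3) 0` exceeds `-1/3`. -/
lemma weight_sq_le_of_ordered {p : ℝ} {y : ℝ × ℝ × ℝ} (h0 : 0 < |y.1|) (h1 : |y.1| ≤ |y.2.1|)
    (h2 : |y.2.1| ≤ |y.2.2|) :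
    weight p y ^ 2 ≤ |y.1| ^ min ((p - 2) / 3) 0 * |y.2.1| ^ min ((p - 2) / 3) 0 *
      |y.2.2| ^ (p - 2 - 2 * min ((p - 2) / 3) 0) := by
  set a := (p - 2) / 3 with ha
  set b := min a 0 with hb
  have hY : 0 < |y.2.2| := by linarith
  have hx : ∀ x : ℝ, 0 < |x| → |x| ≤ |y.2.2| → |x| ^ a ≤ |x| ^ b * |y.2.2| ^ (a - b) := by
    intro x hx hxY
    calc |x| ^ a = |x| ^ b * |x| ^ (a - b) := by rw [← Real.rpow_add hx]; ring_nf
      _ ≤ _ := by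
        gcongr
        exact sub_nonneg.2 (min_le_left _ _)
  rw [weight_sq, ← ha]
  calc _ ≤ (|y.1| ^ b * |y.2.2| ^ (a - b)) * (|y.2.1| ^ b * |y.2.2| ^ (a - b)) * |y.2.2| ^ a := by
        gcongr
        · exact hx _ h0 (h1.trans h2)
        · exact hx _ (h0.trans_le h1) h2
    _ = |y.1| ^ b * |y.2.1| ^ b * (|y.2.2| ^ (a - b) * |y.2.2| ^ (a - b) * |y.2.2| ^ a) := by ring
    _ = _ := by
        rw [← Real.rpow_add hY, ← Real.rpow_add hY]
        congr 2
        rw [ha]; ring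

/-- The two largest abscissae are separated, so that the difference of their slopes is comparable to
`|y₃|^(p-1)`. The bound tends to zero as `R → ∞` because `2b + 1 > 0`. -/
lemma curveBound_far_separated {p : ℝ} (hp : 1 < p) {b : ℝ} (hb : b = min ((p - 2) / 3) 0) :
    ∃ C : ℝ, 0 ≤ C ∧ ∀ R : ℝ, 1 ≤ R →
      CurveBound p (farOrdSet R ∩ {y | |y.2.2| / 2 ≤ |y.2.1 - y.2.2| ∧ 0 < |y.1|})
        (2 * ENNReal.ofReal (C * (2 * (1 / R) ^ (2 * b + 1) / (2 * b + 1)))) := by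
  have hb1 : -1 / 3 < b := by rw [hb]; exact lt_min (by linarith) (by norm_num)
  have hb0 : b ≤ 0 := by rw [hb]; exact min_le_right _ _
  obtain ⟨c, hc, hslope⟩ := exists_slope_sub_ge hp (by norm_num : (0 : ℝ) < 1 / 2)
  refine ⟨(1 / 3) ^ (-|-(2 * b) - 1|) / c * 1, by positivity, fun R hR => ?_⟩
  have hR0 : 0 < R := by linarith
  refine curveBound_of_fst_rpow hp ?_ (by positivity) (by linarith) (by positivity) ?_
  · refine (measurableSet_farOrdSet R).inter (MeasurableSet.inter
      (measurableSet_le (f := fun y : ℝ × ℝ × ℝ => |y.2.2| / 2) (g := fun y => |y.2.1 - y.2.2|)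
        (by fun_prop) (by fun_prop))
      (measurableSet_lt (f := fun _ : ℝ × ℝ × ℝ => (0 : ℝ)) (g := fun y => |y.1|)
        (by fun_prop) (by fun_prop)))
  rintro y ⟨hy, h4, h5⟩
  have hmax := maxAbs_eq_of_mem_farOrdSet hy
  obtain ⟨h1, h2, h3⟩ := hy
  have hY : 0 < |y.2.2| := by linarith
  have hYσ := maxAbs_le_size hp y
  have hσY := size_le_three_mul_maxAbs hp y
  rw [hmax] at hYσ hσY
  constructor
  · rw [one_div, ← div_eq_inv_mul, le_div_iff₀ hR0]; linarith
  · refine le_mul_size_rpow (U := 1) (m := p - 1) hc zero_le_one (by positivity) hY hYσ hσY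
      ?_ ?_ zero_le_one
    · refine (weight_sq_le_of_ordered h5 h1 h2).trans ?_
      rw [← hb, ← Real.rpow_add hY, one_mul, mul_one]
      have : |y.2.1| ^ b ≤ |y.1| ^ b := Real.rpow_le_rpow_of_nonpos h5 h1 hb0
      calc |y.1| ^ b * |y.2.1| ^ b * |y.2.2| ^ (p - 2 - 2 * b)
          ≤ |y.1| ^ b * |y.1| ^ b * |y.2.2| ^ (p - 2 - 2 * b) := by gcongr
        _ = _ := by
          rw [← Real.rpow_add h5]
          congr 2 <;> ring
    · rw [mul_one, abs_sub_comm (slope p y.2.2)]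
      exact hslope _ _ _ hY h2 le_rfl (by linarith)

lemma half_le_of_close {y : ℝ × ℝ × ℝ} (h2 : |y.2.1| ≤ |y.2.2|)
    (h4 : |y.2.1 - y.2.2| < |y.2.2| / 2) :
    (y.2.1 ∈ Set.Icc (1 / 2 * |y.2.2|) |y.2.2| ∧ y.2.2 = |y.2.2|) ∨
    (-y.2.1 ∈ Set.Icc (1 / 2 * |y.2.2|) |y.2.2| ∧ -y.2.2 = |y.2.2|) := by
  rw [abs_le] at h2
  rw [abs_lt] at h4
  simp only [Set.mem_Icc]
  rcases abs_choice y.2.2 with h | h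
  · left
    rw [h] at h2 h4 ⊢
    refine ⟨⟨?_, ?_⟩, rfl⟩ <;> linarith
  · right
    rw [h] at h2 h4 ⊢
    refine ⟨⟨?_, ?_⟩, rfl⟩ <;> linarith

/-- The two largest abscissae `y₂`, `y₃` are close, and `|y₁ y₃| ≤ (y₂ - y₃)²`. The difference of
their slopes is comparable to `|y₃|^(p-2) |y₂ - y₃| ≥ |y₃|^(p-3/2) |y₁|^(1/2)`, which leaves the
integrable power `b - 1/2` of `|y₁|`. -/
lemma curveBound_far_close_fst {p : ℝ} (hp : 1 < p) {b : ℝ} (hb : b = min ((p - 2) / 3) 0) :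
    ∃ C : ℝ, 0 ≤ C ∧ ∀ R : ℝ, 1 ≤ R →
      CurveBound p (farOrdSet R ∩ {y | |y.2.1 - y.2.2| < |y.2.2| / 2 ∧
          |y.2.2| * |y.1| ≤ (y.2.1 - y.2.2) ^ 2 ∧ 0 < |y.1|})
        (2 * ENNReal.ofReal (C * (2 * (1 / R) ^ (b - 1 / 2 + 1) / (b - 1 / 2 + 1)))) := by
  have hb1 : -1 / 3 < b := by rw [hb]; exact lt_min (by linarith) (by norm_num)
  have hb0 : b ≤ 0 := by rw [hb]; exact min_le_right _ _
  set c := p * (p - 1) * (1 / 2) ^ |p - 2| with hc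
  have hc0 : 0 < c := by
    have : 0 < p - 1 := by linarith
    positivity
  refine ⟨(1 / 3) ^ (-|-(b - 1 / 2) - 1|) / c * (1 / 2) ^ (-|b|), by positivity, fun R hR => ?_⟩
  have hR0 : 0 < R := by linarith
  refine curveBound_of_fst_rpow hp ?_ (by positivity) (by linarith) (by positivity) ?_
  · refine (measurableSet_farOrdSet R).inter (MeasurableSet.inter
      (measurableSet_lt (f := fun y : ℝ × ℝ × ℝ => |y.2.1 - y.2.2|) (g := fun y => |y.2.2| / 2)
        (by fun_prop) (by fun_prop)) (MeasurableSet.inter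
      (measurableSet_le (f := fun y : ℝ × ℝ × ℝ => |y.2.2| * |y.1|)
        (g := fun y => (y.2.1 - y.2.2) ^ 2) (by fun_prop) (by fun_prop))
      (measurableSet_lt (f := fun _ : ℝ × ℝ × ℝ => (0 : ℝ)) (g := fun y => |y.1|)
        (by fun_prop) (by fun_prop))))
  rintro y ⟨hy, h4, h6, h5⟩
  have hmax := maxAbs_eq_of_mem_farOrdSet hy
  obtain ⟨h1, h2, h3⟩ := hy
  have hY : 0 < |y.2.2| := by linarith
  have hYσ := maxAbs_le_size hp y
  have hσY := size_le_three_mul_maxAbs hp y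
  rw [hmax] at hYσ hσY
  have hhalf := half_le_of_close h2 h4
  constructor
  · rw [one_div, ← div_eq_inv_mul, le_div_iff₀ hR0]; linarith
  · refine le_mul_size_rpow (U := |y.1| ^ (1 / 2 : ℝ)) (m := p - 2 + 1 / 2) hc0 (by positivity)
      (by positivity) hY hYσ hσY ?_ ?_ (by positivity)
    · refine (weight_sq_le_of_ordered h5 h1 h2).trans ?_
      have h21 : |y.2.1| ^ b ≤ (1 / 2) ^ (-|b|) * |y.2.2| ^ b := by
        refine rpow_le_of_mem_Icc b (by norm_num) hY ?_ h2
        rcases hhalf with ⟨h, -⟩ | ⟨h, -⟩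
        · exact h.1.trans (le_abs_self _)
        · exact h.1.trans (neg_le_abs _)
      rw [← hb]
      calc |y.1| ^ b * |y.2.1| ^ b * |y.2.2| ^ (p - 2 - 2 * b)
          ≤ |y.1| ^ b * ((1 / 2) ^ (-|b|) * |y.2.2| ^ b) * |y.2.2| ^ (p - 2 - 2 * b) := by gcongr
        _ = (1 / 2) ^ (-|b|) * |y.1| ^ b * (|y.2.2| ^ b * |y.2.2| ^ (p - 2 - 2 * b)) := by ring
        _ = _ := by
          rw [← Real.rpow_add hY, ← Real.rpow_add hY, mul_assoc ((1 / 2 : ℝ) ^ (-|b|)) (_ ^ (b - 1 / 2)),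
            ← Real.rpow_add h5]
          congr 2
          · congr 1; ring
          · ring
    · have hsl : c * |y.2.2| ^ (p - 2) * |y.2.1 - y.2.2| ≤ |slope p y.2.2 - slope p y.2.1| := by
        have key : ∀ u v : ℝ, u ∈ Set.Icc (1 / 2 * |y.2.2|) |y.2.2| → v = |y.2.2| →
            c * |y.2.2| ^ (p - 2) * |u - v| ≤ |slope p v - slope p u| := by
          intro u v hu hv
          have := slope_sub_mul_ge hp (by norm_num : (0 : ℝ) < 1 / 2) hY hu.1 hu.2
            (z := v) (by linarith) (by linarith)
          rw [abs_sub_comm (slope p v)]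
          rcases eq_or_ne u v with h | h
          · simp [h]
          · have huv : 0 < |u - v| := abs_pos.2 (sub_ne_zero.2 h)
            refine le_of_mul_le_mul_right ?_ huv
            calc c * |y.2.2| ^ (p - 2) * |u - v| * |u - v|
                = p * (p - 1) * ((1 / 2) ^ |p - 2| * |y.2.2| ^ (p - 2)) * (u - v) ^ 2 := by
                  rw [mul_assoc, ← sq, sq_abs, hc]; ring
              _ ≤ (slope p u - slope p v) * (u - v) := this
              _ ≤ _ := by rw [← abs_mul]; exact le_abs_self _
        rcases hhalf with ⟨h, h'⟩ | ⟨h, h'⟩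
        · exact key _ _ h h'
        · have := key _ _ h h'
          rw [slope_neg, slope_neg] at this
          rw [abs_sub_comm y.2.1, abs_sub_comm (slope p y.2.2)]
          convert this using 2
          · ring_nf
          · ring_nf
      have hv : |y.2.2| ^ (1 / 2 : ℝ) * |y.1| ^ (1 / 2 : ℝ) ≤ |y.2.1 - y.2.2| := by
        rw [← Real.mul_rpow hY.le h5.le, ← Real.sqrt_eq_rpow]
        exact Real.sqrt_le_iff.2 ⟨abs_nonneg _, by rw [sq_abs]; exact h6⟩
      calc c * (|y.2.2| ^ (p - 2 + 1 / 2) * |y.1| ^ (1 / 2 : ℝ))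
          = c * |y.2.2| ^ (p - 2) * (|y.2.2| ^ (1 / 2 : ℝ) * |y.1| ^ (1 / 2 : ℝ)) := by
            rw [Real.rpow_add hY]; ring
        _ ≤ c * |y.2.2| ^ (p - 2) * |y.2.1 - y.2.2| := by gcongr
        _ ≤ _ := hsl

/-- The two largest abscissae `y₂`, `y₃` are close, and `(y₂ - y₃)² < |y₁ y₃|`. Here lines of
constant difference `y₂ - y₃` are used, along which the derivative is comparable to `|y₃|^(p-1)`;
the condition turns the power `b` of `|y₁|` into the integrable power `2b` of `|y₂ - y₃|`. -/
lemma curveBound_far_close_sub {p : ℝ} (hp : 1 < p) {b : ℝ} (hb : b = min ((p - 2) / 3) 0) :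
    ∃ C : ℝ, 0 ≤ C ∧ ∀ R : ℝ, 1 ≤ R → 4 ≤ R ^ (p - 1) →
      CurveBound p (farOrdSet R ∩ {y | |y.2.1 - y.2.2| < |y.2.2| / 2 ∧
          (y.2.1 - y.2.2) ^ 2 < |y.2.2| * |y.1| ∧ 0 < |y.1| ∧ 0 < |y.2.1 - y.2.2|})
        (2 * ENNReal.ofReal (C * (2 * ((1 / R) ^ (1 / 2 : ℝ)) ^ (2 * b + 1) / (2 * b + 1)))) := by
  have hb1 : -1 / 3 < b := by rw [hb]; exact lt_min (by linarith) (by norm_num)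
  have hb0 : b ≤ 0 := by rw [hb]; exact min_le_right _ _
  have hc0 : 0 < p / 2 := by linarith
  refine ⟨(1 / 3) ^ (-|-(2 * b) - 1|) / (p / 2) * (1 / 2) ^ (-|b|), by positivity,
    fun R hR hR4 => ?_⟩
  have hR0 : 0 < R := by linarith
  refine curveBound_of_sub_rpow hp ?_ (by positivity) (by linarith) (by positivity) ?_
  · refine (measurableSet_farOrdSet R).inter (MeasurableSet.inter
      (measurableSet_lt (f := fun y : ℝ × ℝ × ℝ => |y.2.1 - y.2.2|) (g := fun y => |y.2.2| / 2)
        (by fun_prop) (by fun_prop)) (MeasurableSet.inter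
      (measurableSet_lt (f := fun y : ℝ × ℝ × ℝ => (y.2.1 - y.2.2) ^ 2)
        (g := fun y => |y.2.2| * |y.1|) (by fun_prop) (by fun_prop)) (MeasurableSet.inter
      (measurableSet_lt (f := fun _ : ℝ × ℝ × ℝ => (0 : ℝ)) (g := fun y => |y.1|)
        (by fun_prop) (by fun_prop))
      (measurableSet_lt (f := fun _ : ℝ × ℝ × ℝ => (0 : ℝ)) (g := fun y => |y.2.1 - y.2.2|)
        (by fun_prop) (by fun_prop)))))
  rintro y ⟨hy, h4, h6, h5, h7⟩
  have hmax := maxAbs_eq_of_mem_farOrdSet hy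
  obtain ⟨h1, h2, h3⟩ := hy
  have hY : 0 < |y.2.2| := by linarith
  have hYσ := maxAbs_le_size hp y
  have hσY := size_le_three_mul_maxAbs hp y
  rw [hmax] at hYσ hσY
  have hhalf := half_le_of_close h2 h4
  have hyR : |y.1| ≤ |y.2.2| / R := by rw [le_div_iff₀ hR0]; linarith
  constructor
  · calc |y.2.1 - y.2.2| ≤ √(1 / R * |y.2.2| ^ 2) := by
          apply Real.le_sqrt_of_sq_le
          rw [sq_abs]
          calc (y.2.1 - y.2.2) ^ 2 ≤ |y.2.2| * |y.1| := h6.le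
            _ ≤ |y.2.2| * (|y.2.2| / R) := by gcongr
            _ = _ := by ring
      _ = (1 / R) ^ (1 / 2 : ℝ) * |y.2.2| := by
          rw [Real.sqrt_mul (by positivity), Real.sqrt_sq hY.le, Real.sqrt_eq_rpow]
      _ ≤ _ := by gcongr
  · refine le_mul_size_rpow (U := 1) (m := p - 1) hc0 (by positivity)
      (by positivity) hY hYσ hσY ?_ ?_ zero_le_one
    · refine (weight_sq_le_of_ordered h5 h1 h2).trans ?_
      have h21 : |y.2.1| ^ b ≤ (1 / 2) ^ (-|b|) * |y.2.2| ^ b := by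
        refine rpow_le_of_mem_Icc b (by norm_num) hY ?_ h2
        rcases hhalf with ⟨h, -⟩ | ⟨h, -⟩
        · exact h.1.trans (le_abs_self _)
        · exact h.1.trans (neg_le_abs _)
      have h1b : |y.1| ^ b ≤ |y.2.1 - y.2.2| ^ (2 * b) * |y.2.2| ^ (-b) := by
        have h8 : |y.2.1 - y.2.2| ^ (2 : ℝ) / |y.2.2| ≤ |y.1| := by
          rw [div_le_iff₀ hY, Real.rpow_two, sq_abs]; linarith
        have h9 : 0 < |y.2.1 - y.2.2| ^ (2 : ℝ) := by positivity
        calc |y.1| ^ b ≤ (|y.2.1 - y.2.2| ^ (2 : ℝ) / |y.2.2|) ^ b :=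
              Real.rpow_le_rpow_of_nonpos (by positivity) h8 hb0
          _ = _ := by
              rw [Real.div_rpow h9.le hY.le, ← Real.rpow_mul h7.le, Real.rpow_neg hY.le]; rfl
      rw [← hb]
      calc |y.1| ^ b * |y.2.1| ^ b * |y.2.2| ^ (p - 2 - 2 * b)
          ≤ (|y.2.1 - y.2.2| ^ (2 * b) * |y.2.2| ^ (-b)) *
            ((1 / 2) ^ (-|b|) * |y.2.2| ^ b) * |y.2.2| ^ (p - 2 - 2 * b) := by gcongr
        _ = (1 / 2) ^ (-|b|) * |y.2.1 - y.2.2| ^ (2 * b) * 1 *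
            (|y.2.2| ^ (-b) * |y.2.2| ^ b * |y.2.2| ^ (p - 2 - 2 * b)) := by ring
        _ = _ := by
          rw [← Real.rpow_add hY, ← Real.rpow_add hY, ← Real.rpow_add hY]
          congr 2; ring
    · have hs1 : |slope p y.1| ≤ p / 4 * |y.2.2| ^ (p - 1) := by
        have habs : |slope p y.1| = slope p |y.1| := by
          simp [slope, abs_mul, abs_of_pos (by linarith : 0 < p),
            abs_of_nonneg (Real.rpow_nonneg (abs_nonneg y.1) _)]
        rw [habs, slope_of_pos h5]
        have h8 : |y.1| ^ (p - 1) ≤ |y.2.2| ^ (p - 1) / 4 := by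
          calc |y.1| ^ (p - 1) ≤ (|y.2.2| / R) ^ (p - 1) := by
                gcongr
            _ = |y.2.2| ^ (p - 1) / R ^ (p - 1) := Real.div_rpow hY.le hR0.le _
            _ ≤ _ := by gcongr
        have : 0 < p := by linarith
        nlinarith
      have key : ∀ u v : ℝ, u ∈ Set.Icc (1 / 2 * |y.2.2|) |y.2.2| → v = |y.2.2| →
          p * |y.2.2| ^ (p - 1) ≤ slope p u + slope p v := by
        intro u v hu hv
        have hu0 : 0 < u := lt_of_lt_of_le (by positivity) hu.1
        have hsu : 0 ≤ slope p u := by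
          rw [slope_of_pos hu0]
          have : 0 < p := by linarith
          positivity
        rw [hv, slope_of_pos hY]; linarith
      have h0 : 0 ≤ |y.2.2| ^ (p - 1) := by positivity
      have h9 : p * |y.2.2| ^ (p - 1) ≤ |slope p y.2.1 + slope p y.2.2| := by
        rcases hhalf with ⟨h, h'⟩ | ⟨h, h'⟩
        · exact (key _ _ h h').trans (le_abs_self _)
        · have := key _ _ h h'
          rw [slope_neg, slope_neg] at this
          refine le_trans ?_ (neg_le_abs _)
          linarith
      have h10 := abs_sub_abs_le_abs_sub (slope p y.2.1 + slope p y.2.2) (2 * slope p y.1)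
      rw [abs_mul, abs_two] at h10
      rw [mul_one]
      linarith

lemma exists_curveBound_farOrdSet {p : ℝ} (hp : 1 < p) {ε : ℝ≥0∞} (hε : 0 < ε) :
    ∃ R₀ : ℝ, ∀ R ≥ R₀, CurveBound p (farOrdSet R) ε := by
  set b := min ((p - 2) / 3) 0 with hb
  have hb1 : -1 / 3 < b := lt_min (by linarith) (by norm_num)
  obtain ⟨C₁, hC₁, h1⟩ := curveBound_far_separated hp hb
  obtain ⟨C₂, hC₂, h2⟩ := curveBound_far_close_fst hp hb
  obtain ⟨C₃, hC₃, h3⟩ := curveBound_far_close_sub hp hb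
  have hlim : ∀ C e s : ℝ, 0 < e → 0 < s → Tendsto (fun R : ℝ => 2 * ENNReal.ofReal
      (C * (2 * ((1 / R) ^ s) ^ e / e))) atTop (𝓝 0) := by
    intro C e s he hs
    have h4 : Tendsto (fun R : ℝ => (1 / R) ^ s) atTop (𝓝 0) := by
      have := (tendsto_inv_atTop_zero (𝕜 := ℝ)).rpow_const (p := s) (Or.inr hs.le)
      simpa [Real.zero_rpow hs.ne'] using this
    have h5 := ((h4.rpow_const (p := e) (Or.inr he.le)).const_mul 2).div_const e |>.const_mul C
    rw [Real.zero_rpow he.ne', mul_zero, zero_div, mul_zero] at h5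
    have h6 := ENNReal.Tendsto.const_mul (a := 2) (ENNReal.tendsto_ofReal h5)
      (Or.inr (by norm_num))
    simpa using h6
  have hl1 := hlim C₁ (2 * b + 1) 1 (by linarith) one_pos
  have hl2 := hlim C₂ (b - 1 / 2 + 1) 1 (by linarith) one_pos
  have hl3 := hlim C₃ (2 * b + 1) (1 / 2) (by linarith) (by norm_num)
  have hsum := hl1.add (hl2.add hl3)
  simp only [add_zero, Real.rpow_one] at hsum
  have hR4 : ∀ᶠ R : ℝ in atTop, 4 ≤ R ^ (p - 1) :=
    (tendsto_rpow_atTop (by linarith : 0 < p - 1)).eventually_ge_atTop 4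
  obtain ⟨R₀, hR₀⟩ := eventually_atTop.1
    ((hsum.eventually (gt_mem_nhds hε)).and (hR4.and (eventually_ge_atTop 1)))
  refine ⟨R₀, fun R hR => ?_⟩
  obtain ⟨h4, h5, h6⟩ := hR₀ R hR
  refine CurveBound.of_ae (((h1 R h6).union ((h2 R h6).union (h3 R h6 h5))).mono subset_rfl h4.le) ?_
  filter_upwards [ae_generic] with y hy hyE
  have g1 : 0 < |y.1| := abs_pos.2 hy.1
  have g2 : 0 < |y.2.1 - y.2.2| := abs_pos.2 (sub_ne_zero.2 hy.2.2.2)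
  rcases le_or_gt (|y.2.2| / 2) |y.2.1 - y.2.2| with h | h
  · exact Or.inl ⟨hyE, h, g1⟩
  · rcases le_or_gt (|y.2.2| * |y.1|) ((y.2.1 - y.2.2) ^ 2) with h' | h'
    · exact Or.inr (Or.inl ⟨hyE, h, h', g1⟩)
    · exact Or.inr (Or.inr ⟨hyE, h, h', g1, g2⟩)

/-- The push-forward from the region where the abscissae are not comparable is negligible. -/
lemma exists_curveBound_farSet {p : ℝ} (hp : 1 < p) {ε : ℝ≥0∞} (hε : 0 < ε) :
    ∃ R₀ : ℝ, ∀ R ≥ R₀, CurveBound p (farSet R) ε := by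
  obtain ⟨R₀, hR₀⟩ := exists_curveBound_farOrdSet hp (ε := ε / 6)
    (ENNReal.div_pos hε.ne' (by norm_num))
  refine ⟨R₀, fun R hR => ?_⟩
  have h := hR₀ R hR
  have h6 : ε / 6 + (ε / 6 + (ε / 6 + (ε / 6 + (ε / 6 + ε / 6)))) = ε := by
    have : ε / 6 + (ε / 6 + (ε / 6 + (ε / 6 + (ε / 6 + ε / 6)))) = 6 * (ε / 6) := by ring
    rw [this, ENNReal.mul_div_cancel (by norm_num) (by norm_num)]
  rw [← h6]
  refine CurveBound.mono (h.union (h.swap_fst.union (h.swap_snd.union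
    (h.swap_fst.swap_snd.union (h.swap_snd.swap_fst.union h.swap_fst.swap_snd.swap_fst)))))
    ?_ le_rfl
  intro y hy
  have hy' : R * min |y.1| (min |y.2.1| |y.2.2|) < max |y.1| (max |y.2.1| |y.2.2|) := hy
  simp only [Set.mem_union, Set.mem_preimage]
  change (_ ∧ _ ∧ _) ∨ (_ ∧ _ ∧ _) ∨ (_ ∧ _ ∧ _) ∨ (_ ∧ _ ∧ _) ∨ (_ ∧ _ ∧ _) ∨ (_ ∧ _ ∧ _)
  simp only
  rcases le_total |y.1| |y.2.1| with a1 | a1 <;> rcases le_total |y.1| |y.2.2| with a2 | a2 <;>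
    rcases le_total |y.2.1| |y.2.2| with a3 | a3 <;>
    simp_all
  · left; linarith
  · left; exact ⟨by linarith, by linarith, by linarith⟩

/-- Every point of space has close abscissae, or separated comparable ones in some order, or
abscissae that are not comparable. -/
lemma mem_regions (ρ R : ℝ) (y : ℝ × ℝ × ℝ) :
    y ∈ closeSet ρ ∨ y ∈ farSet R ∨ y ∈ sepSet ρ R ∨ (y.2.1, y.1, y.2.2) ∈ sepSet ρ R ∨
      (y.2.2, y.1, y.2.1) ∈ sepSet ρ R := by
  by_cases h : y ∈ farSet R
  · exact Or.inr (Or.inl h)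
  have hR : maxAbs y ≤ R * minAbs y := not_lt.1 h
  have e1 : maxAbs (y.2.1, y.1, y.2.2) = maxAbs y := by
    simp only [maxAbs]; rw [max_left_comm]
  have e2 : minAbs (y.2.1, y.1, y.2.2) = minAbs y := by
    simp only [minAbs]; rw [min_left_comm]
  have e3 : maxAbs (y.2.2, y.1, y.2.1) = maxAbs y := by
    simp only [maxAbs]; rw [max_left_comm, max_comm |y.2.2|]
  have e4 : minAbs (y.2.2, y.1, y.2.1) = minAbs y := by
    simp only [minAbs]; rw [min_left_comm, min_comm |y.2.2|]
  by_cases h23 : ρ * maxAbs y < |y.2.1 - y.2.2|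
  · exact Or.inr (Or.inr (Or.inl ⟨h23, hR⟩))
  by_cases h13 : ρ * maxAbs y < |y.1 - y.2.2|
  · exact Or.inr (Or.inr (Or.inr (Or.inl ⟨by rw [e1]; exact h13, by rw [e1, e2]; exact hR⟩)))
  by_cases h12 : ρ * maxAbs y < |y.1 - y.2.1|
  · exact Or.inr (Or.inr (Or.inr (Or.inr ⟨by rw [e3]; exact h12, by rw [e3, e4]; exact hR⟩)))
  exact Or.inl ⟨not_lt.1 h12, not_lt.1 h13, not_lt.1 h23⟩

/-- The push-forward of `weight p ^ 2` times Lebesgue measure has a bounded density. -/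
lemma exists_curveBound_univ {p : ℝ} (hp : 1 < p) :
    ∃ K : ℝ≥0∞, K ≠ ∞ ∧ CurveBound p Set.univ K := by
  obtain ⟨ρ, hρ, h1⟩ := exists_curveBound_closeSet hp one_pos
  obtain ⟨R₀, hR₀⟩ := exists_curveBound_farSet hp one_pos
  have h2 := hR₀ (max R₀ 1) (le_max_left _ _)
  obtain ⟨K, hK, h3⟩ := curveBound_sepSet hp hρ (le_max_right R₀ 1)
  refine ⟨_, ?_, (h1.union (h2.union (h3.union (h3.swap_fst.union h3.swap_fst.swap_snd)))).mono
    ?_ le_rfl⟩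
  · simp [hK]
  · intro y _
    rcases mem_regions ρ (max R₀ 1) y with h | h | h | h | h
    · exact Or.inl h
    · exact Or.inr (Or.inl h)
    · exact Or.inr (Or.inr (Or.inl h))
    · exact Or.inr (Or.inr (Or.inr (Or.inl h)))
    · exact Or.inr (Or.inr (Or.inr (Or.inr h)))

/-! ### Tensor products and the convolution operator -/

/-- The complex space `L²(α)`. -/
abbrev L2 (α : Type*) [MeasureSpace α] := Lp ℂ 2 (volume : Measure α)

lemma eLpNorm_two_sq {α : Type*} [MeasurableSpace α] {μ : Measure α} {E : Type*}
    [NormedAddCommGroup E] (f : α → E) : eLpNorm f 2 μ ^ 2 = ∫⁻ x, ‖f x‖ₑ ^ 2 ∂μ := by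
  have h := eLpNorm_nnreal_pow_eq_lintegral (μ := μ) (f := f) (p := 2) (by norm_num)
  simpa using h

lemma enorm_sq_eq_lintegral {α : Type*} [MeasureSpace α] (f : L2 α) :
    ‖f‖ₑ ^ 2 = ∫⁻ x, ‖f x‖ₑ ^ 2 := by
  rw [Lp.enorm_def, eLpNorm_two_sq]

lemma memLp_two_of_lintegral {α : Type*} [MeasurableSpace α] {μ : Measure α} {f : α → ℂ}
    (hf : AEStronglyMeasurable f μ) (h : ∫⁻ x, ‖f x‖ₑ ^ 2 ∂μ ≠ ∞) : MemLp f 2 μ := by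
  refine ⟨hf, ?_⟩
  rw [← eLpNorm_two_sq] at h
  exact lt_top_iff_ne_top.2 fun h' => h (by rw [h']; simp)

lemma enorm_toLp_sq {α : Type*} [MeasureSpace α] {f : α → ℂ} (hf : MemLp f 2 volume) :
    ‖hf.toLp f‖ₑ ^ 2 = ∫⁻ x, ‖f x‖ₑ ^ 2 := by
  rw [Lp.enorm_toLp, eLpNorm_two_sq]

/-- The Cauchy–Schwarz inequality for lower integrals. -/
lemma lintegral_mul_sq_le {α : Type*} [MeasurableSpace α] {μ : Measure α} {f g : α → ℝ≥0∞}
    (hf : AEMeasurable f μ) (hg : AEMeasurable g μ) :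
    (∫⁻ x, f x * g x ∂μ) ^ 2 ≤ (∫⁻ x, f x ^ 2 ∂μ) * ∫⁻ x, g x ^ 2 ∂μ := by
  have h := ENNReal.lintegral_mul_le_Lp_mul_Lq μ Real.HolderConjugate.two_two hf hg
  have h2 : ∀ x : ℝ≥0∞, (x ^ (1 / 2 : ℝ)) ^ 2 = x := fun x => by
    rw [← ENNReal.rpow_natCast, ← ENNReal.rpow_mul]; norm_num
  calc _ ≤ ((∫⁻ x, f x ^ (2 : ℝ) ∂μ) ^ (1 / 2 : ℝ) * (∫⁻ x, g x ^ (2 : ℝ) ∂μ) ^ (1 / 2 : ℝ)) ^ 2 := by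
        gcongr; exact h
    _ = _ := by
        rw [mul_pow, h2, h2]; simp only [ENNReal.rpow_two]

section Tensor

variable {α β : Type*} [MeasureSpace α] [MeasureSpace β] [SFinite (volume : Measure β)]

lemma lintegral_tensor (f : L2 α) (g : L2 β) :
    ∫⁻ z : α × β, ‖f z.1 * g z.2‖ₑ ^ 2 = ‖f‖ₑ ^ 2 * ‖g‖ₑ ^ 2 := by
  rw [enorm_sq_eq_lintegral, enorm_sq_eq_lintegral, Measure.volume_eq_prod,
    ← lintegral_prod_mul ((Lp.stronglyMeasurable f).enorm.pow_const 2).aemeasurable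
      ((Lp.stronglyMeasurable g).enorm.pow_const 2).aemeasurable]
  simp_rw [enorm_mul, mul_pow]

lemma memLp_tensor (f : L2 α) (g : L2 β) :
    MemLp (fun z : α × β => f z.1 * g z.2) 2 volume := by
  refine memLp_two_of_lintegral ?_ ?_
  · exact (((Lp.stronglyMeasurable f).comp_measurable measurable_fst).mul
      ((Lp.stronglyMeasurable g).comp_measurable measurable_snd)).aestronglyMeasurable
  · rw [lintegral_tensor]
    exact ENNReal.mul_ne_top (by simp) (by simp)

lemma enorm_toLp_tensor (f : L2 α) (g : L2 β) :
    ‖(memLp_tensor f g).toLp _‖ₑ = ‖f‖ₑ * ‖g‖ₑ := by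
  have h := enorm_toLp_sq (memLp_tensor f g)
  rw [lintegral_tensor, ← mul_pow] at h
  exact (ENNReal.pow_right_strictMono two_ne_zero).injective h

/-- The tensor product `f(x) g(y)` of two square-integrable functions. -/
def tensor : L2 α →L[ℂ] L2 β →L[ℂ] L2 (α × β) :=
  LinearMap.mkContinuous₂ (LinearMap.mk₂ ℂ (fun f g => (memLp_tensor f g).toLp _)
    (fun f f' g => by
      rw [← MemLp.toLp_add]
      refine MemLp.toLp_congr _ _ ?_
      filter_upwards [Measure.quasiMeasurePreserving_fst.ae (Lp.coeFn_add f f')] with z hz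
      simp only [Pi.add_apply, hz, add_mul])
    (fun c f g => by
      rw [← MemLp.toLp_const_smul]
      refine MemLp.toLp_congr _ _ ?_
      filter_upwards [Measure.quasiMeasurePreserving_fst.ae (Lp.coeFn_smul c f)] with z hz
      simp only [Pi.smul_apply, hz, smul_eq_mul, mul_assoc])
    (fun f g g' => by
      rw [← MemLp.toLp_add]
      refine MemLp.toLp_congr _ _ ?_
      filter_upwards [Measure.quasiMeasurePreserving_snd.ae (Lp.coeFn_add g g')] with z hz
      simp only [Pi.add_apply, hz, mul_add])
    (fun c f g => by
      rw [← MemLp.toLp_const_smul]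
      refine MemLp.toLp_congr _ _ ?_
      filter_upwards [Measure.quasiMeasurePreserving_snd.ae (Lp.coeFn_smul c g)] with z hz
      simp only [Pi.smul_apply, hz, smul_eq_mul, mul_left_comm])) 1
    (fun f g => by
      rw [one_mul]
      have := congrArg ENNReal.toReal (enorm_toLp_tensor f g)
      rw [ENNReal.toReal_mul] at this
      exact le_of_eq (by simpa using this))

lemma coeFn_tensor (f : L2 α) (g : L2 β) :
    tensor f g =ᵐ[volume] fun z : α × β => f z.1 * g z.2 := MemLp.coeFn_toLp (memLp_tensor f g)

lemma enorm_tensor (f : L2 α) (g : L2 β) : ‖tensor f g‖ₑ = ‖f‖ₑ * ‖g‖ₑ := enorm_toLp_tensor f g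

end Tensor

lemma coeFn_tensor_triple (f g h : L2 ℝ) :
    tensor f (tensor g h) =ᵐ[volume] fun y : ℝ × ℝ × ℝ => f y.1 * (g y.2.1 * h y.2.2) := by
  have h1 : ∀ᵐ y : ℝ × ℝ × ℝ, tensor g h y.2 = g y.2.1 * h y.2.2 :=
    Measure.quasiMeasurePreserving_snd.ae (coeFn_tensor g h)
  filter_upwards [coeFn_tensor f (tensor g h), h1] with y h2 h3
  rw [h2, h3]

lemma lintegral_pullback_le {p : ℝ} {E : Set (ℝ × ℝ × ℝ)} {K : ℝ≥0∞} (hE : CurveBound p E K)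
    (ψ : L2 (ℝ × ℝ)) :
    ∫⁻ y in E, ‖ψ (curveSum p y) * (weight p y : ℂ)‖ₑ ^ 2 ≤ K * ‖ψ‖ₑ ^ 2 := by
  have h := hE (fun z => ‖ψ z‖ₑ ^ 2) ((Lp.stronglyMeasurable ψ).enorm.pow_const 2)
  rw [← enorm_sq_eq_lintegral] at h
  refine le_trans (le_of_eq (lintegral_congr fun y => ?_)) h
  rw [enorm_mul, mul_pow]
  congr 1
  rw [ENNReal.ofReal_pow (by unfold weight; positivity)]
  congr 1
  rw [← ofReal_norm, Complex.norm_real, Real.norm_of_nonneg (by unfold weight; positivity)]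

lemma stronglyMeasurable_pullback (p : ℝ) (ψ : L2 (ℝ × ℝ)) :
    StronglyMeasurable fun y => ψ (curveSum p y) * (weight p y : ℂ) :=
  ((Lp.stronglyMeasurable ψ).comp_measurable (measurable_curveSum p)).mul
    (Complex.measurable_ofReal.comp (measurable_weight p)).stronglyMeasurable

lemma memLp_pullback {p : ℝ} (hp : 1 < p) (ψ : L2 (ℝ × ℝ)) :
    MemLp (fun y => ψ (curveSum p y) * (weight p y : ℂ)) 2 volume := by
  obtain ⟨K, hK, h⟩ := exists_curveBound_univ hp
  refine memLp_two_of_lintegral (stronglyMeasurable_pullback p ψ).aestronglyMeasurable ?_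
  have h1 := lintegral_pullback_le h ψ
  rw [Measure.restrict_univ] at h1
  exact ne_top_of_le_ne_top (ENNReal.mul_ne_top hK (by simp)) h1

lemma weight_pos {p : ℝ} {y : ℝ × ℝ × ℝ} (h1 : y.1 ≠ 0) (h2 : y.2.1 ≠ 0) (h3 : y.2.2 ≠ 0) :
    0 < weight p y := by
  unfold weight; positivity

lemma weight_nonneg (p : ℝ) (y : ℝ × ℝ × ℝ) : 0 ≤ weight p y := by unfold weight; positivity

lemma quasiMeasurePreserving_curveSum {p : ℝ} (hp : 1 < p) :
    Measure.QuasiMeasurePreserving (curveSum p) volume volume := by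
  refine ⟨measurable_curveSum p, Measure.AbsolutelyContinuous.mk fun s hs hs0 => ?_⟩
  obtain ⟨K, hK, h⟩ := exists_curveBound_univ hp
  have h1 := h (s.indicator 1) (measurable_one.indicator hs)
  rw [Measure.restrict_univ, lintegral_indicator_one hs, hs0, mul_zero, le_zero_iff,
    lintegral_eq_zero_iff (by
      refine Measurable.mul ((measurable_one.indicator hs).comp (measurable_curveSum p)) ?_
      fun_prop)] at h1
  rw [Measure.map_apply (measurable_curveSum p) hs]
  rw [measure_eq_zero_iff_ae_notMem]
  filter_upwards [h1, ae_generic] with y hy hg hys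
  have := weight_pos (p := p) hg.1 hg.2.1 hg.2.2.1
  rw [Set.indicator_of_mem (by exact hys)] at hy
  simp [this.ne'] at hy

/-- The pull-back `ψ ↦ ψ(∑ yᵢ, ∑ |yᵢ|^p) ∏ |yᵢ|^((p-2)/6)`, the adjoint of `convOp`. -/
def pullback {p : ℝ} (hp : 1 < p) : L2 (ℝ × ℝ) →L[ℂ] L2 (ℝ × ℝ × ℝ) :=
  LinearMap.mkContinuousOfExistsBound
    { toFun := fun ψ => (memLp_pullback hp ψ).toLp _
      map_add' := fun ψ ψ' => by
        rw [← MemLp.toLp_add]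
        refine MemLp.toLp_congr _ _ ?_
        filter_upwards [(quasiMeasurePreserving_curveSum hp).ae (Lp.coeFn_add ψ ψ')] with y hy
        simp only [Pi.add_apply, hy, add_mul]
      map_smul' := fun c ψ => by
        rw [RingHom.id_apply, ← MemLp.toLp_const_smul]
        refine MemLp.toLp_congr _ _ ?_
        filter_upwards [(quasiMeasurePreserving_curveSum hp).ae (Lp.coeFn_smul c ψ)] with y hy
        simp only [Pi.smul_apply, hy, smul_eq_mul, mul_assoc] }
    (by
      obtain ⟨K, hK, h⟩ := exists_curveBound_univ hp
      refine ⟨√K.toReal, fun ψ => ?_⟩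
      have h1 := lintegral_pullback_le h ψ
      rw [Measure.restrict_univ, ← enorm_toLp_sq (memLp_pullback hp ψ)] at h1
      have h2 := ENNReal.toReal_mono (ENNReal.mul_ne_top hK (by simp)) h1
      rw [ENNReal.toReal_mul, ENNReal.toReal_pow, ENNReal.toReal_pow, toReal_enorm,
        toReal_enorm] at h2
      refine abs_le_of_sq_le_sq' ?_ (by positivity) |>.2
      rw [mul_pow, Real.sq_sqrt (by positivity)]
      exact h2)

lemma coeFn_pullback {p : ℝ} (hp : 1 < p) (ψ : L2 (ℝ × ℝ)) :
    pullback hp ψ =ᵐ[volume] fun y => ψ (curveSum p y) * (weight p y : ℂ) :=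
  MemLp.coeFn_toLp (memLp_pullback hp ψ)

/-- The operator that sends `F` to the density of the push-forward under `curveSum p` of the
complex measure `F(y) ∏ |yᵢ|^((p-2)/6) dy`. -/
def convOp {p : ℝ} (hp : 1 < p) : L2 (ℝ × ℝ × ℝ) →L[ℂ] L2 (ℝ × ℝ) :=
  ContinuousLinearMap.adjoint (pullback hp)

lemma inner_convOp {p : ℝ} (hp : 1 < p) (ψ : L2 (ℝ × ℝ)) (F : L2 (ℝ × ℝ × ℝ)) :
    inner ℂ ψ (convOp hp F) =
      ∫ y, F y * (starRingEnd ℂ) (ψ (curveSum p y) * (weight p y : ℂ)) := by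
  rw [convOp, ContinuousLinearMap.adjoint_inner_right, L2.inner_def]
  refine integral_congr_ae ?_
  filter_upwards [coeFn_pullback hp ψ] with y hy
  rw [hy]; rfl

/-- Duality: the norm is tested against functions on the plane. -/
lemma enorm_convOp_le {p : ℝ} (hp : 1 < p) (F : L2 (ℝ × ℝ × ℝ)) {B : ℝ≥0∞}
    (h : ∀ ψ : L2 (ℝ × ℝ), ∫⁻ y, ‖F y‖ₑ * ‖ψ (curveSum p y) * (weight p y : ℂ)‖ₑ ≤ B * ‖ψ‖ₑ) :
    ‖convOp hp F‖ₑ ≤ B := by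
  set ψ := convOp hp F with hψ
  have h1 := h ψ
  have h2 : ‖ψ‖ₑ * ‖ψ‖ₑ ≤ B * ‖ψ‖ₑ := by
    have h3 : ‖ψ‖ₑ * ‖ψ‖ₑ = ‖inner ℂ ψ ψ‖ₑ := by
      rw [inner_self_eq_norm_sq_to_K, ← ofReal_norm, ← ofReal_norm, ← sq,
        ← ENNReal.ofReal_pow (norm_nonneg _)]
      simp
    rw [h3]
    conv_lhs => rw [hψ, ← hψ]
    rw [show inner ℂ ψ ψ = inner ℂ ψ (convOp hp F) from rfl, inner_convOp]
    refine (enorm_integral_le_lintegral_enorm _).trans (le_trans (le_of_eq ?_) h1)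
    refine lintegral_congr fun y => ?_
    rw [enorm_mul, RCLike.enorm_conj]
  rcases eq_or_ne ‖ψ‖ₑ 0 with h0 | h0
  · rw [h0]; exact zero_le
  · exact (ENNReal.mul_le_mul_iff_left h0 (by simp)).1 h2

/-- The norm of `convOp` on functions supported in `E` is controlled by `CurveBound p E`. -/
lemma enorm_convOp_sq_le {p : ℝ} (hp : 1 < p) (F : L2 (ℝ × ℝ × ℝ)) {E : Set (ℝ × ℝ × ℝ)}
    {K : ℝ≥0∞} (hE : CurveBound p E K) (hEm : MeasurableSet E) (hF : ∀ᵐ y, y ∉ E → F y = 0) :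
    ‖convOp hp F‖ₑ ^ 2 ≤ K * ‖F‖ₑ ^ 2 := by
  have h2 : ∀ x : ℝ≥0∞, (x ^ (1 / 2 : ℝ)) ^ 2 = x := fun x => by
    rw [← ENNReal.rpow_natCast, ← ENNReal.rpow_mul]; norm_num
  have h : ‖convOp hp F‖ₑ ≤ K ^ (1 / 2 : ℝ) * ‖F‖ₑ := by
    refine enorm_convOp_le hp F fun ψ => ?_
    refine (ENNReal.pow_right_strictMono two_ne_zero).le_iff_le.1 ?_
    calc (∫⁻ y, ‖F y‖ₑ * ‖ψ (curveSum p y) * (weight p y : ℂ)‖ₑ) ^ 2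
        = (∫⁻ y in E, ‖F y‖ₑ * ‖ψ (curveSum p y) * (weight p y : ℂ)‖ₑ) ^ 2 := by
          congr 1
          rw [← lintegral_indicator hEm]
          refine lintegral_congr_ae ?_
          filter_upwards [hF] with y hy
          by_cases h : y ∈ E
          · rw [Set.indicator_of_mem h]
          · rw [Set.indicator_of_notMem h, hy h]; simp
      _ ≤ (∫⁻ y in E, ‖F y‖ₑ ^ 2) *
          ∫⁻ y in E, ‖ψ (curveSum p y) * (weight p y : ℂ)‖ₑ ^ 2 :=
          lintegral_mul_sq_le (Lp.stronglyMeasurable F).enorm.aemeasurable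
            (stronglyMeasurable_pullback p ψ).enorm.aemeasurable
      _ ≤ ‖F‖ₑ ^ 2 * (K * ‖ψ‖ₑ ^ 2) := by
          gcongr
          · rw [enorm_sq_eq_lintegral]; exact setLIntegral_le_lintegral _ _
          · exact lintegral_pullback_le hE ψ
      _ = _ := by rw [mul_pow, mul_pow, h2]; ring
  calc ‖convOp hp F‖ₑ ^ 2 ≤ (K ^ (1 / 2 : ℝ) * ‖F‖ₑ) ^ 2 := by gcongr
    _ = _ := by rw [mul_pow, h2]

/-- The density of the triple convolution `fσ_p ∗ gσ_p ∗ hσ_p`. -/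
def tripleConv {p : ℝ} (hp : 1 < p) (f g h : L2 ℝ) : L2 (ℝ × ℝ) :=
  convOp hp (tensor f (tensor g h))

lemma inner_tripleConv {p : ℝ} (hp : 1 < p) (ψ : L2 (ℝ × ℝ)) (f g h : L2 ℝ) :
    inner ℂ ψ (tripleConv hp f g h) = ∫ y : ℝ × ℝ × ℝ, f y.1 * (g y.2.1 * h y.2.2) *
      (starRingEnd ℂ) (ψ (curveSum p y) * (weight p y : ℂ)) := by
  rw [tripleConv, inner_convOp]
  refine integral_congr_ae ?_
  filter_upwards [coeFn_tensor_triple f g h] with y hy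
  rw [hy]

lemma enorm_tripleConv_le_of {p : ℝ} (hp : 1 < p) (f g h : L2 ℝ) {B : ℝ≥0∞}
    (hB : ∀ ψ : L2 (ℝ × ℝ), ∫⁻ y : ℝ × ℝ × ℝ, ‖f y.1‖ₑ * (‖g y.2.1‖ₑ * ‖h y.2.2‖ₑ) *
      ‖ψ (curveSum p y) * (weight p y : ℂ)‖ₑ ≤ B * ‖ψ‖ₑ) :
    ‖tripleConv hp f g h‖ₑ ≤ B := by
  refine enorm_convOp_le hp _ fun ψ => le_trans (le_of_eq ?_) (hB ψ)
  refine lintegral_congr_ae ?_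
  filter_upwards [coeFn_tensor_triple f g h] with y hy
  rw [hy, enorm_mul, enorm_mul]

/-! ### The convolution of measures has this density -/

lemma measurableEmbedding_graph (p : ℝ) : MeasurableEmbedding fun y : ℝ => (y, |y| ^ p) := by
  refine MeasurableEmbedding.of_measurable_inverse (g := Prod.fst) (by fun_prop) ?_
    measurable_fst (fun _ => rfl)
  have : Set.range (fun y : ℝ => (y, |y| ^ p)) = {q : ℝ × ℝ | q.2 = |q.1| ^ p} := by
    ext q
    constructor
    · rintro ⟨y, rfl⟩; rfl
    · intro hq
      exact ⟨q.1, Prod.ext rfl hq.symm⟩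
  rw [this]
  exact measurableSet_eq_fun measurable_snd (by fun_prop)

lemma integral_sigma_triple (p : ℝ) (Φ : (ℝ × ℝ) × (ℝ × ℝ) × (ℝ × ℝ) → ℂ) :
    ∫ z, Φ z ∂((sigma p).prod ((sigma p).prod (sigma p))) =
      ∫ y : ℝ × ℝ × ℝ, Φ ((y.1, |y.1| ^ p), (y.2.1, |y.2.1| ^ p), (y.2.2, |y.2.2| ^ p)) *
        (weight p y : ℂ) := by
  have hγ := measurableEmbedding_graph p
  have hd : Measurable fun y : ℝ => ENNReal.ofReal (|y| ^ ((p - 2) / 6)) := by fun_prop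
  unfold sigma
  rw [Measure.map_prod_map _ _ hγ.measurable hγ.measurable, Measure.map_prod_map _ _ hγ.measurable
    (hγ.measurable.prodMap hγ.measurable), (hγ.prodMap (hγ.prodMap hγ)).integral_map,
    prod_withDensity hd hd, prod_withDensity hd (by fun_prop),
    integral_withDensity_eq_integral_toReal_smul (by fun_prop)
      (Eventually.of_forall fun y => by simp [ENNReal.mul_lt_top])]
  refine integral_congr_ae (Eventually.of_forall fun y => ?_)
  simp only [ENNReal.toReal_mul, Prod.map]
  rw [ENNReal.toReal_ofReal (by positivity), ENNReal.toReal_ofReal (by positivity),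
    ENNReal.toReal_ofReal (by positivity), Complex.real_smul, mul_comm, weight, mul_assoc]

lemma integral_mul_tripleConv {p : ℝ} (hp : 1 < p) (f : L2 ℝ) {φ : ℝ × ℝ → ℂ}
    (hφ : Continuous φ) (hφc : HasCompactSupport φ) :
    ∫ z, φ z * tripleConv hp f f f z =
      ∫ z : (ℝ × ℝ) × (ℝ × ℝ) × (ℝ × ℝ),
          φ (z.1 + z.2.1 + z.2.2) * (f z.1.1 * f z.2.1.1 * f z.2.2.1)
            ∂((sigma p).prod ((sigma p).prod (sigma p))) := by
  rw [integral_sigma_triple]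
  have hm : MemLp (fun z => (starRingEnd ℂ) (φ z)) 2 (volume : Measure (ℝ × ℝ)) :=
    Continuous.memLp_of_hasCompactSupport (by fun_prop) (hφc.comp_left (map_zero _))
  have h := inner_tripleConv hp (hm.toLp _) f f f
  rw [L2.inner_def] at h
  calc ∫ z, φ z * tripleConv hp f f f z
      = ∫ z, inner ℂ (hm.toLp _ z) (tripleConv hp f f f z) := by
        refine integral_congr_ae ?_
        filter_upwards [hm.coeFn_toLp] with z hz
        rw [hz, RCLike.inner_apply]
        simp [mul_comm]
    _ = _ := h
    _ = _ := by
        refine integral_congr_ae ?_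
        filter_upwards [(quasiMeasurePreserving_curveSum hp).ae hm.coeFn_toLp] with y hy
        rw [hy, map_mul, Complex.conj_conj, Complex.conj_ofReal]
        simp only [curveSum, Prod.mk_add_mk]
        ring

/-- The density is unique, and is given by `tripleConv`. -/
lemma isTripleConvDensity_iff {p : ℝ} (hp : 1 < p) (f : L2 ℝ) (h : ℝ × ℝ → ℂ) :
    IsTripleConvDensity p f h ↔ h =ᵐ[volume] tripleConv hp f f f := by
  have hloc : LocallyIntegrable (tripleConv hp f f f) volume :=
    (Lp.memLp (tripleConv hp f f f)).locallyIntegrable (by norm_num)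
  constructor
  · rintro ⟨hl, hφ⟩
    refine ae_eq_of_integral_contDiff_smul_eq hl hloc fun g hg hgc => ?_
    have hg1 : Continuous fun z => (g z : ℂ) := Complex.continuous_ofReal.comp hg.continuous
    have hg2 : HasCompactSupport fun z => (g z : ℂ) := hgc.comp_left Complex.ofReal_zero
    have h1 := hφ (fun z => (g z : ℂ)) hg1 hg2
    rw [← integral_mul_tripleConv hp f hg1 hg2] at h1
    simpa only [Complex.real_smul] using h1
  · intro hh
    refine ⟨hloc.congr hh.symm, fun φ hφ hφc => ?_⟩
    rw [← integral_mul_tripleConv hp f hφ hφc]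
    refine integral_congr_ae ?_
    filter_upwards [hh] with z hz
    rw [hz]

lemma tripleConvNorm_eq {p : ℝ} (hp : 1 < p) (f : L2 ℝ) :
    tripleConvNorm p f = ‖tripleConv hp f f f‖ₑ := by
  unfold tripleConvNorm
  apply le_antisymm
  · rw [Lp.enorm_def]
    exact iInf_le_of_le (tripleConv hp f f f)
      (iInf_le _ ((isTripleConvDensity_iff hp f _).2 EventuallyEq.rfl))
  · refine le_iInf₂ fun h hh => ?_
    rw [Lp.enorm_def, eLpNorm_congr_ae ((isTripleConvDensity_iff hp f h).1 hh)]

/-! ### Symmetry, boundedness and positivity of the triple convolution -/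

lemma tripleConv_swapFst {p : ℝ} (hp : 1 < p) (f g h : L2 ℝ) :
    tripleConv hp f g h = tripleConv hp g f h := by
  refine ext_inner_left ℂ fun ψ => ?_
  rw [inner_tripleConv, inner_tripleConv,
    ← measurePreserving_swapFst.integral_comp measurableEmbedding_swapFst]
  refine integral_congr_ae (Eventually.of_forall fun y => ?_)
  simp only [curveSum_swapFst, weight_swapFst]
  ring

lemma tripleConv_swapSnd {p : ℝ} (hp : 1 < p) (f g h : L2 ℝ) :
    tripleConv hp f g h = tripleConv hp f h g := by
  refine ext_inner_left ℂ fun ψ => ?_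
  rw [inner_tripleConv, inner_tripleConv,
    ← measurePreserving_swapSnd.integral_comp measurableEmbedding_swapSnd]
  refine integral_congr_ae (Eventually.of_forall fun y => ?_)
  simp only [curveSum_swapSnd, weight_swapSnd]
  ring

lemma norm_tensor {α β : Type*} [MeasureSpace α] [MeasureSpace β] [SFinite (volume : Measure β)]
    (f : L2 α) (g : L2 β) : ‖tensor f g‖ = ‖f‖ * ‖g‖ := by
  have h := congrArg ENNReal.toReal (enorm_tensor f g)
  rwa [ENNReal.toReal_mul, toReal_enorm, toReal_enorm, toReal_enorm] at h

lemma norm_tripleConv_le {p : ℝ} (hp : 1 < p) (f g h : L2 ℝ) :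
    ‖tripleConv hp f g h‖ ≤ ‖convOp hp‖ * (‖f‖ * (‖g‖ * ‖h‖)) := by
  rw [← norm_tensor, ← norm_tensor]
  exact (convOp hp).le_opNorm _

lemma tripleConv_add {p : ℝ} (hp : 1 < p) (f f' g h : L2 ℝ) :
    tripleConv hp (f + f') g h = tripleConv hp f g h + tripleConv hp f' g h := by
  simp [tripleConv]

lemma tripleConv_sub {p : ℝ} (hp : 1 < p) (f f' g h : L2 ℝ) :
    tripleConv hp (f - f') g h = tripleConv hp f g h - tripleConv hp f' g h := by
  simp [tripleConv]

lemma tripleConv_smul {p : ℝ} (hp : 1 < p) (c : ℂ) (f : L2 ℝ) :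
    tripleConv hp (c • f) (c • f) (c • f) = c ^ 3 • tripleConv hp f f f := by
  simp only [tripleConv, map_smul, _root_.smul_apply, smul_smul]
  congr 1; ring

lemma continuous_tripleConv_self {p : ℝ} (hp : 1 < p) :
    Continuous fun f : L2 ℝ => tripleConv hp f f f := by
  unfold tripleConv
  fun_prop

lemma integrable_tripleConv {p : ℝ} (hp : 1 < p) (ψ : L2 (ℝ × ℝ)) (f g h : L2 ℝ) :
    Integrable fun y : ℝ × ℝ × ℝ => f y.1 * (g y.2.1 * h y.2.2) *
      (starRingEnd ℂ) (ψ (curveSum p y) * (weight p y : ℂ)) := by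
  refine (L2.integrable_inner (𝕜 := ℂ) (pullback hp ψ) (tensor f (tensor g h))).congr ?_
  filter_upwards [coeFn_tensor_triple f g h, coeFn_pullback hp ψ] with y h1 h2
  rw [h1, h2]; rfl

lemma lintegral_tripleConv_eq {p : ℝ} (hp : 1 < p) (ψ : L2 (ℝ × ℝ)) (f g h : L2 ℝ) :
    ∫⁻ y : ℝ × ℝ × ℝ, ‖f y.1‖ₑ * (‖g y.2.1‖ₑ * ‖h y.2.2‖ₑ) *
      ‖ψ (curveSum p y) * (weight p y : ℂ)‖ₑ = ENNReal.ofReal (∫ y : ℝ × ℝ × ℝ,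
        ‖f y.1‖ * (‖g y.2.1‖ * ‖h y.2.2‖) * ‖ψ (curveSum p y) * (weight p y : ℂ)‖) := by
  have h1 := ofReal_integral_norm_eq_lintegral_enorm (integrable_tripleConv hp ψ f g h)
  simp only [norm_mul, RCLike.norm_conj, enorm_mul, RCLike.enorm_conj] at h1 ⊢
  exact h1.symm

/-- The absolute value of a square-integrable function. -/
def absL2 {α : Type*} [MeasureSpace α] (f : L2 α) : L2 α :=
  MemLp.toLp (fun y => ((‖f y‖ : ℝ) : ℂ)) (by
    refine (Lp.memLp f).of_le ?_ (Eventually.of_forall fun y => by simp)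
    exact (Complex.continuous_ofReal.comp_stronglyMeasurable
      (Lp.stronglyMeasurable f).norm).aestronglyMeasurable)

lemma coeFn_absL2 {α : Type*} [MeasureSpace α] (f : L2 α) :
    absL2 f =ᵐ[volume] fun y => ((‖f y‖ : ℝ) : ℂ) := MemLp.coeFn_toLp _

lemma norm_absL2 {α : Type*} [MeasureSpace α] (f : L2 α) : ‖absL2 f‖ = ‖f‖ := by
  rw [Lp.norm_def, Lp.norm_def]
  congr 1
  refine eLpNorm_congr_norm_ae ?_
  filter_upwards [coeFn_absL2 f] with y hy
  rw [hy]; simp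

/-- Pairing with nonnegative functions: the absolutely convergent integral is an inner product. -/
lemma lintegral_tripleConv_le_absL2 {p : ℝ} (hp : 1 < p) (ψ : L2 (ℝ × ℝ)) (f : L2 ℝ) :
    ∫⁻ y : ℝ × ℝ × ℝ, ‖f y.1‖ₑ * (‖f y.2.1‖ₑ * ‖f y.2.2‖ₑ) *
      ‖ψ (curveSum p y) * (weight p y : ℂ)‖ₑ ≤
      ‖tripleConv hp (absL2 f) (absL2 f) (absL2 f)‖ₑ * ‖ψ‖ₑ := by
  have h1 : inner ℂ (absL2 ψ) (tripleConv hp (absL2 f) (absL2 f) (absL2 f)) =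
      ((∫ y : ℝ × ℝ × ℝ, ‖f y.1‖ * (‖f y.2.1‖ * ‖f y.2.2‖) *
        ‖ψ (curveSum p y) * (weight p y : ℂ)‖ : ℝ) : ℂ) := by
    rw [inner_tripleConv, ← integral_complex_ofReal]
    refine integral_congr_ae ?_
    have hf := coeFn_absL2 f
    have h12 : ∀ᵐ q : ℝ × ℝ, absL2 f q.1 = ‖f q.1‖ := Measure.quasiMeasurePreserving_fst.ae hf
    have h22 : ∀ᵐ q : ℝ × ℝ, absL2 f q.2 = ‖f q.2‖ := Measure.quasiMeasurePreserving_snd.ae hf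
    have h2 : ∀ᵐ y : ℝ × ℝ × ℝ, absL2 f y.1 = ‖f y.1‖ := Measure.quasiMeasurePreserving_fst.ae hf
    have h3 : ∀ᵐ y : ℝ × ℝ × ℝ, absL2 f y.2.1 = ‖f y.2.1‖ :=
      Measure.quasiMeasurePreserving_snd.ae h12
    have h4 : ∀ᵐ y : ℝ × ℝ × ℝ, absL2 f y.2.2 = ‖f y.2.2‖ :=
      Measure.quasiMeasurePreserving_snd.ae h22
    filter_upwards [h2, h3, h4, (quasiMeasurePreserving_curveSum hp).ae (coeFn_absL2 ψ)]
      with y h2 h3 h4 h5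
    rw [h2, h3, h4, h5, map_mul, Complex.conj_ofReal, Complex.conj_ofReal, norm_mul,
      Complex.norm_real, Real.norm_of_nonneg (weight_nonneg p y)]
    push_cast; ring
  have h2 := norm_inner_le_norm (𝕜 := ℂ) (absL2 ψ) (tripleConv hp (absL2 f) (absL2 f) (absL2 f))
  rw [h1, norm_absL2, Complex.norm_real] at h2
  rw [lintegral_tripleConv_eq hp, ← ofReal_norm, ← ofReal_norm,
    ← ENNReal.ofReal_mul (norm_nonneg _), mul_comm]
  exact ENNReal.ofReal_le_ofReal ((le_abs_self _).trans h2)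

/-- The triple convolution of `f` is dominated by that of `|f|`. -/
lemma norm_tripleConv_le_absL2 {p : ℝ} (hp : 1 < p) (f : L2 ℝ) :
    ‖tripleConv hp f f f‖ ≤ ‖tripleConv hp (absL2 f) (absL2 f) (absL2 f)‖ := by
  have h := enorm_tripleConv_le_of hp f f f fun ψ => lintegral_tripleConv_le_absL2 hp ψ f
  rw [← ofReal_norm, ← ofReal_norm] at h
  exact (ENNReal.ofReal_le_ofReal_iff (norm_nonneg _)).1 h

/-! ### Dilations -/

lemma lintegral_dilate (a : ℝ) (ha : a ≠ 0) (f : L2 ℝ) :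
    ∫⁻ y, ‖((√|a| : ℝ) : ℂ) * f (a * y)‖ₑ ^ 2 = ‖f‖ₑ ^ 2 := by
  have hm : Measurable fun y => ‖f y‖ₑ ^ 2 := (Lp.stronglyMeasurable f).enorm.pow_const 2
  rw [enorm_sq_eq_lintegral, lintegral_comp_mul ha hm,
    ← lintegral_const_mul' _ _ ENNReal.ofReal_ne_top]
  refine lintegral_congr fun y => ?_
  rw [enorm_mul, mul_pow]
  congr 1
  rw [← ofReal_norm, Complex.norm_real, Real.norm_of_nonneg (by positivity),
    ← ENNReal.ofReal_pow (by positivity), Real.sq_sqrt (by positivity)]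

lemma memLp_dilate (a : ℝ) (ha : a ≠ 0) (f : L2 ℝ) :
    MemLp (fun y => ((√|a| : ℝ) : ℂ) * f (a * y)) 2 volume := by
  refine memLp_two_of_lintegral ?_ (by rw [lintegral_dilate a ha]; simp)
  exact (((Lp.stronglyMeasurable f).comp_measurable (by fun_prop)).const_mul
    _).aestronglyMeasurable

/-- The unitary dilation `|a|^(1/2) f(a y)`. -/
def dilate {a : ℝ} (ha : a ≠ 0) (f : L2 ℝ) : L2 ℝ := (memLp_dilate a ha f).toLp _

lemma coeFn_dilate {a : ℝ} (ha : a ≠ 0) (f : L2 ℝ) :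
    dilate ha f =ᵐ[volume] fun y => ((√|a| : ℝ) : ℂ) * f (a * y) := MemLp.coeFn_toLp _

lemma enorm_dilate {a : ℝ} (ha : a ≠ 0) (f : L2 ℝ) : ‖dilate ha f‖ₑ = ‖f‖ₑ := by
  have h := enorm_toLp_sq (memLp_dilate a ha f)
  rw [lintegral_dilate] at h
  exact (ENNReal.pow_right_strictMono two_ne_zero).injective h
  exact ha

lemma norm_dilate {a : ℝ} (ha : a ≠ 0) (f : L2 ℝ) : ‖dilate ha f‖ = ‖f‖ := by
  rw [← toReal_enorm, ← toReal_enorm, enorm_dilate]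

lemma quasiMeasurePreserving_mul {a : ℝ} (ha : a ≠ 0) :
    Measure.QuasiMeasurePreserving (fun y : ℝ => a * y) volume volume := by
  refine ⟨by fun_prop, ?_⟩
  rw [Real.map_volume_mul_left ha]
  exact Measure.smul_absolutelyContinuous

lemma dilate_dilate {a b : ℝ} (ha : a ≠ 0) (hb : b ≠ 0) (hab : a * b = 1) (f : L2 ℝ) :
    dilate ha (dilate hb f) = f := by
  apply Lp.ext
  filter_upwards [coeFn_dilate ha (dilate hb f), (quasiMeasurePreserving_mul ha).ae
    (coeFn_dilate hb f)] with y h1 h2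
  rw [h1, h2, ← mul_assoc, ← mul_assoc, ← Complex.ofReal_mul, ← Real.sqrt_mul (abs_nonneg _),
    ← abs_mul, mul_comm b, hab]
  simp

lemma lintegral_rescale {a b : ℝ} (ha : a ≠ 0) (hb : b ≠ 0) {G : ℝ × ℝ → ℝ≥0∞}
    (hG : Measurable G) :
    ENNReal.ofReal |a| * ENNReal.ofReal |b| * ∫⁻ z : ℝ × ℝ, G (a * z.1, b * z.2) = ∫⁻ z, G z := by
  have hm2 : Measurable fun z : ℝ × ℝ => G (a * z.1, b * z.2) := hG.comp (by fun_prop)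
  rw [Measure.volume_eq_prod, lintegral_prod _ hm2.aemeasurable,
    lintegral_prod _ hG.aemeasurable, lintegral_comp_mul ha (f := fun x => ∫⁻ y, G (x, y))
      hG.lintegral_prod_right', mul_assoc, ← lintegral_const_mul' _ _ ENNReal.ofReal_ne_top]
  congr 1
  refine lintegral_congr fun x => ?_
  have hm3 : Measurable fun y => G (a * x, y) := hG.comp (by fun_prop)
  rw [lintegral_comp_mul hb hm3]

/-- Invariance under dilations: the powers of `a` from the functions, from the densities, from
Lebesgue measure on space and from Lebesgue measure on the plane cancel. -/
lemma norm_tripleConv_dilate_le {p : ℝ} (hp : 1 < p) {a : ℝ} (ha : a ≠ 0) (f : L2 ℝ) :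
    ‖tripleConv hp (dilate ha f) (dilate ha f) (dilate ha f)‖ ≤ ‖tripleConv hp f f f‖ := by
  set h := tripleConv hp (dilate ha f) (dilate ha f) (dilate ha f) with hh
  have ha' : a⁻¹ ≠ 0 := inv_ne_zero ha
  have hapos : 0 < |a| := abs_pos.2 ha
  have hbpos : 0 < |a⁻¹| ^ p := by positivity
  -- the plane is rescaled by `(a, |a|^p)`, which preserves the curve
  have hresc := lintegral_rescale ha' hbpos.ne' (G := fun z => ‖h z‖ₑ ^ 2)
    ((Lp.stronglyMeasurable h).enorm.pow_const 2)
  rw [← enorm_sq_eq_lintegral] at hresc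
  set c := |a⁻¹| * |a⁻¹| ^ p with hc
  have hc0 : 0 < c := by positivity
  rw [abs_of_pos hbpos, ← ENNReal.ofReal_mul (abs_nonneg _), ← hc] at hresc
  have hmem : MemLp (fun z : ℝ × ℝ => h (a⁻¹ * z.1, |a⁻¹| ^ p * z.2)) 2 volume := by
    refine memLp_two_of_lintegral ?_ fun h' => ?_
    · exact ((Lp.stronglyMeasurable h).comp_measurable (by fun_prop)).aestronglyMeasurable
    · rw [h', ENNReal.mul_top (by simpa using hc0)] at hresc
      exact (by simp : ‖h‖ₑ ^ 2 ≠ ∞) hresc.symm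
  set ψ : L2 (ℝ × ℝ) := hmem.toLp _ with hψ
  have hψn : c * ‖ψ‖ ^ 2 = ‖h‖ ^ 2 := by
    rw [← enorm_toLp_sq hmem] at hresc
    have := congrArg ENNReal.toReal hresc
    rwa [ENNReal.toReal_mul, ENNReal.toReal_ofReal hc0.le, ENNReal.toReal_pow, ENNReal.toReal_pow,
      toReal_enorm, toReal_enorm] at this
  have hsum : ∀ y : ℝ × ℝ × ℝ, curveSum p (a⁻¹ • y) =
      (a⁻¹ * (curveSum p y).1, |a⁻¹| ^ p * (curveSum p y).2) := by
    intro y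
    simp only [curveSum, Prod.smul_fst, Prod.smul_snd, smul_eq_mul, abs_mul,
      Real.mul_rpow (abs_nonneg _) (abs_nonneg _), Prod.mk.injEq]
    constructor <;> ring
  have hwt : ∀ y : ℝ × ℝ × ℝ, weight p (a⁻¹ • y) = |a⁻¹| ^ ((p - 2) / 2) * weight p y := by
    intro y
    have h1 : |a⁻¹| ^ ((p - 2) / 2) = |a⁻¹| ^ ((p - 2) / 6) * |a⁻¹| ^ ((p - 2) / 6) *
        |a⁻¹| ^ ((p - 2) / 6) := by
      rw [← Real.rpow_add (by positivity), ← Real.rpow_add (by positivity)]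
      congr 1; ring
    simp only [weight, Prod.smul_fst, Prod.smul_snd, smul_eq_mul, abs_mul,
      Real.mul_rpow (abs_nonneg _) (abs_nonneg _)]
    rw [h1]; ring
  have hinner : inner ℂ h h = ((√c : ℝ) : ℂ) * inner ℂ ψ (tripleConv hp f f f) := by
    rw [show inner ℂ h h = inner ℂ h (tripleConv hp (dilate ha f) (dilate ha f)
      (dilate ha f)) from rfl, inner_tripleConv, inner_tripleConv]
    have : (volume : Measure (ℝ × ℝ)).IsAddHaarMeasure :=
      Measure.prod.instIsAddHaarMeasure volume volume
    have : (volume : Measure (ℝ × ℝ × ℝ)).IsAddHaarMeasure :=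
      Measure.prod.instIsAddHaarMeasure volume volume
    have hscale := Measure.integral_comp_smul (volume : Measure (ℝ × ℝ × ℝ))
      (fun y : ℝ × ℝ × ℝ => ((√|a| : ℝ) : ℂ) ^ 3 * (f (a * y.1) * (f (a * y.2.1) * f (a * y.2.2))) *
        (starRingEnd ℂ) (h (curveSum p y) * (weight p y : ℂ))) a⁻¹
    have hfin : Module.finrank ℝ (ℝ × ℝ × ℝ) = 3 := by simp
    rw [hfin] at hscale
    have h1 : ∫ y : ℝ × ℝ × ℝ, dilate ha f y.1 * (dilate ha f y.2.1 * dilate ha f y.2.2) *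
        (starRingEnd ℂ) (h (curveSum p y) * (weight p y : ℂ)) =
        ∫ y : ℝ × ℝ × ℝ, ((√|a| : ℝ) : ℂ) ^ 3 * (f (a * y.1) * (f (a * y.2.1) * f (a * y.2.2))) *
        (starRingEnd ℂ) (h (curveSum p y) * (weight p y : ℂ)) := by
      refine integral_congr_ae ?_
      have hf := coeFn_dilate ha f
      have h12 : ∀ᵐ q : ℝ × ℝ, dilate ha f q.1 = ((√|a| : ℝ) : ℂ) * f (a * q.1) :=
        Measure.quasiMeasurePreserving_fst.ae hf
      have h22 : ∀ᵐ q : ℝ × ℝ, dilate ha f q.2 = ((√|a| : ℝ) : ℂ) * f (a * q.2) :=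
        Measure.quasiMeasurePreserving_snd.ae hf
      have h2 : ∀ᵐ y : ℝ × ℝ × ℝ, dilate ha f y.1 = ((√|a| : ℝ) : ℂ) * f (a * y.1) :=
        Measure.quasiMeasurePreserving_fst.ae hf
      have h3 : ∀ᵐ y : ℝ × ℝ × ℝ, dilate ha f y.2.1 = ((√|a| : ℝ) : ℂ) * f (a * y.2.1) :=
        Measure.quasiMeasurePreserving_snd.ae h12
      have h4 : ∀ᵐ y : ℝ × ℝ × ℝ, dilate ha f y.2.2 = ((√|a| : ℝ) : ℂ) * f (a * y.2.2) :=
        Measure.quasiMeasurePreserving_snd.ae h22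
      filter_upwards [h2, h3, h4] with y h2 h3 h4
      rw [h2, h3, h4]; ring
    rw [h1]
    have h2 : ∫ y : ℝ × ℝ × ℝ, f y.1 * (f y.2.1 * f y.2.2) *
        (starRingEnd ℂ) (ψ (curveSum p y) * (weight p y : ℂ)) =
        ((√|a| : ℝ) : ℂ)⁻¹ ^ 3 * ((|a⁻¹| ^ ((p - 2) / 2) : ℝ) : ℂ)⁻¹ *
        ∫ y : ℝ × ℝ × ℝ, ((√|a| : ℝ) : ℂ) ^ 3 * (f (a * (a⁻¹ • y).1) *
          (f (a * (a⁻¹ • y).2.1) * f (a * (a⁻¹ • y).2.2))) *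
        (starRingEnd ℂ) (h (curveSum p (a⁻¹ • y)) * (weight p (a⁻¹ • y) : ℂ)) := by
      rw [← integral_const_mul]
      refine integral_congr_ae ?_
      filter_upwards [(quasiMeasurePreserving_curveSum hp).ae hmem.coeFn_toLp] with y hy
      rw [hψ, hy, hsum, hwt]
      simp only [Prod.smul_fst, Prod.smul_snd, smul_eq_mul, mul_inv_cancel_left₀ ha, map_mul,
        Complex.conj_ofReal]
      have e1 : ((√|a| : ℝ) : ℂ) ≠ 0 := by
        simpa using (Real.sqrt_pos.2 hapos).ne'
      have e2 : ((|a⁻¹| ^ ((p - 2) / 2) : ℝ) : ℂ) ≠ 0 := by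
        have : 0 < |a⁻¹| ^ ((p - 2) / 2) := by positivity
        exact_mod_cast this.ne'
      rw [Complex.ofReal_mul]
      generalize hA : ((|a⁻¹| ^ ((p - 2) / 2) : ℝ) : ℂ) = A at e2 ⊢
      field_simp
    rw [h2, hscale, Complex.real_smul, ← mul_assoc, ← mul_assoc]
    have h3 : ((√c : ℝ) : ℂ) * (((√|a| : ℝ) : ℂ)⁻¹ ^ 3 *
        ((|a⁻¹| ^ ((p - 2) / 2) : ℝ) : ℂ)⁻¹) * ((|(a⁻¹ ^ 3)⁻¹| : ℝ) : ℂ) = 1 := by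
      rw [← Complex.ofReal_inv, ← Complex.ofReal_inv, ← Complex.ofReal_pow, ← Complex.ofReal_mul,
        ← Complex.ofReal_mul, ← Complex.ofReal_mul]
      norm_cast
      have g0 : |a⁻¹| = |a| ^ (-1 : ℝ) := by rw [abs_inv, Real.rpow_neg_one]
      have g1 : √c = |a| ^ (-(1 + p) / 2) := by
        rw [hc, Real.sqrt_eq_rpow, g0, ← Real.rpow_mul hapos.le, ← Real.rpow_add hapos,
          ← Real.rpow_mul hapos.le]
        congr 1; ring
      have g2 : (√|a|)⁻¹ ^ 3 = |a| ^ (-(3 / 2) : ℝ) := by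
        rw [Real.sqrt_eq_rpow, ← Real.rpow_neg hapos.le, ← Real.rpow_natCast,
          ← Real.rpow_mul hapos.le]
        norm_num
      have g3 : (|a⁻¹| ^ ((p - 2) / 2))⁻¹ = |a| ^ ((p - 2) / 2) := by
        rw [g0, ← Real.rpow_mul hapos.le, ← Real.rpow_neg hapos.le]
        congr 1; ring
      have g4 : |(a⁻¹ ^ 3)⁻¹| = |a| ^ (3 : ℝ) := by
        rw [inv_pow, inv_inv, abs_pow]; norm_cast
      rw [g1, g2, g3, g4, ← Real.rpow_add hapos, ← Real.rpow_add hapos, ← Real.rpow_add hapos]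
      ring_nf
      exact Real.rpow_zero _
    rw [h3, one_mul]
  have h4 : ‖h‖ ^ 2 ≤ ‖h‖ * ‖tripleConv hp f f f‖ := by
    have h5 : ‖h‖ ^ 2 = ‖inner ℂ h h‖ := by
      rw [inner_self_eq_norm_sq_to_K]; simp
    have h6 : √c * ‖ψ‖ = ‖h‖ := by
      rw [← Real.sqrt_sq (norm_nonneg h), ← hψn, Real.sqrt_mul hc0.le,
        Real.sqrt_sq (norm_nonneg ψ)]
    rw [h5, hinner, norm_mul, Complex.norm_real, Real.norm_of_nonneg (by positivity), ← h6,
      mul_assoc]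
    gcongr
    exact norm_inner_le_norm _ _
  rcases (norm_nonneg h).eq_or_lt with h0 | h0
  · rw [← h0]; exact norm_nonneg _
  · exact le_of_mul_le_mul_left (by rwa [sq] at h4) h0

lemma norm_tripleConv_dilate {p : ℝ} (hp : 1 < p) {a : ℝ} (ha : a ≠ 0) (f : L2 ℝ) :
    ‖tripleConv hp (dilate ha f) (dilate ha f) (dilate ha f)‖ = ‖tripleConv hp f f f‖ := by
  refine le_antisymm (norm_tripleConv_dilate_le hp ha f) ?_
  have h := norm_tripleConv_dilate_le hp (inv_ne_zero ha) (dilate ha f)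
  rwa [dilate_dilate (inv_ne_zero ha) ha (inv_mul_cancel₀ ha)] at h

/-! ### The optimal constant -/

lemma optimalConst_ne_top {p : ℝ} (hp : 1 < p) : optimalConst p ≠ ∞ := by
  have hle : optimalConst p ≤ ENNReal.ofReal (‖convOp hp‖ ^ (1 / 3 : ℝ)) := by
    refine sInf_le fun f => ?_
    rw [tripleConvNorm_eq hp, ← ENNReal.ofReal_pow (by positivity), ← Real.rpow_natCast,
      ← Real.rpow_mul (norm_nonneg _), ← ofReal_norm, ← ofReal_norm,
      ← ENNReal.ofReal_pow (norm_nonneg _), ← ENNReal.ofReal_mul (by positivity)]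
    refine ENNReal.ofReal_le_ofReal ((norm_tripleConv_le hp f f f).trans (le_of_eq ?_))
    norm_num
    exact Or.inl (by ring)
  exact ne_top_of_le_ne_top ENNReal.ofReal_ne_top hle

/-- The cube of the optimal constant, as a real number. -/
def sharpConst (p : ℝ) : ℝ := (optimalConst p ^ 3).toReal

lemma sharpConst_nonneg (p : ℝ) : 0 ≤ sharpConst p := ENNReal.toReal_nonneg

lemma ofReal_sharpConst {p : ℝ} (hp : 1 < p) :
    ENNReal.ofReal (sharpConst p) = optimalConst p ^ 3 :=
  ENNReal.ofReal_toReal (ENNReal.pow_ne_top (optimalConst_ne_top hp))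

lemma ofReal_sharpConst_sq {p : ℝ} (hp : 1 < p) :
    ENNReal.ofReal (sharpConst p ^ 2) = optimalConst p ^ 6 := by
  rw [ENNReal.ofReal_pow (sharpConst_nonneg p), ofReal_sharpConst hp, ← pow_mul]

lemma norm_tripleConv_self_le {p : ℝ} (hp : 1 < p) (f : L2 ℝ) :
    ‖tripleConv hp f f f‖ ≤ sharpConst p * ‖f‖ ^ 3 := by
  have h : ‖tripleConv hp f f f‖ₑ ≤ optimalConst p ^ 3 * ‖f‖ₑ ^ 3 := by
    rw [← tripleConvNorm_eq hp]
    -- the infimum is attained since `C ↦ C ^ 3 * ‖f‖ₑ ^ 3` is continuous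
    have hcl : IsClosed {C : ℝ≥0∞ | tripleConvNorm p f ≤ C ^ 3 * ‖f‖ₑ ^ 3} := by
      refine isClosed_le continuous_const ?_
      exact (ENNReal.continuous_mul_const (by simp)).comp (ENNReal.continuous_pow 3)
    have hne : {C : ℝ≥0∞ | ∀ f : L2 ℝ, tripleConvNorm p f ≤ C ^ 3 * ‖f‖ₑ ^ 3}.Nonempty := by
      by_contra h0
      rw [Set.not_nonempty_iff_eq_empty] at h0
      exact optimalConst_ne_top hp (by rw [optimalConst, h0, sInf_empty])
    have hmem := csInf_mem_closure hne (OrderBot.bddBelow _)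
    have hsub : {C : ℝ≥0∞ | ∀ f : L2 ℝ, tripleConvNorm p f ≤ C ^ 3 * ‖f‖ₑ ^ 3} ⊆
        {C : ℝ≥0∞ | tripleConvNorm p f ≤ C ^ 3 * ‖f‖ₑ ^ 3} :=
      Set.ofPred_subset_ofPred.2 fun C hC => hC f
    exact hcl.closure_subset_iff.2 hsub hmem
  rw [← ofReal_sharpConst hp, ← ofReal_norm, ← ofReal_norm, ← ENNReal.ofReal_pow (norm_nonneg _),
    ← ENNReal.ofReal_mul (sharpConst_nonneg p)] at h
  exact (ENNReal.ofReal_le_ofReal_iff (mul_nonneg (sharpConst_nonneg p) (by positivity))).1 h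

lemma exists_lt_norm_tripleConv {p : ℝ} (hp : 1 < p) {B : ℝ} (hB : 0 ≤ B) (h : B < sharpConst p) :
    ∃ f : L2 ℝ, B * ‖f‖ ^ 3 < ‖tripleConv hp f f f‖ := by
  by_contra! hle
  have h1 : optimalConst p ≤ ENNReal.ofReal (B ^ (1 / 3 : ℝ)) := by
    refine sInf_le fun f => ?_
    rw [tripleConvNorm_eq hp, ← ENNReal.ofReal_pow (by positivity), ← Real.rpow_natCast,
      ← Real.rpow_mul hB, ← ofReal_norm, ← ofReal_norm,
      ← ENNReal.ofReal_pow (norm_nonneg _), ← ENNReal.ofReal_mul (by positivity)]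
    refine ENNReal.ofReal_le_ofReal ((hle f).trans (le_of_eq ?_))
    norm_num
  have h2 : ENNReal.ofReal (sharpConst p) ≤ ENNReal.ofReal B := by
    rw [ofReal_sharpConst hp]
    calc _ ≤ ENNReal.ofReal (B ^ (1 / 3 : ℝ)) ^ 3 := by gcongr
      _ = _ := by
        rw [← ENNReal.ofReal_pow (by positivity), ← Real.rpow_natCast, ← Real.rpow_mul hB]
        norm_num
  exact absurd ((ENNReal.ofReal_le_ofReal_iff hB).1 h2) (not_le.2 h)

lemma isExtremizingSeq_iff {p : ℝ} (hp : 1 < p) (f : ℕ → L2 ℝ) :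
    IsExtremizingSeq p f ↔ (∀ n, f n ≠ 0) ∧
      Tendsto (fun n => ‖tripleConv hp (f n) (f n) (f n)‖ / ‖f n‖ ^ 3) atTop
        (𝓝 (sharpConst p)) := by
  refine and_congr_right fun h0 => ?_
  have h1 : (fun n => tripleConvNorm p (f n) / ‖f n‖ₑ ^ 3) = fun n =>
      ENNReal.ofReal (‖tripleConv hp (f n) (f n) (f n)‖ / ‖f n‖ ^ 3) := by
    ext n
    have : 0 < ‖f n‖ := norm_pos_iff.2 (h0 n)
    rw [tripleConvNorm_eq hp, ENNReal.ofReal_div_of_pos (by positivity),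
      ENNReal.ofReal_pow (norm_nonneg _), ofReal_norm, ofReal_norm]
  rw [h1, ← ofReal_sharpConst hp]
  constructor
  · intro h
    have h2 := (ENNReal.tendsto_toReal ENNReal.ofReal_ne_top).comp h
    rw [ENNReal.toReal_ofReal (sharpConst_nonneg p)] at h2
    refine h2.congr fun n => ?_
    exact ENNReal.toReal_ofReal (by positivity)
  · exact fun h => (ENNReal.continuous_ofReal.tendsto _).comp h

lemma isExtremizer_iff {p : ℝ} (hp : 1 < p) (f : L2 ℝ) :
    IsExtremizer p f ↔ f ≠ 0 ∧ ‖tripleConv hp f f f‖ = sharpConst p * ‖f‖ ^ 3 := by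
  refine and_congr_right fun _ => ?_
  rw [tripleConvNorm_eq hp, ← ofReal_sharpConst hp, ← ofReal_norm, ← ofReal_norm,
    ← ENNReal.ofReal_pow (norm_nonneg _), ← ENNReal.ofReal_mul (sharpConst_nonneg p),
    ENNReal.ofReal_eq_ofReal_iff (norm_nonneg _)
      (mul_nonneg (sharpConst_nonneg p) (by positivity))]

/-- Extremizing sequences of nonnegative functions exist. -/
lemma exists_extremizingSeq {p : ℝ} (hp : 1 < p) (h0 : 0 < sharpConst p) :
    ∃ f : ℕ → L2 ℝ, IsExtremizingSeq p f ∧ IsNonnegSeq f := by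
  have hlt : ∀ n : ℕ, ∃ f : L2 ℝ, (sharpConst p * (1 - 1 / (n + 1))) * ‖f‖ ^ 3 <
      ‖tripleConv hp f f f‖ := fun n => by
    have h1 : (1 : ℝ) / (n + 1) ≤ 1 := by
      rw [div_le_one (by positivity)]; linarith [(Nat.cast_nonneg n : (0 : ℝ) ≤ n)]
    have h2 : (0 : ℝ) < 1 / (n + 1) := by positivity
    refine exists_lt_norm_tripleConv hp (mul_nonneg h0.le (by linarith)) ?_
    nlinarith
  choose f hf using hlt
  refine ⟨fun n => absL2 (f n), (isExtremizingSeq_iff hp _).2 ⟨fun n h => ?_, ?_⟩, fun n => ?_⟩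
  · have h3 : ‖f n‖ = 0 := by rw [← norm_absL2, h, norm_zero]
    have h4 := hf n
    have h5 := norm_tripleConv_self_le hp (f n)
    rw [h3] at h4 h5
    norm_num at h4 h5
    simp [h5] at h4
  · have h1 : Tendsto (fun n : ℕ => sharpConst p * (1 - 1 / ((n : ℝ) + 1))) atTop
        (𝓝 (sharpConst p)) := by
      simpa using (tendsto_one_div_add_atTop_nhds_zero_nat (𝕜 := ℝ)).const_sub 1 |>.const_mul
        (sharpConst p)
    refine tendsto_of_tendsto_of_tendsto_of_le_of_le h1 tendsto_const_nhds (fun n => ?_)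
      (fun n => ?_)
    · have h4 := hf n
      have h5 := norm_tripleConv_self_le hp (f n)
      have h6 : 0 < ‖f n‖ ^ 3 := by
        rcases (norm_nonneg (f n)).eq_or_lt with h | h
        · rw [← h] at h4 h5; norm_num at h4 h5; simp [h5] at h4
        · positivity
      show _ ≤ _ / _
      rw [norm_absL2, le_div_iff₀ h6]
      exact h4.le.trans (norm_tripleConv_le_absL2 hp _)
    · exact div_le_of_le_mul₀ (by positivity) (sharpConst_nonneg p)
        (norm_tripleConv_self_le hp _)
  · filter_upwards [coeFn_absL2 (f n)] with y hy
    rw [hy]; simp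

/-! ### Separated interactions are controlled by annular averages -/

/-- The annulus `t / R ≤ |v| ≤ R t`. -/
def annulus (R t : ℝ) : Set ℝ := {v | t ≤ R * |v| ∧ |v| ≤ R * t}

lemma measurableSet_annulus (R t : ℝ) : MeasurableSet (annulus R t) :=
  (measurableSet_le (f := fun _ => t) (g := fun v : ℝ => R * |v|) (by fun_prop) (by fun_prop)).inter
    (measurableSet_le (f := fun v : ℝ => |v|) (g := fun _ => R * t) (by fun_prop) (by fun_prop))

/-- The scale-invariant average `∫ |f(v)| |v|^(-1/2) dv` over an annulus. -/
def annMass (R : ℝ) (f : L2 ℝ) (t : ℝ) : ℝ≥0∞ :=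
  ∫⁻ v in annulus R t, ‖f v‖ₑ * ENNReal.ofReal (|v| ^ (-(1 / 2) : ℝ))

lemma measurable_enorm_L2 {α : Type*} [MeasureSpace α] (f : L2 α) : Measurable fun v => ‖f v‖ₑ :=
  (Lp.stronglyMeasurable f).enorm

lemma annMass_zero (R : ℝ) (f : L2 ℝ) : annMass R f 0 = 0 := by
  unfold annMass
  refine setLIntegral_measure_zero _ _ (measure_mono_null (t := {0}) ?_ (by simp))
  rintro v ⟨_, hv⟩
  rw [mul_zero] at hv
  exact abs_nonpos_iff.1 hv

/-- The scale of a point of `sepSet` is comparable to each abscissa. -/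
lemma mem_annulus_of_mem_sepSet {p : ℝ} (hp : 1 < p) {ρ R : ℝ} (hR : 1 ≤ R) {y : ℝ × ℝ × ℝ}
    (hy : y ∈ sepSet ρ R) :
    y.1 ∈ annulus (3 * R) (size p y) ∧ y.1 ∈ annulus (3 * R) |y.2.1| := by
  obtain ⟨g1, g2, g3⟩ := abs_le_maxAbs y
  obtain ⟨m1, m2, m3⟩ := minAbs_le_abs y
  have hYσ := maxAbs_le_size hp y
  have hσY := size_le_three_mul_maxAbs hp y
  have h := hy.2
  have h0 := maxAbs_nonneg y
  have hR1 : R * minAbs y ≤ R * |y.1| := by gcongr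
  have hR2 : R * minAbs y ≤ R * |y.2.1| := by gcongr
  refine ⟨⟨by nlinarith, by nlinarith⟩, by nlinarith [abs_nonneg y.1], by nlinarith⟩

/-- The contribution of separated comparable abscissae, by the Cauchy–Schwarz inequality with the
weight `|f(y₁)| |y₁|^(-1/2)`: for given `y₂`, `y₃`, or for a given line through space, the abscissa
`y₁` lies in an annulus, over which this weight has integral at most `M`. -/
lemma exists_sepSet_le {p : ℝ} (hp : 1 < p) {ρ R : ℝ} (hρ : 0 < ρ) (hR : 1 ≤ R) :
    ∃ C : ℝ≥0∞, C ≠ ∞ ∧ ∀ (f : L2 ℝ) (ψ : L2 (ℝ × ℝ)) (M : ℝ≥0∞),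
      (∀ t, 0 < t → annMass (3 * R) f t ≤ M) →
      ∫⁻ y in sepSet ρ R, ‖f y.1‖ₑ * (‖f y.2.1‖ₑ * ‖f y.2.2‖ₑ) *
        ‖ψ (curveSum p y) * (weight p y : ℂ)‖ₑ ≤ C * M * ‖f‖ₑ ^ 2 * ‖ψ‖ₑ := by
  obtain ⟨C, hC, hw⟩ := exists_weight_sq_le_sepSet hp hρ hR
  refine ⟨(2 * ENNReal.ofReal C) ^ (1 / 2 : ℝ),
    ENNReal.rpow_ne_top_of_nonneg (by norm_num) (ENNReal.mul_ne_top (by norm_num) (by simp)),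
    fun f ψ M hM => ?_⟩
  have hM' : ∀ t, 0 ≤ t → annMass (3 * R) f t ≤ M := fun t ht => by
    rcases ht.eq_or_lt with rfl | ht
    · rw [annMass_zero]; exact zero_le
    · exact hM t ht
  have hfm := measurable_enorm_L2 f
  have hψm := measurable_enorm_L2 ψ
  have hEm := measurableSet_sepSet ρ R
  set d : ℝ → ℝ≥0∞ := fun v => ‖f v‖ₑ * ENNReal.ofReal (|v| ^ (-(1 / 2) : ℝ)) with hd
  have hdm : Measurable d := by fun_prop
  have hd3 : Measurable fun y : ℝ × ℝ × ℝ => d y.1 := by fun_prop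
  set F : ℝ × ℝ × ℝ → ℝ≥0∞ := fun y => ‖f y.2.1‖ₑ * ‖f y.2.2‖ₑ with hF
  set G : ℝ × ℝ × ℝ → ℝ≥0∞ := fun y =>
    ‖ψ (curveSum p y)‖ₑ * ENNReal.ofReal (weight p y * |y.1| ^ (1 / 2 : ℝ)) with hG
  have hFm : Measurable F := by fun_prop
  have hGm : Measurable G := (hψm.comp (measurable_curveSum p)).mul (by fun_prop)
  -- Cauchy–Schwarz for the measure with density `|f(y₁)| |y₁|^(-1/2)`
  set μ := (volume.restrict (sepSet ρ R)).withDensity fun y => d y.1 with hμ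
  have hpos : ∀ y ∈ sepSet ρ R, 0 < |y.1| := fun y hy => by
    have h1 := (mem_annulus_of_mem_sepSet hp hR hy).1.1
    have h2 := (hw y hy).1
    have h3 := maxAbs_le_size hp y
    by_contra h4
    have h5 : |y.1| = 0 := le_antisymm (not_lt.1 h4) (abs_nonneg _)
    rw [h5] at h1
    linarith
  have h1 : ∫⁻ y in sepSet ρ R, ‖f y.1‖ₑ * (‖f y.2.1‖ₑ * ‖f y.2.2‖ₑ) *
        ‖ψ (curveSum p y) * (weight p y : ℂ)‖ₑ = ∫⁻ y, F y * G y ∂μ := by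
    change _ = ∫⁻ y, (F * G) y ∂μ
    rw [hμ, lintegral_withDensity_eq_lintegral_mul _ hd3 (hFm.mul hGm)]
    refine setLIntegral_congr_fun hEm fun y hy => ?_
    have hy0 := hpos y hy
    have e1 : ENNReal.ofReal (|y.1| ^ (-(1 / 2) : ℝ)) *
        ENNReal.ofReal (weight p y * |y.1| ^ (1 / 2 : ℝ)) = ENNReal.ofReal (weight p y) := by
      rw [← ENNReal.ofReal_mul (by positivity), mul_left_comm, ← Real.rpow_add hy0]
      norm_num
    have e2 : ‖(weight p y : ℂ)‖ₑ = ENNReal.ofReal (weight p y) := by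
      rw [← ofReal_norm, Complex.norm_real, Real.norm_of_nonneg (weight_nonneg p y)]
    simp only [Pi.mul_apply, hd, hF, hG]
    rw [enorm_mul, e2, ← e1]
    ring
  have h2 : ∫⁻ y, F y ^ 2 ∂μ ≤ M * (‖f‖ₑ ^ 2) ^ 2 := by
    rw [hμ, lintegral_withDensity_eq_lintegral_mul _ hd3 (hFm.pow_const 2)]
    have hS : MeasurableSet {q : ℝ × ℝ | q.1 ∈ annulus (3 * R) |q.2|} :=
      (measurableSet_le (f := fun q : ℝ × ℝ => |q.2|) (g := fun q : ℝ × ℝ => 3 * R * |q.1|)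
        (by fun_prop) (by fun_prop)).inter
      (measurableSet_le (f := fun q : ℝ × ℝ => |q.1|) (g := fun q : ℝ × ℝ => 3 * R * |q.2|)
        (by fun_prop) (by fun_prop))
    have hI : Measurable fun q : ℝ × ℝ => (annulus (3 * R) |q.2|).indicator d q.1 :=
      Measurable.indicator (f := fun q : ℝ × ℝ => d q.1) (by fun_prop) hS
    calc _ ≤ ∫⁻ y : ℝ × ℝ × ℝ, (annulus (3 * R) |y.2.1|).indicator d y.1 *
          (‖f y.2.1‖ₑ ^ 2 * ‖f y.2.2‖ₑ ^ 2) := by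
          rw [← lintegral_indicator hEm]
          refine lintegral_mono fun y => ?_
          by_cases hy : y ∈ sepSet ρ R
          · rw [Set.indicator_of_mem hy,
              Set.indicator_of_mem (mem_annulus_of_mem_sepSet hp hR hy).2]
            simp only [Pi.mul_apply, hF, mul_pow]
            exact le_rfl
          · rw [Set.indicator_of_notMem hy]; exact zero_le
      _ = ∫⁻ b, ∫⁻ c, ∫⁻ a, (annulus (3 * R) |b|).indicator d a *
          (‖f b‖ₑ ^ 2 * ‖f c‖ₑ ^ 2) := by
          have hm : Measurable fun y : ℝ × ℝ × ℝ => (annulus (3 * R) |y.2.1|).indicator d y.1 *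
            (‖f y.2.1‖ₑ ^ 2 * ‖f y.2.2‖ₑ ^ 2) :=
            (hI.comp (measurable_fst.prodMk measurable_snd.fst)).mul (by fun_prop)
          rw [Measure.volume_eq_prod, lintegral_prod_symm _ hm.aemeasurable,
            Measure.volume_eq_prod, lintegral_prod]
          exact hm.lintegral_prod_left'.aemeasurable
      _ = ∫⁻ b, ∫⁻ c, annMass (3 * R) f |b| * (‖f b‖ₑ ^ 2 * ‖f c‖ₑ ^ 2) := by
          refine lintegral_congr fun b => lintegral_congr fun c => ?_
          rw [lintegral_mul_const _ (hdm.indicator (measurableSet_annulus _ _)),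
            lintegral_indicator (measurableSet_annulus _ _)]
          rfl
      _ ≤ ∫⁻ b, ∫⁻ c, M * (‖f b‖ₑ ^ 2 * ‖f c‖ₑ ^ 2) := by
          gcongr with b c
          exact hM' _ (abs_nonneg _)
      _ = _ := by
          have hm2 : Measurable fun v => ‖f v‖ₑ ^ 2 := hfm.pow_const 2
          simp_rw [← mul_assoc]
          calc _ = ∫⁻ b, M * ‖f b‖ₑ ^ 2 * ‖f‖ₑ ^ 2 := by
                refine lintegral_congr fun b => ?_
                rw [lintegral_const_mul _ hm2, enorm_sq_eq_lintegral]
            _ = _ := by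
                rw [lintegral_mul_const _ (hm2.const_mul M), lintegral_const_mul _ hm2,
                  ← enorm_sq_eq_lintegral]
                ring
  have h3 : ∫⁻ y, G y ^ 2 ∂μ ≤ 2 * ENNReal.ofReal C * M * ‖ψ‖ₑ ^ 2 := by
    rw [hμ, lintegral_withDensity_eq_lintegral_mul _ hd3 (hGm.pow_const 2)]
    have hS : MeasurableSet {q : ℝ × ℝ | q.1 ∈ annulus (3 * R) q.2} :=
      (measurableSet_le (f := fun q : ℝ × ℝ => q.2) (g := fun q : ℝ × ℝ => 3 * R * |q.1|)
        (by fun_prop) (by fun_prop)).inter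
      (measurableSet_le (f := fun q : ℝ × ℝ => |q.1|) (g := fun q : ℝ × ℝ => 3 * R * q.2)
        (by fun_prop) (by fun_prop))
    have hI : Measurable fun q : ℝ × ℝ => (annulus (3 * R) q.2).indicator d q.1 :=
      Measurable.indicator (f := fun q : ℝ × ℝ => d q.1) (by fun_prop) hS
    have key := lintegral_fst_le hp hEm
      (fun v t => ENNReal.ofReal C * (annulus (3 * R) t).indicator d v)
      (hI.const_mul _) (K := ENNReal.ofReal C * M) (fun t ht => by
        rw [lintegral_const_mul _ (hdm.indicator (measurableSet_annulus _ _)),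
            lintegral_indicator (measurableSet_annulus _ _)]
        gcongr
        exact hM' t ht)
      (W := fun y => d y.1 * ENNReal.ofReal (weight p y ^ 2 * |y.1|)) (by fun_prop) (by
        intro y hy
        rw [Set.indicator_of_mem (mem_annulus_of_mem_sepSet hp hR hy).1]
        have e1 : ENNReal.ofReal (weight p y ^ 2 * |y.1|) ≤
            ENNReal.ofReal C * ENNReal.ofReal |slope p y.2.2 - slope p y.2.1| := by
          rw [← ENNReal.ofReal_mul hC]
          refine ENNReal.ofReal_le_ofReal (le_trans ?_ (hw y hy).2)
          gcongr
          exact (abs_le_maxAbs y).1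
        calc _ ≤ d y.1 * (ENNReal.ofReal C * ENNReal.ofReal |slope p y.2.2 - slope p y.2.1|) := by
              gcongr
          _ = _ := by ring)
      (hψm.pow_const 2)
    rw [← enorm_sq_eq_lintegral] at key
    refine le_trans (le_of_eq ?_) (key.trans (le_of_eq (by ring)))
    refine lintegral_congr fun y => ?_
    simp only [Pi.mul_apply, hG, mul_pow]
    rw [← ENNReal.ofReal_pow (mul_nonneg (weight_nonneg p y) (by positivity)), mul_pow,
      ← Real.rpow_natCast (|y.1| ^ (1 / 2 : ℝ)), ← Real.rpow_mul (abs_nonneg _)]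
    norm_num
    ring
  rw [h1]
  refine (ENNReal.pow_right_strictMono two_ne_zero).le_iff_le.1 ?_
  have h4 : ((2 * ENNReal.ofReal C) ^ (1 / 2 : ℝ)) ^ 2 = 2 * ENNReal.ofReal C := by
    rw [← ENNReal.rpow_natCast, ← ENNReal.rpow_mul]; norm_num
  calc _ ≤ (∫⁻ y, F y ^ 2 ∂μ) * ∫⁻ y, G y ^ 2 ∂μ :=
        lintegral_mul_sq_le hFm.aemeasurable hGm.aemeasurable
    _ ≤ (M * (‖f‖ₑ ^ 2) ^ 2) * (2 * ENNReal.ofReal C * M * ‖ψ‖ₑ ^ 2) := by gcongr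
    _ = (((2 * ENNReal.ofReal C) ^ (1 / 2 : ℝ)) ^ 2) * (M ^ 2 * (‖f‖ₑ ^ 2) ^ 2 * ‖ψ‖ₑ ^ 2) := by
        rw [h4]; ring
    _ = _ := by ring

lemma setLIntegral_triple_le {p : ℝ} (f : L2 ℝ) (ψ : L2 (ℝ × ℝ)) {E : Set (ℝ × ℝ × ℝ)} {K : ℝ≥0∞}
    (hE : CurveBound p E (K ^ 2)) :
    ∫⁻ y in E, ‖f y.1‖ₑ * (‖f y.2.1‖ₑ * ‖f y.2.2‖ₑ) *
      ‖ψ (curveSum p y) * (weight p y : ℂ)‖ₑ ≤ K * ‖f‖ₑ ^ 3 * ‖ψ‖ₑ := by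
  have hfm := measurable_enorm_L2 f
  have hm : Measurable fun y : ℝ × ℝ × ℝ => ‖f y.1‖ₑ * (‖f y.2.1‖ₑ * ‖f y.2.2‖ₑ) := by fun_prop
  have h1 : ∫⁻ y : ℝ × ℝ × ℝ, (‖f y.1‖ₑ * (‖f y.2.1‖ₑ * ‖f y.2.2‖ₑ)) ^ 2 = (‖f‖ₑ ^ 3) ^ 2 := by
    calc _ = ∫⁻ y, ‖tensor f (tensor f f) y‖ₑ ^ 2 := by
          refine lintegral_congr_ae ?_
          filter_upwards [coeFn_tensor_triple f f f] with y hy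
          rw [hy, enorm_mul, enorm_mul]
      _ = _ := by
          rw [← enorm_sq_eq_lintegral, enorm_tensor, enorm_tensor]; ring
  refine (ENNReal.pow_right_strictMono two_ne_zero).le_iff_le.1 ?_
  calc _ ≤ (∫⁻ y in E, (‖f y.1‖ₑ * (‖f y.2.1‖ₑ * ‖f y.2.2‖ₑ)) ^ 2) *
        ∫⁻ y in E, ‖ψ (curveSum p y) * (weight p y : ℂ)‖ₑ ^ 2 :=
        lintegral_mul_sq_le hm.aemeasurable (stronglyMeasurable_pullback p ψ).enorm.aemeasurable
    _ ≤ (‖f‖ₑ ^ 3) ^ 2 * (K ^ 2 * ‖ψ‖ₑ ^ 2) := by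
        gcongr
        · rw [← h1]; exact setLIntegral_le_lintegral _ _
        · exact lintegral_pullback_le hE ψ
    _ = _ := by ring

/-- A function whose triple convolution exceeds what a concentrating function can achieve has a
large annular average at some scale. -/
lemma exists_annMass_gt {p : ℝ} (hp : 1 < p) {B : ℝ} (hB : √(concConst p) < B) :
    ∃ R : ℝ, 1 ≤ R ∧ ∃ c : ℝ, 0 < c ∧ ∀ f : L2 ℝ, ‖f‖ = 1 → B ≤ ‖tripleConv hp f f f‖ →
      ∃ t, 0 < t ∧ ENNReal.ofReal c < annMass R f t := by
  set B₀ := √(concConst p) with hB₀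
  have hB₀0 : 0 < B₀ := Real.sqrt_pos.2 (concConst_pos hp)
  set δ := (B - B₀) / 3 with hδ
  have hδ0 : 0 < δ := by rw [hδ]; linarith
  obtain ⟨ρ, hρ, hclose⟩ := exists_curveBound_closeSet hp (ε := 2 * B₀ * δ + δ ^ 2) (by positivity)
  obtain ⟨R₀, hfar⟩ := exists_curveBound_farSet hp (ε := ENNReal.ofReal δ ^ 2) (by positivity)
  set R := max R₀ 1 with hR
  have hR1 : 1 ≤ R := le_max_right _ _
  have hfar := hfar R (le_max_left _ _)
  have hclose' : CurveBound p (closeSet ρ) (ENNReal.ofReal (B₀ + δ) ^ 2) := by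
    rw [← ENNReal.ofReal_pow (by positivity)]
    convert hclose using 2
    rw [add_sq, hB₀, Real.sq_sqrt (concConst_pos hp).le]; ring
  obtain ⟨C, hC, hsep⟩ := exists_sepSet_le hp hρ hR1
  have hC0 : 0 ≤ C.toReal := ENNReal.toReal_nonneg
  refine ⟨3 * R, by linarith, δ / (6 * C.toReal + 1), by positivity, fun f hf hfB => ?_⟩
  by_contra! hcon
  set M : ℝ≥0∞ := ENNReal.ofReal (δ / (6 * C.toReal + 1)) with hM
  have hf1 : ‖f‖ₑ = 1 := by rw [← ofReal_norm, hf, ENNReal.ofReal_one]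
  have hbound : ‖tripleConv hp f f f‖ₑ ≤
      ENNReal.ofReal (B₀ + δ) + ENNReal.ofReal δ + 3 * (C * M) := by
    refine enorm_tripleConv_le_of hp f f f fun ψ => ?_
    set I : ℝ × ℝ × ℝ → ℝ≥0∞ := fun y => ‖f y.1‖ₑ * (‖f y.2.1‖ₑ * ‖f y.2.2‖ₑ) *
      ‖ψ (curveSum p y) * (weight p y : ℂ)‖ₑ with hI
    have h1 := setLIntegral_triple_le f ψ hclose'
    have h2 := setLIntegral_triple_le f ψ hfar
    have h3 := hsep f ψ M hcon
    rw [hf1, one_pow, mul_one] at h1 h2 h3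
    -- the other separated pairs, by symmetry
    have hI1 : ∀ y : ℝ × ℝ × ℝ, I (y.2.1, y.1, y.2.2) = I y := fun y => by
      simp only [hI, curveSum_swapFst, weight_swapFst]; ring
    have hI2 : ∀ y : ℝ × ℝ × ℝ, I (y.1, y.2.2, y.2.1) = I y := fun y => by
      simp only [hI, curveSum_swapSnd, weight_swapSnd]; ring
    set S := sepSet ρ R
    have h4 : ∫⁻ y in (fun y : ℝ × ℝ × ℝ => (y.2.1, y.1, y.2.2)) ⁻¹' S, I y ≤ C * M * ‖ψ‖ₑ := by
      refine le_trans (le_of_eq ?_) h3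
      exact (lintegral_congr fun y => (hI1 y).symm).trans
        (measurePreserving_swapFst.setLIntegral_comp_preimage_emb measurableEmbedding_swapFst I S)
    have h5 : ∫⁻ y in (fun y : ℝ × ℝ × ℝ => (y.1, y.2.2, y.2.1)) ⁻¹'
        ((fun y : ℝ × ℝ × ℝ => (y.2.1, y.1, y.2.2)) ⁻¹' S), I y ≤ C * M * ‖ψ‖ₑ := by
      refine le_trans (le_of_eq ?_) h4
      exact (lintegral_congr fun y => (hI2 y).symm).trans
        (measurePreserving_swapSnd.setLIntegral_comp_preimage_emb measurableEmbedding_swapSnd I _)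
    set S₁ := (fun y : ℝ × ℝ × ℝ => (y.2.1, y.1, y.2.2)) ⁻¹' S
    set S₂ := (fun y : ℝ × ℝ × ℝ => (y.1, y.2.2, y.2.1)) ⁻¹' S₁
    have hcover : (Set.univ : Set (ℝ × ℝ × ℝ)) ⊆
        closeSet ρ ∪ (farSet R ∪ (S ∪ (S₁ ∪ S₂))) := fun y _ => mem_regions ρ R y
    calc ∫⁻ y, I y = ∫⁻ y in Set.univ, I y := by rw [Measure.restrict_univ]
      _ ≤ ∫⁻ y in closeSet ρ ∪ (farSet R ∪ (S ∪ (S₁ ∪ S₂))), I y := lintegral_mono_set hcover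
      _ ≤ (∫⁻ y in closeSet ρ, I y) + ((∫⁻ y in farSet R, I y) +
          ((∫⁻ y in S, I y) + ((∫⁻ y in S₁, I y) + ∫⁻ y in S₂, I y))) := by
          refine (lintegral_union_le _ _ _).trans ?_
          gcongr
          refine (lintegral_union_le _ _ _).trans ?_
          gcongr
          refine (lintegral_union_le _ _ _).trans ?_
          gcongr
          exact lintegral_union_le _ _ _
      _ ≤ ENNReal.ofReal (B₀ + δ) * ‖ψ‖ₑ + (ENNReal.ofReal δ * ‖ψ‖ₑ +
          (C * M * ‖ψ‖ₑ + (C * M * ‖ψ‖ₑ + C * M * ‖ψ‖ₑ))) := by gcongr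
      _ = _ := by ring
  have hCM : 3 * (C * M) = ENNReal.ofReal (3 * (C.toReal * (δ / (6 * C.toReal + 1)))) := by
    rw [ENNReal.ofReal_mul (by norm_num), ENNReal.ofReal_mul hC0, ENNReal.ofReal_toReal hC,
      hM]
    simp
  rw [hCM, ← ENNReal.ofReal_add (by positivity) hδ0.le,
    ← ENNReal.ofReal_add (by positivity) (by positivity), ← ofReal_norm,
    ENNReal.ofReal_le_ofReal_iff (by positivity)] at hbound
  have h6 : 3 * (C.toReal * (δ / (6 * C.toReal + 1))) < δ := by
    rw [← mul_assoc, ← mul_div_assoc, div_lt_iff₀ (by positivity)]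
    nlinarith
  have : 3 * δ = B - B₀ := by rw [hδ]; ring
  linarith

/-! ### Plancherel's theorem for integrable functions on the plane -/

section Plancherel

open scoped FourierTransform ContDiff

variable {E : Type*} [NormedAddCommGroup E] [InnerProductSpace ℝ E] [FiniteDimensional ℝ E]
  [MeasurableSpace E] [BorelSpace E]

lemma continuous_fourier_of_integrable {h : E → ℂ} (h1 : Integrable h) : Continuous (𝓕 h) :=
  VectorFourier.fourierIntegral_continuous Real.continuous_fourierChar
    (by exact continuous_inner) h1

/-- The Fourier transform on `L²` is given by the Fourier integral where the latter converges. -/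
lemma coeFn_fourier_toLp {h : E → ℂ} (h1 : Integrable h) (h2 : MemLp h 2 volume) :
    (𝓕 (h2.toLp h) : Lp ℂ 2 (volume : Measure E)) =ᵐ[volume] 𝓕 h := by
  refine ae_eq_of_integral_contDiff_smul_eq
    ((Lp.memLp _).locallyIntegrable (by norm_num))
    (continuous_fourier_of_integrable h1).locallyIntegrable fun g hg hgc => ?_
  have hg1 : HasCompactSupport fun x => (g x : ℂ) := hgc.comp_left Complex.ofReal_zero
  have hg2 : ContDiff ℝ ∞ fun x => (g x : ℂ) := Complex.ofRealCLM.contDiff.comp hg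
  set φ := hg1.toSchwartzMap hg2 with hφ
  have hφx : ∀ x, φ x = (g x : ℂ) := fun x => rfl
  have e1 := congrArg (fun T => T φ) (Lp.fourier_toTemperedDistribution_eq (h2.toLp h))
  simp only [TemperedDistribution.fourier_apply, Lp.toTemperedDistribution_apply] at e1
  calc ∫ x, g x • (𝓕 (h2.toLp h) : Lp ℂ 2 (volume : Measure E)) x
      = ∫ x, φ x • (𝓕 (h2.toLp h) : Lp ℂ 2 (volume : Measure E)) x := by
        simp_rw [hφx]; rfl
    _ = ∫ x, (𝓕 φ) x • (h2.toLp h) x := e1.symm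
    _ = ∫ x, 𝓕 (φ : E → ℂ) x • h x := by
        refine integral_congr_ae ?_
        filter_upwards [h2.coeFn_toLp] with x hx
        rw [hx, SchwartzMap.fourier_coe]
    _ = ∫ x, φ x • 𝓕 h x := by
        simpa using! VectorFourier.integral_fourierIntegral_smul_eq_flip (L := innerₗ E)
          Real.continuous_fourierChar continuous_inner φ.integrable h1
    _ = _ := by simp_rw [hφx]; rfl

lemma lintegral_fourier_sq {h : E → ℂ} (h1 : Integrable h) (h2 : MemLp h 2 volume) :
    ∫⁻ x, ‖𝓕 h x‖ₑ ^ 2 = ∫⁻ x, ‖h x‖ₑ ^ 2 := by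
  have e : ‖(𝓕 (h2.toLp h) : Lp ℂ 2 (volume : Measure E))‖ₑ = ‖h2.toLp h‖ₑ := by
    rw [← ofReal_norm, ← ofReal_norm, Lp.norm_fourier_eq]
  rw [Lp.enorm_def, Lp.enorm_def, eLpNorm_congr_ae (coeFn_fourier_toLp h1 h2),
    eLpNorm_congr_ae h2.coeFn_toLp] at e
  rw [← eLpNorm_two_sq, ← eLpNorm_two_sq, e]

end Plancherel

/-- The character `exp(-2πi (u₁ z₁ + u₂ z₂))` of the plane. -/
def planeChar (u z : ℝ × ℝ) : ℂ :=
  Complex.exp (((-2 * Real.pi * (u.1 * z.1 + u.2 * z.2) : ℝ) : ℂ) * Complex.I)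

lemma norm_planeChar (u z : ℝ × ℝ) : ‖planeChar u z‖ = 1 := Complex.norm_exp_ofReal_mul_I _

lemma continuous_planeChar (z : ℝ × ℝ) : Continuous fun u => planeChar u z := by
  unfold planeChar; fun_prop

lemma continuous_planeChar_uncurry : Continuous fun q : (ℝ × ℝ) × (ℝ × ℝ) => planeChar q.1 q.2 := by
  unfold planeChar; fun_prop

lemma planeChar_add (u v z : ℝ × ℝ) : planeChar (u + v) z = planeChar u z * planeChar v z := by
  unfold planeChar
  rw [← Complex.exp_add, ← add_mul, ← Complex.ofReal_add]
  simp only [Prod.fst_add, Prod.snd_add]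
  congr 3; ring

open scoped FourierTransform in
/-- Plancherel's theorem on the plane. -/
lemma lintegral_planeFourier_sq {h : ℝ × ℝ → ℂ} (h1 : Integrable h) (h2 : MemLp h 2 volume) :
    ∫⁻ z, ‖∫ u, planeChar u z * h u‖ₑ ^ 2 = ∫⁻ u, ‖h u‖ₑ ^ 2 := by
  have hmp := Complex.volume_preserving_equiv_real_prod
  have hme := Complex.measurableEquivRealProd.measurableEmbedding
  have h1' : Integrable fun w : ℂ => h (Complex.measurableEquivRealProd w) :=
    (hmp.integrable_comp_emb hme).2 h1
  have h2' : MemLp (fun w : ℂ => h (Complex.measurableEquivRealProd w)) 2 volume :=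
    h2.comp_measurePreserving hmp
  have key := lintegral_fourier_sq h1' h2'
  rw [hmp.lintegral_comp_emb hme (fun u => ‖h u‖ₑ ^ 2)] at key
  rw [← key, ← hmp.lintegral_comp_emb hme]
  refine lintegral_congr fun w => ?_
  congr 2
  rw [Real.fourier_eq', ← hmp.integral_comp hme]
  refine integral_congr_ae (Eventually.of_forall fun v => ?_)
  simp only [planeChar, Complex.measurableEquivRealProd_apply, Complex.inner, smul_eq_mul]
  congr 4
  simp [Complex.mul_re]
  ring

/-! ### The Fourier extension operator on functions of bounded support -/

/-- `f` vanishes almost everywhere outside `[-R, R]`. -/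
def SuppIn (R : ℝ) (f : L2 ℝ) : Prop := ∀ᵐ y : ℝ, R < |y| → f y = 0

/-- The Fourier transform of the measure `f σ_p`. -/
def extend (p : ℝ) (f : L2 ℝ) (z : ℝ × ℝ) : ℂ :=
  ∫ y : ℝ, planeChar (y, |y| ^ p) z * (f y * ((|y| ^ ((p - 2) / 6) : ℝ) : ℂ))

lemma measurable_planeChar_graph (p : ℝ) (z : ℝ × ℝ) :
    Measurable fun y : ℝ => planeChar (y, |y| ^ p) z :=
  (continuous_planeChar z).measurable.comp (by fun_prop)

/-- The function that represents evaluation of `extend` at `z`. -/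
def extendKernelFun (p R : ℝ) (z : ℝ × ℝ) : ℝ → ℂ :=
  (Set.Icc (-R) R).indicator fun y =>
    (starRingEnd ℂ) (planeChar (y, |y| ^ p) z) * ((|y| ^ ((p - 2) / 6) : ℝ) : ℂ)

lemma measurable_extendKernelFun (p R : ℝ) (z : ℝ × ℝ) : Measurable (extendKernelFun p R z) :=
  ((Complex.continuous_conj.measurable.comp (measurable_planeChar_graph p z)).mul
    (Complex.measurable_ofReal.comp (by fun_prop))).indicator measurableSet_Icc

lemma lintegral_extendKernelFun {p : ℝ} (hp : 1 < p) {R : ℝ} (hR : 0 ≤ R) (z : ℝ × ℝ) :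
    ∫⁻ y, ‖extendKernelFun p R z y‖ₑ ^ 2 =
      ENNReal.ofReal (2 * R ^ ((p - 2) / 3 + 1) / ((p - 2) / 3 + 1)) := by
  rw [← lintegral_abs_rpow_Icc (by linarith) hR, ← lintegral_indicator measurableSet_Icc]
  refine lintegral_congr fun y => ?_
  by_cases hy : y ∈ Set.Icc (-R) R
  · rw [extendKernelFun, Set.indicator_of_mem hy, Set.indicator_of_mem hy, enorm_mul,
      RCLike.enorm_conj, ← ofReal_norm (planeChar _ _), norm_planeChar, ENNReal.ofReal_one, one_mul,
      ← ofReal_norm, Complex.norm_real, Real.norm_of_nonneg (by positivity),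
      ← ENNReal.ofReal_pow (by positivity), ← Real.rpow_natCast, ← Real.rpow_mul (abs_nonneg _)]
    congr 2; push_cast; ring
  · rw [extendKernelFun, Set.indicator_of_notMem hy, Set.indicator_of_notMem hy]; simp

lemma memLp_extendKernelFun {p : ℝ} (hp : 1 < p) {R : ℝ} (hR : 0 ≤ R) (z : ℝ × ℝ) :
    MemLp (extendKernelFun p R z) 2 volume :=
  memLp_two_of_lintegral (measurable_extendKernelFun p R z).aestronglyMeasurable
    (by rw [lintegral_extendKernelFun hp hR]; simp)

/-- On functions of bounded support, the evaluation of `extend` is continuous in `L²`. -/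
lemma extend_eq_inner {p : ℝ} (hp : 1 < p) {R : ℝ} (hR : 0 ≤ R) {f : L2 ℝ} (hf : SuppIn R f)
    (z : ℝ × ℝ) : extend p f z = inner ℂ ((memLp_extendKernelFun hp hR z).toLp _) f := by
  rw [L2.inner_def, extend]
  refine integral_congr_ae ?_
  filter_upwards [hf, (memLp_extendKernelFun hp hR z).coeFn_toLp] with y h1 h2
  rw [h2, RCLike.inner_apply, extendKernelFun]
  by_cases hy : y ∈ Set.Icc (-R) R
  · rw [Set.indicator_of_mem hy, map_mul, Complex.conj_conj, Complex.conj_ofReal]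
    ring
  · rw [h1 (lt_of_not_ge fun h => hy (abs_le.1 h))]; simp

lemma norm_extend_le {p : ℝ} (hp : 1 < p) {R : ℝ} (hR : 0 ≤ R) {f : L2 ℝ} (hf : SuppIn R f)
    (z : ℝ × ℝ) :
    ‖extend p f z‖ ≤ √(2 * R ^ ((p - 2) / 3 + 1) / ((p - 2) / 3 + 1)) * ‖f‖ := by
  have h : ‖(memLp_extendKernelFun hp hR z).toLp _‖ =
      √(2 * R ^ ((p - 2) / 3 + 1) / ((p - 2) / 3 + 1)) := by
    have h0 : 0 < (p - 2) / 3 + 1 := by linarith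
    have h1 := congrArg ENNReal.toReal (enorm_toLp_sq (memLp_extendKernelFun hp hR z))
    rw [lintegral_extendKernelFun hp hR, ENNReal.toReal_ofReal (by positivity),
      ENNReal.toReal_pow, toReal_enorm] at h1
    rw [← h1, Real.sqrt_sq (norm_nonneg _)]
  rw [extend_eq_inner hp hR hf, ← h]
  exact norm_inner_le_norm _ _

lemma measurable_extend (p : ℝ) (f : L2 ℝ) : StronglyMeasurable (extend p f) := by
  unfold extend
  refine StronglyMeasurable.integral_prod_right'
    (f := fun q : (ℝ × ℝ) × ℝ => planeChar (q.2, |q.2| ^ p) q.1 *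
      (f q.2 * ((|q.2| ^ ((p - 2) / 6) : ℝ) : ℂ))) ?_
  refine StronglyMeasurable.mul (Measurable.stronglyMeasurable ?_) (StronglyMeasurable.mul
    ((Lp.stronglyMeasurable f).comp_measurable measurable_snd) (Measurable.stronglyMeasurable ?_))
  · have h : Measurable fun q : (ℝ × ℝ) × ℝ => (((q.2, |q.2| ^ p) : ℝ × ℝ), q.1) := by fun_prop
    exact continuous_planeChar_uncurry.measurable.comp h
  · exact Complex.measurable_ofReal.comp (by fun_prop)

/-- The box that contains the sums of three points of the curve with abscissae in `[-R, R]`. -/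
def sumBox (p R : ℝ) : Set (ℝ × ℝ) :=
  Set.Icc (-(3 * R)) (3 * R) ×ˢ Set.Icc (-(3 * R ^ p)) (3 * R ^ p)

lemma measurableSet_sumBox (p R : ℝ) : MeasurableSet (sumBox p R) :=
  measurableSet_Icc.prod measurableSet_Icc

lemma volume_sumBox_ne_top (p R : ℝ) : volume (sumBox p R) ≠ ∞ :=
  (isCompact_Icc.prod isCompact_Icc).measure_lt_top.ne

lemma curveSum_mem_sumBox {p : ℝ} (hp : 1 < p) {R : ℝ} {y : ℝ × ℝ × ℝ} (h1 : |y.1| ≤ R)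
    (h2 : |y.2.1| ≤ R) (h3 : |y.2.2| ≤ R) : curveSum p y ∈ sumBox p R := by
  have hpow : ∀ x : ℝ, |x| ≤ R → |x| ^ p ≤ R ^ p := fun x hx =>
    Real.rpow_le_rpow (abs_nonneg _) hx (by linarith)
  have e1 := hpow _ h1
  have e2 := hpow _ h2
  have e3 := hpow _ h3
  have p1 : 0 ≤ |y.1| ^ p := by positivity
  have p2 : 0 ≤ |y.2.1| ^ p := by positivity
  have p3 : 0 ≤ |y.2.2| ^ p := by positivity
  rw [abs_le] at h1 h2 h3
  refine ⟨⟨?_, ?_⟩, ?_, ?_⟩ <;> simp only [curveSum] <;> linarith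

lemma ae_zero_or_mem_sumBox {p : ℝ} (hp : 1 < p) {R : ℝ} {f g h : L2 ℝ} (hf : SuppIn R f)
    (hg : SuppIn R g) (hh : SuppIn R h) :
    ∀ᵐ y : ℝ × ℝ × ℝ, f y.1 * (g y.2.1 * h y.2.2) = 0 ∨ curveSum p y ∈ sumBox p R := by
  have hg2 : ∀ᵐ q : ℝ × ℝ, R < |q.1| → g q.1 = 0 := Measure.quasiMeasurePreserving_fst.ae hg
  have hh2 : ∀ᵐ q : ℝ × ℝ, R < |q.2| → h q.2 = 0 := Measure.quasiMeasurePreserving_snd.ae hh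
  have h1 : ∀ᵐ y : ℝ × ℝ × ℝ, R < |y.1| → f y.1 = 0 := Measure.quasiMeasurePreserving_fst.ae hf
  have h2 : ∀ᵐ y : ℝ × ℝ × ℝ, R < |y.2.1| → g y.2.1 = 0 :=
    Measure.quasiMeasurePreserving_snd.ae hg2
  have h3 : ∀ᵐ y : ℝ × ℝ × ℝ, R < |y.2.2| → h y.2.2 = 0 :=
    Measure.quasiMeasurePreserving_snd.ae hh2
  filter_upwards [h1, h2, h3] with y h1 h2 h3
  by_cases c1 : R < |y.1|
  · left; rw [h1 c1, zero_mul]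
  by_cases c2 : R < |y.2.1|
  · left; rw [h2 c2, zero_mul, mul_zero]
  by_cases c3 : R < |y.2.2|
  · left; rw [h3 c3, mul_zero, mul_zero]
  exact Or.inr (curveSum_mem_sumBox hp (not_lt.1 c1) (not_lt.1 c2) (not_lt.1 c3))

lemma tripleConv_eq_zero_off_sumBox {p : ℝ} (hp : 1 < p) {R : ℝ} {f g h : L2 ℝ} (hf : SuppIn R f)
    (hg : SuppIn R g) (hh : SuppIn R h) :
    ∀ᵐ u : ℝ × ℝ, u ∉ sumBox p R → tripleConv hp f g h u = 0 := by
  set H := tripleConv hp f g h with hH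
  have hm : MemLp ((sumBox p R)ᶜ.indicator H) 2 volume :=
    (Lp.memLp H).indicator (measurableSet_sumBox p R).compl
  set ψ : L2 (ℝ × ℝ) := hm.toLp _ with hψ
  have h0 : inner ℂ ψ H = 0 := by
    rw [hH, inner_tripleConv]
    refine integral_eq_zero_of_ae ?_
    filter_upwards [ae_zero_or_mem_sumBox hp hf hg hh,
      (quasiMeasurePreserving_curveSum hp).ae hm.coeFn_toLp] with y h1 h2
    rcases h1 with h1 | h1
    · rw [h1, zero_mul]; rfl
    · rw [hψ, h2, Set.indicator_of_notMem (Set.notMem_compl_iff.2 h1)]; simp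
  have h1 : inner ℂ ψ H = inner ℂ ψ ψ := by
    rw [L2.inner_def, L2.inner_def]
    refine integral_congr_ae ?_
    filter_upwards [hm.coeFn_toLp] with u hu
    rw [hψ, hu]
    by_cases hmem : u ∈ sumBox p R
    · rw [Set.indicator_of_notMem (Set.notMem_compl_iff.2 hmem)]; simp
    · rw [Set.indicator_of_mem (by exact hmem)]
  rw [h0] at h1
  have h2 : ψ = 0 := inner_self_eq_zero.1 h1.symm
  filter_upwards [hm.coeFn_toLp, Lp.coeFn_zero ℂ 2 (volume : Measure (ℝ × ℝ))] with u h3 h4 hu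
  rw [← hψ, h2, h4, Set.indicator_of_mem (by exact hu)] at h3
  exact h3.symm

/-- The Fourier transform of the convolution is the product of the Fourier transforms. -/
lemma planeFourier_tripleConv {p : ℝ} (hp : 1 < p) {R : ℝ} {f g h : L2 ℝ} (hf : SuppIn R f)
    (hg : SuppIn R g) (hh : SuppIn R h) (z : ℝ × ℝ) :
    ∫ u, planeChar u z * tripleConv hp f g h u = extend p f z * (extend p g z * extend p h z) := by
  have hm : MemLp ((sumBox p R).indicator fun u => (starRingEnd ℂ) (planeChar u z)) 2 volume := by
    have : IsFiniteMeasure (volume.restrict (sumBox p R)) :=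
      ⟨by rw [Measure.restrict_apply_univ]; exact (volume_sumBox_ne_top p R).lt_top⟩
    refine (memLp_indicator_iff_restrict (measurableSet_sumBox p R)).2 (MemLp.of_bound
      (Complex.continuous_conj.comp (continuous_planeChar z)).aestronglyMeasurable 1
      (Eventually.of_forall fun u => ?_))
    rw [RCLike.norm_conj, norm_planeChar]
  set ψ : L2 (ℝ × ℝ) := hm.toLp _ with hψ
  calc ∫ u, planeChar u z * tripleConv hp f g h u = inner ℂ ψ (tripleConv hp f g h) := by
        rw [L2.inner_def]
        refine integral_congr_ae ?_
        filter_upwards [hm.coeFn_toLp, tripleConv_eq_zero_off_sumBox hp hf hg hh] with u h1 h2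
        rw [hψ, h1, RCLike.inner_apply]
        by_cases hu : u ∈ sumBox p R
        · rw [Set.indicator_of_mem hu, Complex.conj_conj, mul_comm]
        · rw [h2 hu]; simp
    _ = ∫ y : ℝ × ℝ × ℝ, (planeChar (y.1, |y.1| ^ p) z *
          (f y.1 * ((|y.1| ^ ((p - 2) / 6) : ℝ) : ℂ))) *
        ((planeChar (y.2.1, |y.2.1| ^ p) z * (g y.2.1 * ((|y.2.1| ^ ((p - 2) / 6) : ℝ) : ℂ))) *
        (planeChar (y.2.2, |y.2.2| ^ p) z * (h y.2.2 * ((|y.2.2| ^ ((p - 2) / 6) : ℝ) : ℂ)))) := by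
        rw [inner_tripleConv]
        refine integral_congr_ae ?_
        filter_upwards [ae_zero_or_mem_sumBox hp hf hg hh,
          (quasiMeasurePreserving_curveSum hp).ae hm.coeFn_toLp] with y h1 h2
        rcases h1 with h1 | h1
        · rw [h1, zero_mul]
          rcases mul_eq_zero.1 h1 with h1 | h1
          · simp [h1]
          · rcases mul_eq_zero.1 h1 with h1 | h1 <;> simp [h1]
        · rw [hψ, h2, Set.indicator_of_mem h1, map_mul, Complex.conj_conj, Complex.conj_ofReal,
            weight]
          have e : curveSum p y = (y.1, |y.1| ^ p) + ((y.2.1, |y.2.1| ^ p) + (y.2.2, |y.2.2| ^ p)) := by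
            simp only [curveSum, Prod.mk_add_mk, add_assoc]
          rw [e, planeChar_add, planeChar_add]
          push_cast
          ring
    _ = _ := by
        unfold extend
        rw [Measure.volume_eq_prod, integral_prod_mul (fun a : ℝ => planeChar (a, |a| ^ p) z *
          (f a * ((|a| ^ ((p - 2) / 6) : ℝ) : ℂ))) (fun q : ℝ × ℝ =>
          (planeChar (q.1, |q.1| ^ p) z * (g q.1 * ((|q.1| ^ ((p - 2) / 6) : ℝ) : ℂ))) *
          (planeChar (q.2, |q.2| ^ p) z * (h q.2 * ((|q.2| ^ ((p - 2) / 6) : ℝ) : ℂ))))]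
        congr 1
        rw [Measure.volume_eq_prod, integral_prod_mul (fun a : ℝ => planeChar (a, |a| ^ p) z *
          (g a * ((|a| ^ ((p - 2) / 6) : ℝ) : ℂ))) (fun a : ℝ => planeChar (a, |a| ^ p) z *
          (h a * ((|a| ^ ((p - 2) / 6) : ℝ) : ℂ)))]

/-- Plancherel's theorem turns the convolution into a product. -/
lemma lintegral_extend_mul {p : ℝ} (hp : 1 < p) {R : ℝ} {f g h : L2 ℝ} (hf : SuppIn R f)
    (hg : SuppIn R g) (hh : SuppIn R h) :
    ∫⁻ z, ‖extend p f z * (extend p g z * extend p h z)‖ₑ ^ 2 = ‖tripleConv hp f g h‖ₑ ^ 2 := by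
  have hint : Integrable (tripleConv hp f g h) := by
    have h1 : IntegrableOn (tripleConv hp f g h) (sumBox p R) := by
      have : IsFiniteMeasure (volume.restrict (sumBox p R)) :=
        ⟨by rw [Measure.restrict_apply_univ]; exact (volume_sumBox_ne_top p R).lt_top⟩
      exact ((Lp.memLp _).restrict _).integrable (by norm_num)
    exact h1.integrable_of_ae_notMem_eq_zero (tripleConv_eq_zero_off_sumBox hp hf hg hh)
  rw [enorm_sq_eq_lintegral, ← lintegral_planeFourier_sq hint (Lp.memLp _)]
  simp_rw [planeFourier_tripleConv hp hf hg hh]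

/-! ### Weak convergence -/

/-- Weak convergence of a sequence in a Hilbert space. -/
def WeakTendsto {H : Type*} [NormedAddCommGroup H] [InnerProductSpace ℂ H] (r : ℕ → H) (g : H) :
    Prop :=
  ∀ θ : H, Tendsto (fun n => inner ℂ θ (r n)) atTop (𝓝 (inner ℂ θ g))

/-- Bounded sequences in separable Hilbert spaces have weakly convergent subsequences. -/
lemma exists_weakTendsto_subseq {H : Type*} [NormedAddCommGroup H] [InnerProductSpace ℂ H]
    [CompleteSpace H] [TopologicalSpace.SeparableSpace H] {u : ℕ → H} {M : ℝ}
    (hu : ∀ n, ‖u n‖ ≤ M) : ∃ g : H, ∃ φ : ℕ → ℕ, StrictMono φ ∧ WeakTendsto (u ∘ φ) g := by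
  set x : ℕ → WeakDual ℂ H := fun n =>
    StrongDual.toWeakDual (𝕜 := ℂ) (E := H) (InnerProductSpace.toDual ℂ H (u n)) with hx
  obtain ⟨Λ, -, φ, hφ, hΛ⟩ := WeakDual.isSeqCompact_closedBall (𝕜 := ℂ) (E := H) 0 M
    (x := x) (fun n => by
      rw [Set.mem_preimage, Metric.mem_closedBall, dist_zero_right]
      exact (le_of_eq ((InnerProductSpace.toDual ℂ H).norm_map (u n))).trans (hu n))
  set L : StrongDual ℂ H := WeakDual.toStrongDual Λ with hL
  refine ⟨(InnerProductSpace.toDual ℂ H).symm L, φ, hφ, fun θ => ?_⟩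
  have h1 : Tendsto (fun n => inner ℂ (u (φ n)) θ) atTop (𝓝 (Λ θ)) :=
    ((WeakDual.eval_continuous θ).tendsto Λ).comp hΛ
  have h2 := (Complex.continuous_conj.tendsto _).comp h1
  have h3 : (starRingEnd ℂ) (Λ θ) =
      inner ℂ θ ((InnerProductSpace.toDual ℂ H).symm L) := by
    rw [← inner_conj_symm, InnerProductSpace.toDual_symm_apply]
    rfl
  rw [← h3]
  refine h2.congr fun n => ?_
  simp only [Function.comp_apply, inner_conj_symm]

lemma WeakTendsto.sub_const {H : Type*} [NormedAddCommGroup H] [InnerProductSpace ℂ H]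
    {r : ℕ → H} {g : H} (h : WeakTendsto r g) : WeakTendsto (fun n => r n - g) 0 := fun θ => by
  simpa [inner_sub_right] using (h θ).sub_const (inner ℂ θ g)

lemma tendsto_enorm_sq_iff {H : Type*} [NormedAddCommGroup H] {u : ℕ → H} :
    Tendsto (fun n => ‖u n‖ₑ ^ 2) atTop (𝓝 0) ↔ Tendsto (fun n => ‖u n‖) atTop (𝓝 0) := by
  constructor
  · intro h
    have h1 := (ENNReal.continuous_rpow_const (y := 1 / 2)).tendsto 0 |>.comp h
    have h2 := (ENNReal.tendsto_toReal (by simp)).comp h1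
    simp only [one_div, ENNReal.zero_rpow_of_pos (by norm_num : (0 : ℝ) < 2⁻¹),
      ENNReal.toReal_zero] at h2
    refine h2.congr fun n => ?_
    simp only [Function.comp_apply]
    rw [← ENNReal.rpow_natCast, ← ENNReal.rpow_mul]
    norm_num
  · intro h
    have h1 := (ENNReal.continuous_ofReal.tendsto _).comp (h.pow 2)
    simp only [ne_eq, OfNat.ofNat_ne_zero, not_false_eq_true, zero_pow, ENNReal.ofReal_zero] at h1
    refine h1.congr fun n => ?_
    rw [Function.comp_apply, ENNReal.ofReal_pow (norm_nonneg _), ofReal_norm]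

/-- The tensor product of a weakly null sequence with a bounded sequence is weakly null. -/
lemma tendsto_inner_tensor {α β : Type*} [MeasureSpace α] [MeasureSpace β]
    [SFinite (volume : Measure α)] [SFinite (volume : Measure β)] {r : ℕ → L2 α} {s : ℕ → L2 β}
    {M : ℝ} (hr : ∀ n, ‖r n‖ ≤ M) (hs : ∀ n, ‖s n‖ ≤ M) (hw : WeakTendsto r 0)
    (Ψ : L2 (α × β)) : Tendsto (fun n => inner ℂ Ψ (tensor (r n) (s n))) atTop (𝓝 0) := by
  have hM : 0 ≤ M := (norm_nonneg _).trans (hr 0)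
  set h : ℕ → β → ℂ := fun n b => ∫ a, r n a * (starRingEnd ℂ) (Ψ (a, b)) with hh
  have hΨm : StronglyMeasurable fun q : α × β => Ψ q := Lp.stronglyMeasurable Ψ
  have hΨs : Measurable fun q : α × β => ‖Ψ q‖ₑ ^ 2 := hΨm.enorm.pow_const 2
  have hfin : ∫⁻ b, ∫⁻ a, ‖Ψ (a, b)‖ₑ ^ 2 = ‖Ψ‖ₑ ^ 2 := by
    rw [enorm_sq_eq_lintegral]
    exact (lintegral_prod_symm' _ hΨs).symm
  have hΨfin : ‖Ψ‖ₑ ^ 2 ≠ ∞ := by simp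
  have hsl : ∀ᵐ b, ∫⁻ a, ‖Ψ (a, b)‖ₑ ^ 2 < ∞ := by
    refine ae_lt_top hΨs.lintegral_prod_left' ?_
    rw [hfin]; exact hΨfin
  have hslm : ∀ b, AEStronglyMeasurable (fun a => Ψ (a, b)) (volume : Measure α) := fun b =>
    (hΨm.comp_measurable (by fun_prop)).aestronglyMeasurable
  have hinner : ∀ n b (hm : MemLp (fun a => Ψ (a, b)) 2 volume), h n b = inner ℂ (hm.toLp _) (r n) :=
    fun n b hm => by
      rw [L2.inner_def]
      refine integral_congr_ae ?_
      filter_upwards [hm.coeFn_toLp] with a ha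
      rw [ha, RCLike.inner_apply]
  have hhm : ∀ n, StronglyMeasurable (h n) := fun n => by
    refine StronglyMeasurable.integral_prod_left'
      (f := fun q : α × β => r n q.1 * (starRingEnd ℂ) (Ψ q)) ?_
    exact ((Lp.stronglyMeasurable (r n)).comp_measurable measurable_fst).mul
      (Complex.continuous_conj.comp_stronglyMeasurable hΨm)
  -- `h n b` is the inner product of `r n` with a slice of `Ψ`; it tends to zero for almost all `b`
  have hlim : Tendsto (fun n => ∫⁻ b, ‖h n b‖ₑ ^ 2) atTop (𝓝 0) := by
    have := tendsto_lintegral_of_dominated_convergence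
      (F := fun n b => ‖h n b‖ₑ ^ 2) (f := fun _ => 0) (μ := (volume : Measure β))
      (fun b => (∫⁻ a, ‖Ψ (a, b)‖ₑ ^ 2) * ENNReal.ofReal M ^ 2)
      (fun n => (hhm n).enorm.pow_const 2) (fun n => ?_) ?_ ?_
    · simpa using this
    · filter_upwards [hsl] with b hb
      have hm := memLp_two_of_lintegral (hslm b) hb.ne
      rw [hinner n b hm, ← enorm_toLp_sq hm, ← mul_pow]
      gcongr
      rw [← ofReal_norm, ← ofReal_norm, ← ENNReal.ofReal_mul (norm_nonneg _)]
      refine ENNReal.ofReal_le_ofReal ((norm_inner_le_norm _ _).trans ?_)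
      gcongr
      exact hr n
    · rw [lintegral_mul_const _ hΨs.lintegral_prod_left', hfin]
      exact ENNReal.mul_ne_top hΨfin (by simp)
    · filter_upwards [hsl] with b hb
      have hm := memLp_two_of_lintegral (hslm b) hb.ne
      have h1 := hw (hm.toLp _)
      rw [inner_zero_right] at h1
      have h2 : Tendsto (fun n => ‖h n b‖ₑ) atTop (𝓝 0) := by
        have := (continuous_enorm.tendsto _).comp h1
        rw [enorm_zero] at this
        refine this.congr fun n => ?_
        rw [Function.comp_apply, hinner n b hm]
      have h3 := ((ENNReal.continuous_pow 2).tendsto 0).comp h2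
      simpa [Function.comp_def] using h3
  have hbound : ∀ n, ‖inner ℂ Ψ (tensor (r n) (s n))‖ₑ ^ 2 ≤
      ENNReal.ofReal M ^ 2 * ∫⁻ b, ‖h n b‖ₑ ^ 2 := by
    intro n
    have e1 : inner ℂ Ψ (tensor (r n) (s n)) = ∫ b, s n b * h n b := by
      have hint : Integrable (fun q : α × β => (r n q.1 * s n q.2) * (starRingEnd ℂ) (Ψ q)) := by
        refine (L2.integrable_inner (𝕜 := ℂ) Ψ (tensor (r n) (s n))).congr ?_
        filter_upwards [coeFn_tensor (r n) (s n)] with q hq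
        rw [hq, RCLike.inner_apply]
      calc inner ℂ Ψ (tensor (r n) (s n))
          = ∫ q : α × β, (r n q.1 * s n q.2) * (starRingEnd ℂ) (Ψ q) := by
            rw [L2.inner_def]
            refine integral_congr_ae ?_
            filter_upwards [coeFn_tensor (r n) (s n)] with q hq
            rw [hq, RCLike.inner_apply]
        _ = ∫ b, ∫ a, (r n a * s n b) * (starRingEnd ℂ) (Ψ (a, b)) := by
            exact integral_prod_symm _ hint
        _ = _ := by
            refine integral_congr_ae (Eventually.of_forall fun b => ?_)
            simp only [hh]
            rw [← integral_const_mul]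
            refine integral_congr_ae (Eventually.of_forall fun a => ?_)
            ring
    calc ‖inner ℂ Ψ (tensor (r n) (s n))‖ₑ ^ 2 ≤ (∫⁻ b, ‖s n b‖ₑ * ‖h n b‖ₑ) ^ 2 := by
          rw [e1]
          gcongr
          refine (enorm_integral_le_lintegral_enorm _).trans (le_of_eq ?_)
          simp_rw [enorm_mul]
      _ ≤ (∫⁻ b, ‖s n b‖ₑ ^ 2) * ∫⁻ b, ‖h n b‖ₑ ^ 2 :=
          lintegral_mul_sq_le (Lp.stronglyMeasurable (s n)).enorm.aemeasurable
            (hhm n).enorm.aemeasurable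
      _ ≤ _ := by
          rw [← enorm_sq_eq_lintegral, ← ofReal_norm]
          gcongr
          exact hs n
  have h4 : Tendsto (fun n => ‖inner ℂ Ψ (tensor (r n) (s n))‖ₑ ^ 2) atTop (𝓝 0) := by
    have h5 := ENNReal.Tendsto.const_mul (a := ENNReal.ofReal M ^ 2) hlim (Or.inr (by simp))
    rw [mul_zero] at h5
    exact tendsto_of_tendsto_of_tendsto_of_le_of_le tendsto_const_nhds h5 (fun _ => zero_le) hbound
  rw [tendsto_zero_iff_norm_tendsto_zero]
  exact tendsto_enorm_sq_iff.1 h4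

lemma tendsto_inner_tripleConv {p : ℝ} (hp : 1 < p) {r : ℕ → L2 ℝ} {M : ℝ} (hr : ∀ n, ‖r n‖ ≤ M)
    (hw : WeakTendsto r 0) (ψ : L2 (ℝ × ℝ)) :
    Tendsto (fun n => inner ℂ ψ (tripleConv hp (r n) (r n) (r n))) atTop (𝓝 0) := by
  have hM : 0 ≤ M := (norm_nonneg _).trans (hr 0)
  have h := tendsto_inner_tensor (s := fun n => tensor (r n) (r n)) (M := max M (M * M))
    (fun n => (hr n).trans (le_max_left _ _)) (fun n => by
      rw [norm_tensor]
      exact le_max_of_le_right (mul_le_mul (hr n) (hr n) (norm_nonneg _) hM)) hw (pullback hp ψ)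
  refine h.congr fun n => ?_
  rw [tripleConv, convOp, ContinuousLinearMap.adjoint_inner_right]

/-! ### Truncation -/

/-- The restriction of `f` to `[-R, R]`. -/
def trunc (R : ℝ) (f : L2 ℝ) : L2 ℝ :=
  ((Lp.memLp f).indicator (measurableSet_Icc (a := -R) (b := R))).toLp _

lemma coeFn_trunc (R : ℝ) (f : L2 ℝ) :
    trunc R f =ᵐ[volume] (Set.Icc (-R) R).indicator f := MemLp.coeFn_toLp _

lemma suppIn_trunc (R : ℝ) (f : L2 ℝ) : SuppIn R (trunc R f) := by
  filter_upwards [coeFn_trunc R f] with y hy hR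
  rw [hy, Set.indicator_of_notMem]
  exact fun h => not_le.2 hR (abs_le.2 h)

lemma SuppIn.mono {R S : ℝ} (hRS : R ≤ S) {f : L2 ℝ} (hf : SuppIn R f) : SuppIn S f := by
  filter_upwards [hf] with y hy hS using hy (lt_of_le_of_lt hRS hS)

lemma norm_trunc_le (R : ℝ) (f : L2 ℝ) : ‖trunc R f‖ ≤ ‖f‖ := by
  refine Lp.norm_le_norm_of_ae_le ?_
  filter_upwards [coeFn_trunc R f] with y hy
  rw [hy]
  exact norm_indicator_le_norm_self _ _

lemma inner_trunc (R : ℝ) (θ f : L2 ℝ) : inner ℂ θ (trunc R f) = inner ℂ (trunc R θ) f := by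
  rw [L2.inner_def, L2.inner_def]
  refine integral_congr_ae ?_
  filter_upwards [coeFn_trunc R f, coeFn_trunc R θ] with y h1 h2
  rw [h1, h2]
  by_cases hy : y ∈ Set.Icc (-R) R
  · rw [Set.indicator_of_mem hy, Set.indicator_of_mem hy]
  · rw [Set.indicator_of_notMem hy, Set.indicator_of_notMem hy]; simp

lemma WeakTendsto.trunc {r : ℕ → L2 ℝ} (h : WeakTendsto r 0) (R : ℝ) :
    WeakTendsto (fun n => trunc R (r n)) 0 := fun θ => by
  simp_rw [inner_trunc]
  simpa using h (PowerCurve.trunc R θ)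

lemma exists_norm_sub_trunc_le (f : L2 ℝ) {ε : ℝ} (hε : 0 < ε) :
    ∃ A : ℝ, 0 ≤ A ∧ ‖f - trunc A f‖ ≤ ε := by
  have hfm := measurable_enorm_L2 f
  have hsq : ∀ n : ℕ, ‖f - trunc n f‖ₑ ^ 2 =
      ∫⁻ y, (Set.Icc (-n : ℝ) n)ᶜ.indicator (fun y => ‖f y‖ₑ ^ 2) y := by
    intro n
    rw [enorm_sq_eq_lintegral]
    refine lintegral_congr_ae ?_
    filter_upwards [Lp.coeFn_sub f (trunc n f), coeFn_trunc n f] with y h1 h2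
    rw [h1, Pi.sub_apply, h2]
    by_cases hy : y ∈ Set.Icc (-n : ℝ) n
    · rw [Set.indicator_of_mem hy, Set.indicator_of_notMem (Set.notMem_compl_iff.2 hy)]; simp
    · rw [Set.indicator_of_notMem hy, Set.indicator_of_mem (by exact hy), sub_zero]
  have hlim : Tendsto (fun n : ℕ => ‖f - trunc n f‖ₑ ^ 2) atTop (𝓝 0) := by
    simp_rw [hsq]
    have := tendsto_lintegral_of_dominated_convergence (μ := volume)
      (F := fun (n : ℕ) y => (Set.Icc (-n : ℝ) n)ᶜ.indicator (fun y => ‖f y‖ₑ ^ 2) y)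
      (f := fun _ => 0) (fun y => ‖f y‖ₑ ^ 2)
      (fun n => (hfm.pow_const 2).indicator measurableSet_Icc.compl)
      (fun n => Eventually.of_forall fun y => Set.indicator_le_self _ _ _)
      (by rw [← enorm_sq_eq_lintegral]; simp) (Eventually.of_forall fun y => ?_)
    · simpa using this
    · obtain ⟨N, hN⟩ := exists_nat_ge |y|
      refine tendsto_const_nhds.congr' ?_
      filter_upwards [eventually_ge_atTop N] with n hn
      rw [Set.indicator_of_notMem]
      rw [Set.notMem_compl_iff]
      exact abs_le.1 (hN.trans (by exact_mod_cast hn))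
  have hε2 : (0 : ℝ≥0∞) < ENNReal.ofReal (ε ^ 2) := ENNReal.ofReal_pos.2 (by positivity)
  obtain ⟨n, hn⟩ := (hlim.eventually (gt_mem_nhds hε2)).exists
  refine ⟨n, Nat.cast_nonneg n, ?_⟩
  rw [← ofReal_norm, ← ENNReal.ofReal_pow (norm_nonneg _)] at hn
  exact (abs_le_of_sq_le_sq' (ENNReal.ofReal_le_ofReal_iff (by positivity) |>.1 hn.le) hε.le).2

/-! ### Weakly null sequences decouple -/

/-- If `u n` is bounded both pointwise and in `L²` and converges to zero pointwise, then it
converges to zero weakly in `L²`. -/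
lemma tendsto_lintegral_mul_zero {α : Type*} [MeasurableSpace α] {μ : Measure α} {v : α → ℝ≥0∞}
    {u : ℕ → α → ℝ≥0∞} (hv : Measurable v) (hu : ∀ n, Measurable (u n))
    (hv2 : ∫⁻ x, v x ^ 2 ∂μ ≠ ∞) {K : ℝ≥0∞} (hK : K ≠ ∞) (huK : ∀ n x, u n x ≤ K) {M : ℝ≥0∞}
    (hM : M ≠ ∞) (hu2 : ∀ n, ∫⁻ x, u n x ^ 2 ∂μ ≤ M) (hvt : ∀ x, v x ≠ ∞)
    (hlim : ∀ x, Tendsto (fun n => u n x) atTop (𝓝 0)) :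
    Tendsto (fun n => ∫⁻ x, v x * u n x ∂μ) atTop (𝓝 0) := by
  -- the tail of `v`, where it is small
  set S : ℕ → Set α := fun k => {x | ((k : ℝ≥0∞) + 1) * v x ≤ 1} with hS
  have hSm : ∀ k, MeasurableSet (S k) := fun k =>
    measurableSet_le (hv.const_mul _) measurable_const
  have htail : Tendsto (fun k => ∫⁻ x in S k, v x ^ 2 ∂μ) atTop (𝓝 0) := by
    have := tendsto_lintegral_of_dominated_convergence (μ := μ)
      (F := fun k => (S k).indicator (fun x => v x ^ 2)) (f := fun _ => 0) (fun x => v x ^ 2)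
      (fun k => (hv.pow_const 2).indicator (hSm k))
      (fun k => Eventually.of_forall fun x => Set.indicator_le_self _ _ _) hv2
      (Eventually.of_forall fun x => ?_)
    · simp only [lintegral_zero] at this
      refine this.congr fun k => lintegral_indicator (hSm k) _
    · rcases eq_or_ne (v x) 0 with h0 | h0
      · refine tendsto_const_nhds.congr fun k => ?_
        simp [Set.indicator, h0]
      · obtain ⟨N, hN⟩ := ENNReal.exists_nat_gt (r := (v x)⁻¹) (by simpa using h0)
        refine tendsto_const_nhds.congr' ?_
        filter_upwards [eventually_ge_atTop N] with k hk
        rw [Set.indicator_of_notMem]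
        intro hx
        have h1 : ((k : ℝ≥0∞) + 1) * v x ≤ 1 := hx
        have h2 : (v x)⁻¹ < (k : ℝ≥0∞) + 1 := by
          refine hN.trans_le (le_trans ?_ le_self_add)
          exact_mod_cast hk
        have h3 : (v x)⁻¹ * v x < ((k : ℝ≥0∞) + 1) * v x :=
          (ENNReal.mul_lt_mul_iff_left h0 (hvt x)).2 h2
        rw [ENNReal.inv_mul_cancel h0 (hvt x)] at h3
        exact absurd h1 (not_le.2 h3)
  rw [ENNReal.tendsto_nhds_zero]
  intro ε hε
  have hε2 : 0 < ε / 2 := ENNReal.half_pos hε.ne'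
  have htail' := ENNReal.Tendsto.mul_const (b := M) htail (Or.inr hM)
  rw [zero_mul] at htail'
  obtain ⟨k, hk⟩ := (htail'.eventually (gt_mem_nhds (ENNReal.pow_pos hε2 2))).exists
  -- where `1 ≤ (k + 1) v`, the function `v` is bounded by a multiple of the integrable `v ^ 2`
  have hmain : Tendsto (fun n => ∫⁻ x in (S k)ᶜ, v x * u n x ∂μ) atTop (𝓝 0) := by
    have := tendsto_lintegral_of_dominated_convergence (μ := μ.restrict (S k)ᶜ)
      (F := fun n x => v x * u n x) (f := fun _ => 0)
      (fun x => v x ^ 2 * (((k : ℝ≥0∞) + 1) * K)) (fun n => hv.mul (hu n)) (fun n => ?_) ?_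
      (Eventually.of_forall fun x => ?_)
    · simpa using this
    · rw [EventuallyLE, ae_restrict_iff' (hSm k).compl]
      refine Eventually.of_forall fun x hx => ?_
      have h1 : 1 ≤ ((k : ℝ≥0∞) + 1) * v x := (not_le.1 (show ¬((k : ℝ≥0∞) + 1) * v x ≤ 1 from hx)).le
      calc v x * u n x ≤ v x * K := by gcongr; exact huK n x
        _ = 1 * (v x * K) := (one_mul _).symm
        _ ≤ (((k : ℝ≥0∞) + 1) * v x) * (v x * K) := by gcongr
        _ = _ := by ring
    · rw [lintegral_mul_const _ (hv.pow_const 2)]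
      refine ENNReal.mul_ne_top (ne_top_of_le_ne_top hv2 (setLIntegral_le_lintegral _ _))
        (ENNReal.mul_ne_top ?_ hK)
      exact ENNReal.add_ne_top.2 ⟨ENNReal.natCast_ne_top k, ENNReal.one_ne_top⟩
    · have := ENNReal.Tendsto.const_mul (a := v x) (hlim x) (Or.inr (hvt x))
      rwa [mul_zero] at this
  filter_upwards [(ENNReal.tendsto_nhds_zero.1 hmain) _ hε2] with n hn
  have h1 : ∫⁻ x in S k, v x * u n x ∂μ ≤ ε / 2 := by
    refine (ENNReal.pow_right_strictMono two_ne_zero).le_iff_le.1 ?_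
    calc _ ≤ (∫⁻ x in S k, v x ^ 2 ∂μ) * ∫⁻ x in S k, u n x ^ 2 ∂μ :=
          lintegral_mul_sq_le hv.aemeasurable (hu n).aemeasurable
      _ ≤ (∫⁻ x in S k, v x ^ 2 ∂μ) * M := by
          gcongr
          exact (setLIntegral_le_lintegral _ _).trans (hu2 n)
      _ ≤ _ := hk.le
  rw [← lintegral_add_compl _ (hSm k), ← ENNReal.add_halves ε]
  exact add_le_add h1 hn

lemma measurable_enorm_extend (p : ℝ) (f : L2 ℝ) : Measurable fun z => ‖extend p f z‖ₑ :=
  (measurable_extend p f).enorm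

/-- By Plancherel's theorem, the Cauchy–Schwarz inequality for the products of the Fourier
transforms. -/
lemma norm_tripleConv_sq_le {p : ℝ} (hp : 1 < p) {R : ℝ} {g a r : L2 ℝ} (hg : SuppIn R g)
    (ha : SuppIn R a) (hr : SuppIn R r) :
    ‖tripleConv hp g a r‖ ^ 2 ≤ ‖tripleConv hp g g r‖ * ‖tripleConv hp a a r‖ := by
  have hgm := measurable_enorm_extend p g
  have ham := measurable_enorm_extend p a
  have hrm := measurable_enorm_extend p r
  have h1 : ‖tripleConv hp g a r‖ₑ ^ 2 = ∫⁻ z, (‖extend p g z‖ₑ * ‖extend p g z‖ₑ *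
      ‖extend p r z‖ₑ) * (‖extend p a z‖ₑ * ‖extend p a z‖ₑ * ‖extend p r z‖ₑ) := by
    rw [← lintegral_extend_mul hp hg ha hr]
    refine lintegral_congr fun z => ?_
    rw [enorm_mul, enorm_mul]; ring
  have h2 : ∀ {f : L2 ℝ}, SuppIn R f → ∫⁻ z, (‖extend p f z‖ₑ * ‖extend p f z‖ₑ *
      ‖extend p r z‖ₑ) ^ 2 = ‖tripleConv hp f f r‖ₑ ^ 2 := fun {f} hf => by
    rw [← lintegral_extend_mul hp hf hf hr]
    refine lintegral_congr fun z => ?_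
    rw [enorm_mul, enorm_mul]; ring
  have h3 := lintegral_mul_sq_le (μ := volume) ((hgm.mul hgm).mul hrm).aemeasurable
    ((ham.mul ham).mul hrm).aemeasurable
  simp only [Pi.mul_apply] at h3
  rw [← h1, h2 hg, h2 ha, ← mul_pow] at h3
  have h4 := (ENNReal.pow_right_strictMono two_ne_zero).le_iff_le.1 h3
  rw [← ofReal_norm, ← ofReal_norm, ← ofReal_norm, ← ENNReal.ofReal_pow (norm_nonneg _),
    ← ENNReal.ofReal_mul (norm_nonneg _)] at h4
  exact (ENNReal.ofReal_le_ofReal_iff (by positivity)).1 h4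

lemma norm_tripleConv_le_of_le {p : ℝ} (hp : 1 < p) {f g h : L2 ℝ} {A B C : ℝ} (hf : ‖f‖ ≤ A)
    (hg : ‖g‖ ≤ B) (hh : ‖h‖ ≤ C) : ‖tripleConv hp f g h‖ ≤ ‖convOp hp‖ * (A * (B * C)) := by
  have hA : 0 ≤ A := (norm_nonneg _).trans hf
  have hB : 0 ≤ B := (norm_nonneg _).trans hg
  refine (norm_tripleConv_le hp f g h).trans ?_
  gcongr

/-- Decoupling for uniformly bounded supports: the Fourier transforms of the measures `rₙ σ_p` are
uniformly bounded and tend to zero pointwise. -/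
lemma tendsto_tripleConv_of_suppIn {p : ℝ} (hp : 1 < p) {R : ℝ} (hR : 0 ≤ R) {g : L2 ℝ}
    {a r : ℕ → L2 ℝ} (hg : SuppIn R g) (ha : ∀ n, SuppIn R (a n)) (hr : ∀ n, SuppIn R (r n))
    {M : ℝ} (haM : ∀ n, ‖a n‖ ≤ M) (hrM : ∀ n, ‖r n‖ ≤ M) (hw : WeakTendsto r 0) :
    Tendsto (fun n => ‖tripleConv hp g (a n) (r n)‖) atTop (𝓝 0) := by
  have hM : 0 ≤ M := (norm_nonneg _).trans (hrM 0)
  have hgm := measurable_enorm_extend p g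
  have hrm := fun n => measurable_enorm_extend p (r n)
  set B := √(2 * R ^ ((p - 2) / 3 + 1) / ((p - 2) / 3 + 1)) with hB
  have hext : ∀ {f : L2 ℝ} {C : ℝ}, SuppIn R f → ‖f‖ ≤ C → ∀ z,
      ‖extend p f z‖ₑ ≤ ENNReal.ofReal (B * C) := fun {f C} hf hC z => by
    rw [← ofReal_norm]
    refine ENNReal.ofReal_le_ofReal ((norm_extend_le hp hR hf z).trans ?_)
    gcongr
  have hggr : Tendsto (fun n => ‖tripleConv hp g g (r n)‖) atTop (𝓝 0) := by
    rw [← tendsto_enorm_sq_iff]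
    -- `|GGRₙ|² = |G|³ (|G| |Rₙ|²)` for the Fourier transforms `G`, `Rₙ` of `g σ_p`, `rₙ σ_p`
    have key := tendsto_lintegral_mul_zero (μ := volume) (v := fun z => ‖extend p g z‖ₑ ^ 3)
      (u := fun n z => ‖extend p g z‖ₑ * ‖extend p (r n) z‖ₑ ^ 2) (hgm.pow_const 3)
      (fun n => hgm.mul ((hrm n).pow_const 2)) ?_
      (K := ENNReal.ofReal (B * ‖g‖) * ENNReal.ofReal (B * M) ^ 2)
      (ENNReal.mul_ne_top (by simp) (by simp)) (fun n z => ?_)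
      (M := ENNReal.ofReal (‖convOp hp‖ * (‖g‖ * (M * M))) ^ 2)
      (ENNReal.pow_ne_top ENNReal.ofReal_ne_top) (fun n => ?_)
      (fun z => by simp) (fun z => ?_)
    · refine key.congr fun n => ?_
      rw [← lintegral_extend_mul hp hg hg (hr n)]
      refine lintegral_congr fun z => ?_
      rw [enorm_mul, enorm_mul]; ring
    · have e : ∫⁻ z, (‖extend p g z‖ₑ ^ 3) ^ 2 = ‖tripleConv hp g g g‖ₑ ^ 2 := by
        rw [← lintegral_extend_mul hp hg hg hg]
        refine lintegral_congr fun z => ?_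
        rw [enorm_mul, enorm_mul]; ring
      rw [e]; simp
    · gcongr
      · exact hext hg le_rfl z
      · exact hext (hr n) (hrM n) z
    · have e : ∫⁻ z, (‖extend p g z‖ₑ * ‖extend p (r n) z‖ₑ ^ 2) ^ 2 =
          ‖tripleConv hp g (r n) (r n)‖ₑ ^ 2 := by
        rw [← lintegral_extend_mul hp hg (hr n) (hr n)]
        refine lintegral_congr fun z => ?_
        rw [enorm_mul, enorm_mul]; ring
      rw [e, ← ofReal_norm]
      gcongr
      exact norm_tripleConv_le_of_le hp le_rfl (hrM n) (hrM n)
    · have h1 : Tendsto (fun n => ‖extend p (r n) z‖ₑ) atTop (𝓝 0) := by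
        have h2 := (continuous_enorm.tendsto _).comp
          (hw ((memLp_extendKernelFun hp hR z).toLp _))
        rw [inner_zero_right, enorm_zero] at h2
        refine h2.congr fun n => ?_
        rw [Function.comp_apply, ← extend_eq_inner hp hR (hr n)]
      have h3 := ((ENNReal.continuous_pow 2).tendsto 0).comp h1
      have h4 := ENNReal.Tendsto.const_mul (a := ‖extend p g z‖ₑ) h3 (Or.inr (by simp))
      simpa [Function.comp_def] using h4
  have h1 : ∀ n, ‖tripleConv hp g (a n) (r n)‖ ^ 2 ≤
      ‖tripleConv hp g g (r n)‖ * (‖convOp hp‖ * (M * (M * M))) := fun n =>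
    (norm_tripleConv_sq_le hp hg (ha n) (hr n)).trans (by
      gcongr
      exact norm_tripleConv_le_of_le hp (haM n) (haM n) (hrM n))
  have h2 : Tendsto (fun n => ‖tripleConv hp g (a n) (r n)‖ ^ 2) atTop (𝓝 0) := by
    have h3 := hggr.mul_const (‖convOp hp‖ * (M * (M * M)))
    rw [zero_mul] at h3
    exact squeeze_zero (fun _ => by positivity) h1 h3
  have h4 := (Real.continuous_sqrt.tendsto 0).comp h2
  rw [Real.sqrt_zero] at h4
  refine h4.congr fun n => ?_
  rw [Function.comp_apply, Real.sqrt_sq (norm_nonneg _)]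

/-- If one abscissa is confined to a bounded set, then the interaction with large abscissae is
negligible. -/
lemma exists_norm_tripleConv_sub_trunc_le {p : ℝ} (hp : 1 < p) {A : ℝ} (hA : 0 ≤ A) {g : L2 ℝ}
    (hg : SuppIn A g) {M : ℝ} (hM : 0 ≤ M) {ε : ℝ} (hε : 0 < ε) :
    ∃ ρ, A ≤ ρ ∧ ∀ a r : L2 ℝ, ‖a‖ ≤ M → ‖r‖ ≤ M →
      ‖tripleConv hp g a r - tripleConv hp g (trunc ρ a) (trunc ρ r)‖ ≤ ε := by
  set δ : ℝ := ε / (2 * ‖g‖ * M ^ 2 + 1) with hδ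
  have hδ0 : 0 < δ := by positivity
  obtain ⟨R₀, hfar⟩ := exists_curveBound_farSet hp (ε := ENNReal.ofReal (δ ^ 2)) (by positivity)
  set R := max R₀ 1 with hR
  have hR1 : 1 ≤ R := le_max_right _ _
  have hfar := hfar R (le_max_left _ _)
  refine ⟨R * A, by nlinarith, fun a r ha hr => ?_⟩
  set F := tensor g (tensor a r) - tensor g (tensor (trunc (R * A) a) (trunc (R * A) r)) with hF
  have hFn : ‖F‖ ≤ 2 * ‖g‖ * M ^ 2 := by
    have h1 : ‖tensor g (tensor a r)‖ ≤ ‖g‖ * (M * M) := by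
      rw [norm_tensor, norm_tensor]; gcongr
    have h2 : ‖tensor g (tensor (trunc (R * A) a) (trunc (R * A) r))‖ ≤ ‖g‖ * (M * M) := by
      rw [norm_tensor, norm_tensor]
      gcongr
      exacts [(norm_trunc_le _ _).trans ha, (norm_trunc_le _ _).trans hr]
    calc _ ≤ _ := norm_sub_le _ _
      _ ≤ ‖g‖ * (M * M) + ‖g‖ * (M * M) := add_le_add h1 h2
      _ = _ := by ring
  have hF0 : ∀ᵐ y, y ∉ farSet R → F y = 0 := by
    have ha1 : ∀ᵐ q : ℝ × ℝ, trunc (R * A) a q.1 = (Set.Icc (-(R * A)) (R * A)).indicator a q.1 :=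
      Measure.quasiMeasurePreserving_fst.ae (coeFn_trunc (R * A) a)
    have hr1 : ∀ᵐ q : ℝ × ℝ, trunc (R * A) r q.2 = (Set.Icc (-(R * A)) (R * A)).indicator r q.2 :=
      Measure.quasiMeasurePreserving_snd.ae (coeFn_trunc (R * A) r)
    have hg2 : ∀ᵐ y : ℝ × ℝ × ℝ, A < |y.1| → g y.1 = 0 := Measure.quasiMeasurePreserving_fst.ae hg
    have ha2 : ∀ᵐ y : ℝ × ℝ × ℝ, trunc (R * A) a y.2.1 =
      (Set.Icc (-(R * A)) (R * A)).indicator a y.2.1 := Measure.quasiMeasurePreserving_snd.ae ha1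
    have hr2 : ∀ᵐ y : ℝ × ℝ × ℝ, trunc (R * A) r y.2.2 =
      (Set.Icc (-(R * A)) (R * A)).indicator r y.2.2 := Measure.quasiMeasurePreserving_snd.ae hr1
    filter_upwards [coeFn_tensor_triple g a r, coeFn_tensor_triple g (trunc (R * A) a)
      (trunc (R * A) r), Lp.coeFn_sub (tensor g (tensor a r))
      (tensor g (tensor (trunc (R * A) a) (trunc (R * A) r))), hg2, ha2, hr2] with
      y e1 e2 e3 e4 e5 e6 hy
    rw [hF, e3, Pi.sub_apply, e1, e2]
    by_cases hyA : A < |y.1|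
    · rw [e4 hyA]; simp
    · have h1 : maxAbs y ≤ R * minAbs y := not_lt.1 hy
      have h2 : R * minAbs y ≤ R * A := by
        gcongr
        exact (minAbs_le_abs y).1.trans (not_lt.1 hyA)
      have h3 := abs_le_maxAbs y
      rw [e5, e6, Set.indicator_of_mem (by exact abs_le.1 (by linarith)),
        Set.indicator_of_mem (by exact abs_le.1 (by linarith)), sub_self]
  have h1 := enorm_convOp_sq_le hp F hfar (measurableSet_farSet R) hF0
  rw [← ofReal_norm, ← ofReal_norm, ← ENNReal.ofReal_pow (norm_nonneg _),
    ← ENNReal.ofReal_pow (norm_nonneg _), ← ENNReal.ofReal_mul (by positivity),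
    ENNReal.ofReal_le_ofReal_iff (by positivity), ← mul_pow] at h1
  have h2 : ‖convOp hp F‖ ≤ δ * ‖F‖ := (abs_le_of_sq_le_sq' h1 (by positivity)).2
  rw [tripleConv, tripleConv, ← map_sub]
  calc _ ≤ δ * ‖F‖ := h2
    _ ≤ δ * (2 * ‖g‖ * M ^ 2) := by gcongr
    _ ≤ ε := by
        rw [hδ, div_mul_eq_mul_div, div_le_iff₀ (by positivity)]
        nlinarith

/-- The interaction of a fixed function with a weakly null sequence is negligible. -/
lemma tendsto_tripleConv_of_weak {p : ℝ} (hp : 1 < p) (g : L2 ℝ) {a r : ℕ → L2 ℝ} {M : ℝ}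
    (haM : ∀ n, ‖a n‖ ≤ M) (hrM : ∀ n, ‖r n‖ ≤ M) (hw : WeakTendsto r 0) :
    Tendsto (fun n => ‖tripleConv hp g (a n) (r n)‖) atTop (𝓝 0) := by
  have hM : 0 ≤ M := (norm_nonneg _).trans (hrM 0)
  rw [Metric.tendsto_atTop]
  intro ε hε
  obtain ⟨A, hA, hgA⟩ := exists_norm_sub_trunc_le g
    (ε := ε / 4 / (‖convOp hp‖ * (M * M) + 1)) (by positivity)
  obtain ⟨ρ, hρ, htr⟩ := exists_norm_tripleConv_sub_trunc_le hp hA (suppIn_trunc A g) hM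
    (ε := ε / 4) (by positivity)
  have hlim := tendsto_tripleConv_of_suppIn hp (hA.trans hρ) ((suppIn_trunc A g).mono hρ)
    (fun n => suppIn_trunc ρ (a n)) (fun n => suppIn_trunc ρ (r n))
    (fun n => (norm_trunc_le _ _).trans (haM n)) (fun n => (norm_trunc_le _ _).trans (hrM n))
    (hw.trunc ρ)
  obtain ⟨N, hN⟩ := (Metric.tendsto_atTop.1 hlim) (ε / 4) (by positivity)
  refine ⟨N, fun n hn => ?_⟩
  have h1 := hN n hn
  rw [dist_zero_right, norm_norm] at h1 ⊢
  have h2 := htr (a n) (r n) (haM n) (hrM n)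
  have h3 : ‖tripleConv hp (g - trunc A g) (a n) (r n)‖ ≤ ε / 4 := by
    refine (norm_tripleConv_le_of_le hp hgA (haM n) (hrM n)).trans ?_
    rw [mul_left_comm, div_mul_eq_mul_div, div_le_iff₀ (by positivity)]
    gcongr
    linarith
  have h4 : tripleConv hp g (a n) (r n) = tripleConv hp (g - trunc A g) (a n) (r n) +
      ((tripleConv hp (trunc A g) (a n) (r n) -
        tripleConv hp (trunc A g) (trunc ρ (a n)) (trunc ρ (r n))) +
      tripleConv hp (trunc A g) (trunc ρ (a n)) (trunc ρ (r n))) := by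
    rw [tripleConv_sub]; abel
  rw [h4]
  calc _ ≤ _ := norm_add_le _ _
    _ ≤ _ := add_le_add le_rfl (norm_add_le _ _)
    _ < _ := by linarith

/-! ### Compactness of extremizing sequences -/

lemma tripleConv_add_snd {p : ℝ} (hp : 1 < p) (f g g' h : L2 ℝ) :
    tripleConv hp f (g + g') h = tripleConv hp f g h + tripleConv hp f g' h := by
  simp [tripleConv]

lemma tripleConv_add_trd {p : ℝ} (hp : 1 < p) (f g h h' : L2 ℝ) :
    tripleConv hp f g (h + h') = tripleConv hp f g h + tripleConv hp f g h' := by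
  simp [tripleConv]

lemma tripleConv_add_self {p : ℝ} (hp : 1 < p) (g r : L2 ℝ) :
    tripleConv hp (g + r) (g + r) (g + r) = (tripleConv hp g g g + tripleConv hp r r r) +
      ((3 : ℂ) • tripleConv hp g g r + (3 : ℂ) • tripleConv hp g r r) := by
  have h1 : tripleConv hp g r g = tripleConv hp g g r := tripleConv_swapSnd hp g r g
  have h2 : tripleConv hp r g g = tripleConv hp g g r := by rw [tripleConv_swapFst, h1]
  have h3 : tripleConv hp r g r = tripleConv hp g r r := tripleConv_swapFst hp r g r
  have h4 : tripleConv hp r r g = tripleConv hp g r r := by rw [tripleConv_swapSnd, h3]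
  simp only [tripleConv_add, tripleConv_add_snd, tripleConv_add_trd, h1, h2, h3, h4]
  module

/-- Strict superadditivity: a normalized extremizing sequence with a nonzero weak limit converges
strongly. -/
lemma tendsto_of_weakTendsto {p : ℝ} (hp : 1 < p) (hD : 0 < sharpConst p) {g : ℕ → L2 ℝ}
    {g' : L2 ℝ} (hg1 : ∀ n, ‖g n‖ = 1)
    (hT : Tendsto (fun n => ‖tripleConv hp (g n) (g n) (g n)‖) atTop (𝓝 (sharpConst p)))
    (hw : WeakTendsto g g') (hg' : g' ≠ 0) : Tendsto g atTop (𝓝 g') := by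
  set r : ℕ → L2 ℝ := fun n => g n - g' with hr
  set s := ‖g'‖ ^ 2 with hs
  have hs0 : 0 < s := by have := norm_pos_iff.2 hg'; positivity
  have hrw : WeakTendsto r 0 := hw.sub_const
  have hrM : ∀ n, ‖r n‖ ≤ 1 + ‖g'‖ := fun n => (norm_sub_le _ _).trans (by rw [hg1])
  have hrn : Tendsto (fun n => ‖r n‖ ^ 2) atTop (𝓝 (1 - s)) := by
    have h1 : ∀ n, ‖r n‖ ^ 2 = 1 - 2 * RCLike.re (inner ℂ g' (g n)) + s := fun n => by
      rw [hr, norm_sub_sq (𝕜 := ℂ), hg1, ← inner_conj_symm, RCLike.conj_re]; ring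
    simp_rw [h1]
    have h2 := (RCLike.continuous_re.tendsto _).comp (hw g')
    have h3 := ((h2.const_mul 2).const_sub 1).add_const s
    have h4 : RCLike.re (inner ℂ g' g') = s := by
      rw [inner_self_eq_norm_sq (𝕜 := ℂ)]
    rw [h4] at h3
    rw [show 1 - 2 * s + s = 1 - s by ring] at h3
    exact h3
  set X : ℕ → L2 (ℝ × ℝ) := fun n => tripleConv hp (r n) (r n) (r n) with hX
  set Z := tripleConv hp g' g' g' with hZ
  set e : ℕ → L2 (ℝ × ℝ) := fun n =>
    (3 : ℂ) • tripleConv hp g' g' (r n) + (3 : ℂ) • tripleConv hp g' (r n) (r n) with he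
  have he0 : Tendsto (fun n => ‖e n‖) atTop (𝓝 0) := by
    have h1 := tendsto_tripleConv_of_weak hp g' (a := fun _ => g') (r := r) (M := 1 + ‖g'‖)
      (fun _ => by linarith) hrM hrw
    have h2 := tendsto_tripleConv_of_weak hp g' (a := r) (r := r) hrM hrM hrw
    have h3 := (h1.const_mul 3).add (h2.const_mul 3)
    simp only [mul_zero, add_zero] at h3
    refine squeeze_zero (fun _ => norm_nonneg _) (fun n => (norm_add_le _ _).trans ?_) h3
    rw [norm_smul, norm_smul]
    simp
  have hexp : ∀ n, tripleConv hp (g n) (g n) (g n) = (Z + X n) + e n := fun n => by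
    have : g n = g' + r n := by simp only [hr]; abel
    rw [this, tripleConv_add_self]
  -- the square of the norm of the main part
  have hle : ∀ n, ‖Z + X n‖ ^ 2 ≤ sharpConst p ^ 2 * s ^ 3 + 2 * RCLike.re (inner ℂ Z (X n)) +
      sharpConst p ^ 2 * (‖r n‖ ^ 2) ^ 3 := fun n => by
    rw [norm_add_sq (𝕜 := ℂ)]
    have h1 : ‖Z‖ ^ 2 ≤ (sharpConst p * ‖g'‖ ^ 3) ^ 2 := by
      gcongr; exact norm_tripleConv_self_le hp g'
    have h2 : ‖X n‖ ^ 2 ≤ (sharpConst p * ‖r n‖ ^ 3) ^ 2 := by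
      gcongr; exact norm_tripleConv_self_le hp (r n)
    have h3 : (sharpConst p * ‖g'‖ ^ 3) ^ 2 = sharpConst p ^ 2 * s ^ 3 := by rw [hs]; ring
    have h4 : (sharpConst p * ‖r n‖ ^ 3) ^ 2 = sharpConst p ^ 2 * (‖r n‖ ^ 2) ^ 3 := by ring
    linarith
  have hcross : Tendsto (fun n => RCLike.re (inner ℂ Z (X n))) atTop (𝓝 0) := by
    have h1 := (RCLike.continuous_re.tendsto _).comp (tendsto_inner_tripleConv hp hrM hrw Z)
    simpa [Function.comp_def] using h1
  have hmain : Tendsto (fun n => ‖Z + X n‖) atTop (𝓝 (sharpConst p)) := by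
    have h1 : ∀ n, |‖Z + X n‖ - ‖tripleConv hp (g n) (g n) (g n)‖| ≤ ‖e n‖ := fun n => by
      rw [hexp]
      refine (abs_norm_sub_norm_le _ _).trans (le_of_eq ?_)
      rw [← norm_neg]; congr 1; abel
    have h2 : Tendsto (fun n => ‖Z + X n‖ - ‖tripleConv hp (g n) (g n) (g n)‖) atTop (𝓝 0) :=
      squeeze_zero_norm h1 he0
    simpa using h2.add hT
  have hlim := le_of_tendsto_of_tendsto' (hmain.pow 2)
    (((hcross.const_mul 2).const_add (sharpConst p ^ 2 * s ^ 3)).add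
      ((hrn.pow 3).const_mul (sharpConst p ^ 2))) hle
  have hs1 : s ≤ 1 := by
    have := ge_of_tendsto' hrn fun n => (by positivity : 0 ≤ ‖r n‖ ^ 2)
    linarith
  -- in the limit `1 ≤ s³ + (1 - s)³`, which forces `s = 1` as `0 < s ≤ 1`
  have hs2 : s = 1 := by
    have hD2 : 0 < sharpConst p ^ 2 := by positivity
    have h1 : 1 ≤ s ^ 3 + (1 - s) ^ 3 := by
      by_contra! h
      nlinarith
    have h2 : s * (1 - s) ≤ 0 := by nlinarith
    nlinarith
  rw [hs2, sub_self] at hrn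
  have h5 := (Real.continuous_sqrt.tendsto 0).comp hrn
  rw [Real.sqrt_zero] at h5
  rw [tendsto_iff_norm_sub_tendsto_zero]
  refine h5.congr fun n => ?_
  rw [Function.comp_apply, Real.sqrt_sq (norm_nonneg _)]

lemma annMass_dilate {R : ℝ} {t : ℝ} (ht : 0 < t) (f : L2 ℝ) :
    annMass R (dilate ht.ne' f) 1 = annMass R f t := by
  have hfm := measurable_enorm_L2 f
  unfold annMass
  rw [← lintegral_indicator (measurableSet_annulus R 1),
    ← lintegral_indicator (measurableSet_annulus R t), lintegral_comp_mul ht.ne'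
      (Measurable.indicator (by fun_prop) (measurableSet_annulus R t)),
    ← lintegral_const_mul' _ _ ENNReal.ofReal_ne_top]
  refine lintegral_congr_ae ?_
  filter_upwards [coeFn_dilate ht.ne' f] with v hv
  have hmem : v ∈ annulus R 1 ↔ t * v ∈ annulus R t := by
    have h1 : t ≤ R * |t * v| ↔ 1 ≤ R * |v| := by
      rw [abs_mul, abs_of_pos ht, show R * (t * |v|) = t * (R * |v|) by ring]
      exact le_mul_iff_one_le_right ht
    have h2 : |t * v| ≤ R * t ↔ |v| ≤ R * 1 := by
      rw [abs_mul, abs_of_pos ht, mul_comm R t, mul_one]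
      exact mul_le_mul_iff_right₀ ht
    exact and_congr h1.symm h2.symm
  by_cases h : v ∈ annulus R 1
  · rw [Set.indicator_of_mem h, Set.indicator_of_mem (hmem.1 h), hv, enorm_mul]
    have h1 : ‖((√|t| : ℝ) : ℂ)‖ₑ = ENNReal.ofReal √t := by
      rw [← ofReal_norm, Complex.norm_real, Real.norm_of_nonneg (by positivity), abs_of_pos ht]
    have h2 : √t = t * t ^ (-(1 / 2) : ℝ) := by
      rw [Real.sqrt_eq_rpow, ← Real.rpow_one_add' ht.le (by norm_num)]; norm_num
    rw [h1, h2, abs_mul, abs_of_pos ht, Real.mul_rpow ht.le (abs_nonneg _),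
      ENNReal.ofReal_mul ht.le, ENNReal.ofReal_mul (by positivity)]
    ring
  · rw [Set.indicator_of_notMem h, Set.indicator_of_notMem (fun h' => h (hmem.2 h')), mul_zero]

/-- The function `|v|^(-1/2)` on the annulus `1 / R ≤ |v| ≤ R`, whose inner product with a
nonnegative function is its annular average. -/
def annTestFun (R : ℝ) : ℝ → ℂ :=
  (annulus R 1).indicator fun v => ((|v| ^ (-(1 / 2) : ℝ) : ℝ) : ℂ)

lemma memLp_annTestFun {R : ℝ} (hR : 1 ≤ R) : MemLp (annTestFun R) 2 volume := by
  have hsub : annulus R 1 ⊆ Set.Icc (-R) R := fun v hv => by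
    have := hv.2
    rw [mul_one] at this
    exact abs_le.1 this
  have hfin : IsFiniteMeasure (volume.restrict (annulus R 1)) := by
    refine ⟨?_⟩
    rw [Measure.restrict_apply_univ]
    exact (measure_mono hsub).trans_lt (by simp)
  refine (memLp_indicator_iff_restrict (measurableSet_annulus R 1)).2 (MemLp.of_bound
    (Complex.measurable_ofReal.comp (by fun_prop)).aestronglyMeasurable (R ^ (1 / 2 : ℝ)) ?_)
  rw [ae_restrict_iff' (measurableSet_annulus R 1)]
  refine Eventually.of_forall fun v hv => ?_
  have hv1 : R⁻¹ ≤ |v| := by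
    rw [inv_le_iff_one_le_mul₀' (by linarith)]
    exact hv.1
  have hR0 : 0 < R⁻¹ := by positivity
  rw [Complex.norm_real, Real.norm_of_nonneg (by positivity)]
  calc |v| ^ (-(1 / 2) : ℝ) ≤ R⁻¹ ^ (-(1 / 2) : ℝ) :=
        Real.rpow_le_rpow_of_nonpos hR0 hv1 (by norm_num)
    _ = _ := by rw [Real.inv_rpow (by linarith), Real.rpow_neg (by linarith), inv_inv]

lemma enorm_inner_annTestFun {R : ℝ} (hR : 1 ≤ R) {f : L2 ℝ}
    (hf : ∀ᵐ y, 0 ≤ (f y).re ∧ (f y).im = 0) :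
    ‖inner ℂ ((memLp_annTestFun hR).toLp _) f‖ₑ = annMass R f 1 := by
  set θ := (memLp_annTestFun hR).toLp _ with hθ
  have e1 : (fun y => inner ℂ (θ y) (f y)) =ᵐ[volume] fun y =>
      ((((annulus R 1).indicator (fun v => ‖f v‖ * |v| ^ (-(1 / 2) : ℝ)) y : ℝ)) : ℂ) := by
    filter_upwards [hf, (memLp_annTestFun hR).coeFn_toLp] with y h1 h2
    rw [hθ, h2, RCLike.inner_apply, annTestFun]
    have h3 : f y = ((‖f y‖ : ℝ) : ℂ) := by
      have h4 : f y = (((f y).re : ℝ) : ℂ) := Complex.ext (by simp) (by simp [h1.2])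
      rw [h4, Complex.norm_real, Real.norm_of_nonneg h1.1]
    by_cases hy : y ∈ annulus R 1
    · rw [Set.indicator_of_mem hy, Set.indicator_of_mem hy, Complex.conj_ofReal,
        Complex.ofReal_mul, ← h3]
    · rw [Set.indicator_of_notMem hy, Set.indicator_of_notMem hy]; simp
  have hint := (L2.integrable_inner (𝕜 := ℂ) θ f).congr e1
  have hint' : Integrable fun y =>
      (annulus R 1).indicator (fun v => ‖f v‖ * |v| ^ (-(1 / 2) : ℝ)) y := by
    simpa using hint.re
  have hnn : ∀ y, 0 ≤ (annulus R 1).indicator (fun v => ‖f v‖ * |v| ^ (-(1 / 2) : ℝ)) y :=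
    fun y => Set.indicator_nonneg (fun v _ => by positivity) y
  rw [L2.inner_def, integral_congr_ae e1, integral_complex_ofReal, ← ofReal_norm,
    Complex.norm_real, Real.norm_of_nonneg (integral_nonneg hnn),
    ofReal_integral_eq_lintegral_ofReal hint' (Eventually.of_forall hnn), annMass,
    ← lintegral_indicator (measurableSet_annulus R 1)]
  refine lintegral_congr fun y => ?_
  by_cases hy : y ∈ annulus R 1
  · rw [Set.indicator_of_mem hy, Set.indicator_of_mem hy, ENNReal.ofReal_mul (norm_nonneg _),
      ofReal_norm]
  · rw [Set.indicator_of_notMem hy, Set.indicator_of_notMem hy, ENNReal.ofReal_zero]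

/-- The normalization of `f`, rescaled by `a`. -/
def normDilate {a : ℝ} (ha : a ≠ 0) (f : L2 ℝ) : L2 ℝ := dilate ha (((‖f‖⁻¹ : ℝ) : ℂ) • f)

lemma coeFn_normDilate {a : ℝ} (ha : a ≠ 0) (f : L2 ℝ) :
    normDilate ha f =ᵐ[volume] fun y => ((√|a| / ‖f‖ : ℝ) : ℂ) * f (a * y) := by
  filter_upwards [coeFn_dilate ha (((‖f‖⁻¹ : ℝ) : ℂ) • f), (quasiMeasurePreserving_mul ha).ae
    (Lp.coeFn_smul ((‖f‖⁻¹ : ℝ) : ℂ) f)] with y h1 h2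
  rw [normDilate, h1, h2, Pi.smul_apply, smul_eq_mul, ← mul_assoc, ← Complex.ofReal_mul,
    div_eq_mul_inv]

lemma norm_normDilate {a : ℝ} (ha : a ≠ 0) {f : L2 ℝ} (hf : f ≠ 0) : ‖normDilate ha f‖ = 1 := by
  rw [normDilate, norm_dilate, norm_smul, Complex.norm_real, norm_inv, norm_norm]
  exact inv_mul_cancel₀ (norm_ne_zero_iff.2 hf)

lemma norm_tripleConv_normDilate {p : ℝ} (hp : 1 < p) {a : ℝ} (ha : a ≠ 0) (f : L2 ℝ) :
    ‖tripleConv hp (normDilate ha f) (normDilate ha f) (normDilate ha f)‖ =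
      ‖tripleConv hp f f f‖ / ‖f‖ ^ 3 := by
  rw [normDilate, norm_tripleConv_dilate, tripleConv_smul, norm_smul, norm_pow, Complex.norm_real,
    norm_inv, norm_norm, inv_pow, div_eq_inv_mul]

lemma sharpConst_pos_of_concConst_lt {p : ℝ} (hp : 1 < p) (hD : concConst p < sharpConst p ^ 2) :
    0 < sharpConst p := by
  refine (sharpConst_nonneg p).lt_of_ne fun h => ?_
  rw [← h] at hD
  have := concConst_pos hp
  norm_num at hD
  linarith

/-- Above the critical constant, extremizing sequences are compact up to scaling. The scale is the
one at which an annular average is bounded below. -/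
lemma exists_scaling_subseq_tendsto {p : ℝ} (hp : 1 < p) (hD : concConst p < sharpConst p ^ 2)
    {f : ℕ → L2 ℝ} (hf : IsExtremizingSeq p f) (hf0 : IsNonnegSeq f) :
    ∃ (a : ℕ → ℝ) (ha : ∀ n, 0 < a n), ∀ φ : ℕ → ℕ, StrictMono φ → ∃ ψ : ℕ → ℕ, StrictMono ψ ∧
      ∃ g : L2 ℝ, Tendsto (fun n => normDilate (ha (φ (ψ n))).ne' (f (φ (ψ n)))) atTop (𝓝 g) := by
  obtain ⟨hne, hlim⟩ := (isExtremizingSeq_iff hp f).1 hf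
  have hD0 := sharpConst_pos_of_concConst_lt hp hD
  have hsq : √(concConst p) < sharpConst p := (Real.sqrt_lt' hD0).2 hD
  obtain ⟨B, hB1, hB2⟩ := exists_between hsq
  obtain ⟨R, hR, c, hc, hann⟩ := exists_annMass_gt hp hB1
  have hscale : ∀ n, ∃ a : ℝ, 0 < a ∧ (B ≤ ‖tripleConv hp (f n) (f n) (f n)‖ / ‖f n‖ ^ 3 →
      ENNReal.ofReal c < annMass R (((‖f n‖⁻¹ : ℝ) : ℂ) • f n) a) := fun n => by
    by_cases h : B ≤ ‖tripleConv hp (f n) (f n) (f n)‖ / ‖f n‖ ^ 3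
    · obtain ⟨t, ht, h1⟩ := hann (((‖f n‖⁻¹ : ℝ) : ℂ) • f n) (by
        rw [norm_smul, Complex.norm_real, norm_inv, norm_norm]
        exact inv_mul_cancel₀ (norm_ne_zero_iff.2 (hne n))) (by
        rwa [tripleConv_smul, norm_smul, norm_pow, Complex.norm_real, norm_inv, norm_norm, inv_pow,
          ← div_eq_inv_mul])
      exact ⟨t, ht, fun _ => h1⟩
    · exact ⟨1, one_pos, fun h' => absurd h' h⟩
  choose a ha hac using hscale
  refine ⟨a, ha, fun φ hφ => ?_⟩
  set g : ℕ → L2 ℝ := fun n => normDilate (ha n).ne' (f n) with hg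
  have hg1 : ∀ n, ‖g n‖ = 1 := fun n => norm_normDilate _ (hne n)
  have hgT : Tendsto (fun n => ‖tripleConv hp (g n) (g n) (g n)‖) atTop (𝓝 (sharpConst p)) := by
    refine hlim.congr fun n => ?_
    rw [hg, norm_tripleConv_normDilate]
  have : Fact ((2 : ℝ≥0∞) ≠ ∞) := ⟨by simp⟩
  have : SecondCountableTopology (L2 ℝ) := Lp.SecondCountableTopology
  obtain ⟨g', ψ, hψ, hw⟩ := exists_weakTendsto_subseq (u := fun n => g (φ n)) (M := 1)
    (fun n => (hg1 _).le)
  have hφψ : Tendsto (fun n => φ (ψ n)) atTop atTop := hφ.tendsto_atTop.comp hψ.tendsto_atTop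
  refine ⟨ψ, hψ, g', tendsto_of_weakTendsto hp hD0 (fun n => hg1 _) (hgT.comp hφψ) hw ?_⟩
  rintro rfl
  -- the averages over the annulus prevent the weak limit from vanishing
  have h1 := (continuous_enorm.tendsto _).comp (hw ((memLp_annTestFun hR).toLp _))
  rw [inner_zero_right, enorm_zero] at h1
  have h2 : ∀ᶠ n in atTop, ENNReal.ofReal c ≤
      ‖inner ℂ ((memLp_annTestFun hR).toLp _) (g (φ (ψ n)))‖ₑ := by
    filter_upwards [hφψ.eventually (hlim.eventually (lt_mem_nhds hB2))] with n hn
    rw [enorm_inner_annTestFun hR]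
    · exact (hac _ hn.le).le.trans (le_of_eq (annMass_dilate (ha _) _).symm)
    · filter_upwards [coeFn_normDilate (ha (φ (ψ n))).ne' (f (φ (ψ n))),
        (quasiMeasurePreserving_mul (ha (φ (ψ n))).ne').ae (hf0 (φ (ψ n)))] with y h3 h4
      rw [hg, h3, Complex.re_ofReal_mul, Complex.im_ofReal_mul, h4.2]
      exact ⟨mul_nonneg (by positivity) h4.1, mul_zero _⟩
  have h3 := ge_of_tendsto h1 h2
  rw [nonpos_iff_eq_zero, ENNReal.ofReal_eq_zero] at h3
  linarith

/-- If the subsequences of `g` have convergent subsequences, then the range of `g` is relatively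
compact. -/
lemma isCompact_closure_range_of_subseq {X : Type*} [PseudoMetricSpace X] {g : ℕ → X}
    (h : ∀ φ : ℕ → ℕ, StrictMono φ → ∃ ψ : ℕ → ℕ, StrictMono ψ ∧
      ∃ a, Tendsto (fun n => g (φ (ψ n))) atTop (𝓝 a)) : IsCompact (closure (Set.range g)) := by
  refine IsSeqCompact.isCompact fun x hx => ?_
  have h1 : ∀ k : ℕ, ∃ n, dist (x k) (g n) < 1 / ((k : ℝ) + 1) := fun k => by
    obtain ⟨_, ⟨n, rfl⟩, hn⟩ := Metric.mem_closure_iff.1 (hx k) (1 / ((k : ℝ) + 1)) (by positivity)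
    exact ⟨n, hn⟩
  choose n hn using h1
  -- it suffices to find a convergent subsequence of the approximating sequence
  suffices hs : ∃ χ : ℕ → ℕ, StrictMono χ ∧ ∃ a, Tendsto (fun k => g (n (χ k))) atTop (𝓝 a) by
    obtain ⟨χ, hχ, a, hlim⟩ := hs
    refine ⟨a, mem_closure_of_tendsto hlim (Eventually.of_forall fun k => ⟨_, rfl⟩), χ, hχ, ?_⟩
    refine (tendsto_iff_of_dist ?_).2 hlim
    exact squeeze_zero (fun _ => dist_nonneg) (fun k => (hn (χ k)).le)
      ((tendsto_one_div_add_atTop_nhds_zero_nat (𝕜 := ℝ)).comp hχ.tendsto_atTop)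
  -- the indices `n k` tend to infinity, or some index recurs infinitely often
  by_cases htop : Tendsto n atTop atTop
  · obtain ⟨φ, hφ, hnφ⟩ := strictMono_subseq_of_tendsto_atTop htop
    obtain ⟨ψ, hψ, a, ha⟩ := h (n ∘ φ) hnφ
    exact ⟨φ ∘ ψ, hφ.comp hψ, a, ha⟩
  · rw [tendsto_atTop] at htop
    push Not at htop
    obtain ⟨m, hm⟩ := htop
    have hfin : (g '' Set.Iio m).Finite := (Set.finite_Iio m).image g
    obtain ⟨a, -, χ, hχ, hlim⟩ := hfin.isCompact.isSeqCompact.subseq_of_frequently_in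
      (x := fun k => g (n k)) (hm.mono fun k hk => ⟨n k, by simpa using hk, rfl⟩)
    exact ⟨χ, hχ, a, hlim⟩

lemma isPrecompactModScaling_of_extremizing {p : ℝ} (hp : 1 < p)
    (hD : concConst p < sharpConst p ^ 2) {f : ℕ → L2 ℝ} (hf : IsExtremizingSeq p f)
    (hf0 : IsNonnegSeq f) : IsPrecompactModScaling f := by
  obtain ⟨a, ha, h⟩ := exists_scaling_subseq_tendsto hp hD hf hf0
  refine ⟨a, fun n => normDilate (ha n).ne' (f n), ha, fun n => ?_,
    isCompact_closure_range_of_subseq h⟩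
  filter_upwards [coeFn_normDilate (ha n).ne' (f n)] with y hy
  rw [hy, abs_of_pos (ha n)]

/-- A limit of a normalized extremizing sequence is an extremizer. -/
lemma exists_isExtremizer {p : ℝ} (hp : 1 < p) (hD : concConst p < sharpConst p ^ 2) :
    ∃ f : L2 ℝ, IsExtremizer p f := by
  have hD0 := sharpConst_pos_of_concConst_lt hp hD
  obtain ⟨f, hf, hf0⟩ := exists_extremizingSeq hp hD0
  obtain ⟨a, ha, h⟩ := exists_scaling_subseq_tendsto hp hD hf hf0
  obtain ⟨ψ, hψ, g, hg⟩ := h id strictMono_id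
  obtain ⟨hne, hlim⟩ := (isExtremizingSeq_iff hp f).1 hf
  have hg1 : ‖g‖ = 1 := tendsto_nhds_unique hg.norm
    (tendsto_const_nhds.congr fun n => (norm_normDilate _ (hne _)).symm)
  have hgT : ‖tripleConv hp g g g‖ = sharpConst p := by
    refine tendsto_nhds_unique (((continuous_tripleConv_self hp).norm.tendsto g).comp hg) ?_
    refine (hlim.comp hψ.tendsto_atTop).congr fun n => ?_
    simp only [Function.comp_apply, norm_tripleConv_normDilate, id]
  refine ⟨g, (isExtremizer_iff hp g).2 ⟨fun h0 => ?_, ?_⟩⟩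
  · rw [h0, norm_zero] at hg1; exact zero_ne_one hg1
  · rw [hg1, hgT]; ring

/-! ### Concentrating Gaussians -/

/-- The second-order coefficient `p (p - 1) / 2` of `|1 + s|^p` at `s = 0`. -/
def curvature (p : ℝ) : ℝ := p * (p - 1) / 2

lemma curvature_pos {p : ℝ} (hp : 1 < p) : 0 < curvature p := by
  have : 0 < p - 1 := by linarith
  unfold curvature; positivity

/-- A Gaussian of width `1 / k` at the point `1`, truncated and divided by the density of the
measure on the curve. The truncation keeps away from `0`, where the density may vanish. -/
def concFun (p k : ℝ) : ℝ → ℝ :=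
  (Set.Ioo (1 / 2 : ℝ) (3 / 2)).indicator fun y =>
    Real.exp (-(k * (y - 1)) ^ 2) * (|y| ^ ((p - 2) / 6))⁻¹

/-- The triple convolution of a Gaussian on the parabola `s = c y²`, up to a constant factor: the
product of the three Gaussians is constant on the fibres, which are circles of equal measure. -/
def parabolaFun (c : ℝ) : ℝ × ℝ → ℝ :=
  {u : ℝ × ℝ | c * u.1 ^ 2 / 3 ≤ u.2}.indicator fun u => Real.exp (-u.2 / c)

/-- The test function transported to the point `3 (1, 1)` by the affine symmetries of the
osculating parabola. -/
def concTest (p k : ℝ) (u : ℝ × ℝ) : ℝ :=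
  parabolaFun (curvature p) (k * (u.1 - 3), k ^ 2 * (u.2 - 3 - p * (u.1 - 3)))

lemma measurable_concFun (p k : ℝ) : Measurable (concFun p k) :=
  Measurable.indicator (by fun_prop) measurableSet_Ioo

lemma measurable_parabolaFun (c : ℝ) : Measurable (parabolaFun c) :=
  Measurable.indicator (by fun_prop)
    (measurableSet_le (f := fun u : ℝ × ℝ => c * u.1 ^ 2 / 3) (by fun_prop) measurable_snd)

lemma measurable_concTest (p k : ℝ) : Measurable (concTest p k) :=
  (measurable_parabolaFun _).comp (by fun_prop)

lemma concFun_nonneg (p k y : ℝ) : 0 ≤ concFun p k y :=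
  Set.indicator_nonneg (fun y _ => by positivity) y

lemma parabolaFun_nonneg (c : ℝ) (u : ℝ × ℝ) : 0 ≤ parabolaFun c u :=
  Set.indicator_nonneg (fun u _ => by positivity) u

lemma parabolaFun_le_one {c : ℝ} (hc : 0 < c) (u : ℝ × ℝ) : parabolaFun c u ≤ 1 := by
  refine Set.indicator_le' (s := {u : ℝ × ℝ | c * u.1 ^ 2 / 3 ≤ u.2}) (g := fun _ => 1)
    (fun u hu => ?_) (fun _ _ => zero_le_one) u
  have h1 : c * u.1 ^ 2 / 3 ≤ u.2 := hu
  have h2 : 0 ≤ c * u.1 ^ 2 / 3 := by positivity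
  rw [Real.exp_le_one_iff, neg_div]
  have : 0 ≤ u.2 / c := div_nonneg (h2.trans h1) hc.le
  linarith

lemma lintegral_gaussian {b : ℝ} (hb : 0 < b) :
    ∫⁻ t : ℝ, ENNReal.ofReal (Real.exp (-b * t ^ 2)) = ENNReal.ofReal √(Real.pi / b) := by
  rw [← integral_gaussian, ofReal_integral_eq_lintegral_ofReal (integrable_exp_neg_mul_sq hb)
    (Eventually.of_forall fun t => by positivity)]

lemma lintegral_parabolaFun_sq {c : ℝ} (hc : 0 < c) :
    ∫⁻ u, ENNReal.ofReal (parabolaFun c u) ^ 2 =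
      ENNReal.ofReal (c / 2 * √(Real.pi / (2 / 3))) := by
  have hm : Measurable fun u => ENNReal.ofReal (parabolaFun c u) ^ 2 :=
    (measurable_parabolaFun c).ennreal_ofReal.pow_const 2
  rw [Measure.volume_eq_prod, lintegral_prod _ hm.aemeasurable, ENNReal.ofReal_mul (by positivity),
    ← lintegral_gaussian (by norm_num), ← lintegral_const_mul' _ _ ENNReal.ofReal_ne_top]
  refine lintegral_congr fun ξ => ?_
  have ha : -2 / c < 0 := div_neg_of_neg_of_pos (by norm_num) hc
  have h1 : ∀ τ, ENNReal.ofReal (parabolaFun c (ξ, τ)) ^ 2 =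
      (Set.Ici (c * ξ ^ 2 / 3)).indicator (fun τ => ENNReal.ofReal (Real.exp (-2 / c * τ))) τ := by
    intro τ
    by_cases h : c * ξ ^ 2 / 3 ≤ τ
    · rw [parabolaFun, Set.indicator_of_mem (by exact h), Set.indicator_of_mem (by exact h),
        ← ENNReal.ofReal_pow (by positivity), ← Real.exp_nat_mul]
      congr 2; push_cast; ring
    · rw [parabolaFun, Set.indicator_of_notMem (by exact h), Set.indicator_of_notMem (by exact h)]
      simp
  simp_rw [h1]
  rw [lintegral_indicator measurableSet_Ici, setLIntegral_congr Ioi_ae_eq_Ici.symm,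
    ← ofReal_integral_eq_lintegral_ofReal (integrableOn_exp_mul_Ioi ha _)
      (Eventually.of_forall fun t => by positivity), integral_exp_mul_Ioi ha,
    ← ENNReal.ofReal_mul (by positivity)]
  congr 1
  rw [show -2 / c * (c * ξ ^ 2 / 3) = -(2 / 3) * ξ ^ 2 by field_simp]
  field_simp

/-! ### Scaling of the integrals -/

lemma lintegral_affine {k : ℝ} (hk : 0 < k) (b : ℝ) {f : ℝ → ℝ≥0∞} (hf : Measurable f) :
    ∫⁻ y, f y = ENNReal.ofReal k⁻¹ * ∫⁻ t, f (b + k⁻¹ * t) := by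
  have hk' : 0 < k⁻¹ := by positivity
  have hm : Measurable fun s => f (b + s) := hf.comp (by fun_prop)
  rw [← lintegral_add_left_eq_self f b, lintegral_comp_mul hk'.ne' hm, abs_of_pos hk']

lemma lintegral_triple_affine {k : ℝ} (hk : 0 < k) (b : ℝ) {G : ℝ × ℝ × ℝ → ℝ≥0∞}
    (hG : Measurable G) :
    ∫⁻ y, G y = ENNReal.ofReal (k⁻¹ ^ 3) *
      ∫⁻ t : ℝ × ℝ × ℝ, G (b + k⁻¹ * t.1, b + k⁻¹ * t.2.1, b + k⁻¹ * t.2.2) := by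
  have hk' : 0 ≤ k⁻¹ := by positivity
  have hG' : Measurable fun t : ℝ × ℝ × ℝ =>
    G (b + k⁻¹ * t.1, b + k⁻¹ * t.2.1, b + k⁻¹ * t.2.2) := hG.comp (by fun_prop)
  have hm1 : Measurable fun y1 => ∫⁻ y2, ∫⁻ y3, G (y1, y2, y3) := by
    have h1 : Measurable fun q : (ℝ × ℝ) × ℝ => G (q.1.1, q.1.2, q.2) := hG.comp (by fun_prop)
    exact h1.lintegral_prod_right'.lintegral_prod_right'
  have hm2 : ∀ y1, Measurable fun y2 => ∫⁻ y3, G (y1, y2, y3) := fun y1 => by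
    have h1 : Measurable fun q : ℝ × ℝ => G (y1, q.1, q.2) := hG.comp (by fun_prop)
    exact h1.lintegral_prod_right'
  have hm3 : ∀ y1 y2, Measurable fun y3 => G (y1, y2, y3) := fun y1 y2 => hG.comp (by fun_prop)
  have hk3 : ENNReal.ofReal (k⁻¹ ^ 3) =
      ENNReal.ofReal k⁻¹ * (ENNReal.ofReal k⁻¹ * ENNReal.ofReal k⁻¹) := by
    rw [← ENNReal.ofReal_mul hk', ← ENNReal.ofReal_mul hk']; congr 1; ring
  rw [lintegral_triple hG, lintegral_triple hG', lintegral_affine hk b hm1, hk3, mul_assoc,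
    ← lintegral_const_mul' (ENNReal.ofReal k⁻¹ * ENNReal.ofReal k⁻¹) _
      (ENNReal.mul_ne_top ENNReal.ofReal_ne_top ENNReal.ofReal_ne_top)]
  congr 1
  refine lintegral_congr fun t1 => ?_
  rw [lintegral_affine hk b (hm2 _), mul_assoc]
  congr 1
  rw [← lintegral_const_mul' _ _ ENNReal.ofReal_ne_top]
  exact lintegral_congr fun t2 => lintegral_affine hk b (hm3 _ _)

lemma lintegral_concTest_sq {p : ℝ} (hp : 1 < p) {k : ℝ} (hk : 0 < k) :
    ∫⁻ u, ENNReal.ofReal (concTest p k u) ^ 2 =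
      ENNReal.ofReal (k⁻¹ ^ 3 * (curvature p / 2 * √(Real.pi / (2 / 3)))) := by
  have hc := curvature_pos hp
  have hk2 : 0 < k ^ 2 := by positivity
  set G : ℝ × ℝ → ℝ≥0∞ := fun u => ENNReal.ofReal (parabolaFun (curvature p) u) ^ 2 with hG
  have hm : Measurable G := (measurable_parabolaFun _).ennreal_ofReal.pow_const 2
  have h0 : ∀ u, ENNReal.ofReal (concTest p k u) ^ 2 =
      G (k * (u.1 - 3), k ^ 2 * (u.2 - 3 - p * (u.1 - 3))) := fun u => rfl
  have hint : ∫⁻ u, G u = ENNReal.ofReal (curvature p / 2 * √(Real.pi / (2 / 3))) :=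
    lintegral_parabolaFun_sq hc
  simp_rw [h0]
  clear_value G
  have hm0 : Measurable fun u : ℝ × ℝ => G (k * (u.1 - 3), k ^ 2 * (u.2 - 3 - p * (u.1 - 3))) :=
    hm.comp (by fun_prop)
  rw [ENNReal.ofReal_mul (by positivity), ← hint, Measure.volume_eq_prod,
    lintegral_prod _ hm0.aemeasurable, lintegral_prod _ hm.aemeasurable]
  have h1 : ∀ ξ, ∫⁻ τ, G (k * (ξ - 3), k ^ 2 * (τ - 3 - p * (ξ - 3))) =
      ENNReal.ofReal (k ^ 2)⁻¹ * ∫⁻ τ, G (k * (ξ - 3), τ) := fun ξ => by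
    have hm1 : Measurable fun τ => G (k * (ξ - 3), k ^ 2 * (τ - 3 - p * (ξ - 3))) :=
      hm0.comp measurable_prodMk_left
    rw [lintegral_affine hk2 (3 + p * (ξ - 3)) hm1]
    congr 1
    refine lintegral_congr fun τ => ?_
    congr 2
    field_simp
    ring
  simp_rw [h1]
  rw [lintegral_const_mul' _ _ ENNReal.ofReal_ne_top, lintegral_affine hk 3
    (f := fun ξ => ∫⁻ τ, G (k * (ξ - 3), τ)) ?_, ← mul_assoc, ← ENNReal.ofReal_mul (by positivity)]
  · congr 1
    · congr 1; field_simp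
    · refine lintegral_congr fun ξ => ?_
      have : k * (3 + k⁻¹ * ξ - 3) = ξ := by field_simp; ring
      rw [this]
  · have h2 : Measurable fun q : ℝ × ℝ => G (k * (q.1 - 3), q.2) := hm.comp (by fun_prop)
    exact h2.lintegral_prod_right'

/-- The density of the mass of `concFun p k` in the rescaled variable. -/
def massDensity (p k t : ℝ) : ℝ :=
  (Set.Ioo (-(k / 2)) (k / 2)).indicator (fun t => Real.exp (-2 * t ^ 2) *
    |1 + k⁻¹ * t| ^ (-((p - 2) / 3))) t

lemma mem_Ioo_affine {k : ℝ} (hk : 0 < k) (t : ℝ) :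
    1 + k⁻¹ * t ∈ Set.Ioo (1 / 2 : ℝ) (3 / 2) ↔ t ∈ Set.Ioo (-(k / 2)) (k / 2) := by
  have h1 : k⁻¹ * t = t / k := by field_simp
  rw [h1, Set.mem_Ioo, Set.mem_Ioo]
  have h2 : 1 / 2 < 1 + t / k ↔ -(k / 2) < t := by
    rw [← sub_lt_iff_lt_add', lt_div_iff₀ hk]; constructor <;> intro h <;> linarith
  have h3 : 1 + t / k < 3 / 2 ↔ t < k / 2 := by
    rw [← lt_sub_iff_add_lt', div_lt_iff₀ hk]; constructor <;> intro h <;> linarith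
  rw [h2, h3]

lemma concFun_sq {p k : ℝ} (hk : 0 < k) (t : ℝ) :
    concFun p k (1 + k⁻¹ * t) ^ 2 = massDensity p k t := by
  have hmem := mem_Ioo_affine hk t
  by_cases h : t ∈ Set.Ioo (-(k / 2)) (k / 2)
  · rw [concFun, massDensity, Set.indicator_of_mem (hmem.2 h), Set.indicator_of_mem h, mul_pow,
      ← Real.exp_nat_mul, inv_pow, ← Real.rpow_natCast (_ ^ _), ← Real.rpow_mul (abs_nonneg _),
      ← Real.rpow_neg (abs_nonneg _)]
    congr 2
    · have : k * (1 + k⁻¹ * t - 1) = t := by field_simp; ring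
      rw [this]; push_cast; ring
    · push_cast; ring
  · rw [concFun, massDensity, Set.indicator_of_notMem (fun h' => h (hmem.1 h')),
      Set.indicator_of_notMem h]; norm_num

lemma tendsto_massDensity (p t : ℝ) {k : ℕ → ℝ} (hk : Tendsto k atTop atTop) :
    Tendsto (fun n => massDensity p (k n) t) atTop (𝓝 (Real.exp (-2 * t ^ 2))) := by
  have h1 : Tendsto (fun n => |1 + (k n)⁻¹ * t|) atTop (𝓝 1) := by
    have h2 : Tendsto (fun n => 1 + (k n)⁻¹ * t) atTop (𝓝 1) := by
      simpa using (hk.inv_tendsto_atTop.mul_const t).const_add 1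
    simpa using h2.abs
  have h3 : Tendsto (fun n => Real.exp (-2 * t ^ 2) * |1 + (k n)⁻¹ * t| ^ (-((p - 2) / 3))) atTop
      (𝓝 (Real.exp (-2 * t ^ 2))) := by
    have h4 := (h1.rpow_const (p := -((p - 2) / 3)) (Or.inl one_ne_zero)).const_mul
      (Real.exp (-2 * t ^ 2))
    simpa using h4
  refine h3.congr' ?_
  filter_upwards [hk.eventually_gt_atTop (2 * |t|)] with n hn
  rw [massDensity, Set.indicator_of_mem]
  have := abs_lt.1 (show |t| < k n / 2 by linarith)
  exact this

lemma measurable_massDensity (p k : ℝ) : Measurable (massDensity p k) :=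
  Measurable.indicator (by fun_prop) measurableSet_Ioo

lemma massDensity_le (p : ℝ) {k : ℝ} (hk : 0 < k) (t : ℝ) :
    massDensity p k t ≤ Real.exp (-2 * t ^ 2) * ((1 / 3 : ℝ) ^ (-|-((p - 2) / 3)|) *
      (3 / 2) ^ (-((p - 2) / 3))) := by
  refine Set.indicator_le' (s := Set.Ioo (-(k / 2)) (k / 2)) (g := fun t =>
    Real.exp (-2 * t ^ 2) * ((1 / 3 : ℝ) ^ (-|-((p - 2) / 3)|) * (3 / 2) ^ (-((p - 2) / 3))))
    (fun t ht => ?_) (fun _ _ => by positivity) t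
  have h1 : |k⁻¹ * t| < 1 / 2 := by
    rw [abs_mul, abs_of_pos (by positivity : 0 < k⁻¹), inv_mul_lt_iff₀ hk]
    have := abs_lt.2 ht
    linarith
  rw [abs_lt] at h1
  gcongr
  refine rpow_le_of_mem_Icc _ (by norm_num) (by norm_num) ?_ ?_
  · rw [abs_of_pos (by linarith)]; linarith
  · rw [abs_of_pos (by linarith)]; linarith

lemma tendsto_mass (p : ℝ) {k : ℕ → ℝ} (hk0 : ∀ n, 0 < k n) (hk : Tendsto k atTop atTop) :
    Tendsto (fun n => ∫⁻ t, ENNReal.ofReal (massDensity p (k n) t)) atTop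
      (𝓝 (ENNReal.ofReal √(Real.pi / 2))) := by
  rw [← lintegral_gaussian (by norm_num)]
  refine tendsto_lintegral_of_dominated_convergence (fun t => ENNReal.ofReal
    (Real.exp (-2 * t ^ 2) * ((1 / 3 : ℝ) ^ (-|-((p - 2) / 3)|) * (3 / 2) ^ (-((p - 2) / 3)))))
    (fun n => (measurable_massDensity p (k n)).ennreal_ofReal)
    (fun n => Eventually.of_forall fun t => ENNReal.ofReal_le_ofReal (massDensity_le p (hk0 n) t))
    ?_ (Eventually.of_forall fun t =>
      (ENNReal.continuous_ofReal.tendsto _).comp (tendsto_massDensity p t hk))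
  simp_rw [ENNReal.ofReal_mul (Real.exp_nonneg _)]
  rw [lintegral_mul_const _ (by fun_prop), lintegral_gaussian (by norm_num)]
  exact ENNReal.mul_ne_top (by simp) (by simp)

lemma tendsto_mass_off (p : ℝ) {k : ℕ → ℝ} (hk0 : ∀ n, 0 < k n) (hk : Tendsto k atTop atTop)
    {ρ : ℝ} (hρ : 0 < ρ) :
    Tendsto (fun n => ∫⁻ t in {t | k n * ρ ≤ |t|}, ENNReal.ofReal (massDensity p (k n) t)) atTop
      (𝓝 0) := by
  have hS : ∀ n, MeasurableSet {t : ℝ | k n * ρ ≤ |t|} := fun n =>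
    measurableSet_le measurable_const (by fun_prop)
  simp_rw [← lintegral_indicator (hS _)]
  have := tendsto_lintegral_of_dominated_convergence (μ := volume) (f := fun _ => 0)
    (F := fun n => {t : ℝ | k n * ρ ≤ |t|}.indicator
      fun t => ENNReal.ofReal (massDensity p (k n) t)) (fun t => ENNReal.ofReal
    (Real.exp (-2 * t ^ 2) * ((1 / 3 : ℝ) ^ (-|-((p - 2) / 3)|) * (3 / 2) ^ (-((p - 2) / 3)))))
    (fun n => ((measurable_massDensity p (k n)).ennreal_ofReal).indicator (hS n))
    (fun n => Eventually.of_forall fun t => (Set.indicator_le_self _ _ _).trans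
      (ENNReal.ofReal_le_ofReal (massDensity_le p (hk0 n) t)))
    ?_ (Eventually.of_forall fun t => ?_)
  · simpa using this
  · simp_rw [ENNReal.ofReal_mul (Real.exp_nonneg _)]
    rw [lintegral_mul_const _ (by fun_prop), lintegral_gaussian (by norm_num)]
    exact ENNReal.mul_ne_top (by simp) (by simp)
  · refine tendsto_const_nhds.congr' ?_
    filter_upwards [(hk.atTop_mul_const hρ).eventually_gt_atTop |t|] with n hn
    rw [Set.indicator_of_notMem]
    exact not_le.2 hn

/-! ### The osculating parabola -/

/-- Taylor's formula of second order for `|1 + s|^p` at `s = 0`. -/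
lemma tendsto_taylor {p : ℝ} (hp : 1 < p) :
    Tendsto (fun s : ℝ => (|1 + s| ^ p - 1 - p * s) / s ^ 2) (𝓝[≠] 0) (𝓝 (curvature p)) := by
  have hslope : HasDerivAt (slope p) (p * (p - 1)) 1 := by
    have h1 : HasDerivAt (fun t : ℝ => p * t ^ (p - 1)) (p * ((p - 1) * 1 ^ (p - 1 - 1))) 1 :=
      (Real.hasDerivAt_rpow_const (p := p - 1) (Or.inl one_ne_zero)).const_mul p
    rw [Real.one_rpow, mul_one] at h1
    exact h1.congr_of_eventuallyEq ((eventually_gt_nhds one_pos).mono fun s hs => slope_of_pos hs)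
  have hslope1 : slope p 1 = p := by rw [slope_of_pos one_pos, Real.one_rpow, mul_one]
  refine HasDerivAt.lhopital_zero_nhdsNE (f' := fun s => slope p (1 + s) - p)
    (g' := fun s => 2 * s) (Eventually.of_forall fun s => ?_) (Eventually.of_forall fun s => ?_)
    ?_ ?_ ?_ ?_
  · have h1 := (hasDerivAt_abs_rpow_slope hp (1 + s)).comp s ((hasDerivAt_id s).const_add 1)
    have h2 := (h1.sub_const 1).sub ((hasDerivAt_id s).const_mul p)
    rw [mul_one, mul_one] at h2
    exact h2
  · simpa using hasDerivAt_pow 2 s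
  · filter_upwards [self_mem_nhdsWithin] with s hs
    exact mul_ne_zero two_ne_zero hs
  · have h1 : Continuous fun s : ℝ => |1 + s| ^ p - 1 - p * s := by
      have : Continuous fun s : ℝ => |1 + s| ^ p :=
        (by fun_prop : Continuous fun s : ℝ => |1 + s|).rpow_const fun _ => Or.inr (by linarith)
      fun_prop
    have h2 := h1.tendsto 0
    simp only [add_zero, abs_one, Real.one_rpow, sub_self, mul_zero] at h2
    exact h2.mono_left nhdsWithin_le_nhds
  · have h1 := (by fun_prop : Continuous fun s : ℝ => s ^ 2).tendsto 0
    simp only [ne_eq, OfNat.ofNat_ne_zero, not_false_eq_true, zero_pow] at h1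
    exact h1.mono_left nhdsWithin_le_nhds
  · have h1 := (hasDerivAt_iff_tendsto_slope_zero.1 hslope).const_mul (1 / 2)
    have h2 : (1 / 2 : ℝ) * (p * (p - 1)) = curvature p := by unfold curvature; ring
    rw [h2] at h1
    refine h1.congr fun s => ?_
    rw [smul_eq_mul, hslope1]
    field_simp

lemma tendsto_rescaled_curve {p : ℝ} (hp : 1 < p) {k : ℕ → ℝ} (hk0 : ∀ n, 0 < k n)
    (hk : Tendsto k atTop atTop) (t : ℝ) :
    Tendsto (fun n => k n ^ 2 * (|1 + (k n)⁻¹ * t| ^ p - 1 - p * ((k n)⁻¹ * t))) atTop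
      (𝓝 (curvature p * t ^ 2)) := by
  rcases eq_or_ne t 0 with rfl | ht
  · simp
  have h1 : Tendsto (fun n => (k n)⁻¹ * t) atTop (𝓝[≠] 0) := by
    refine tendsto_nhdsWithin_iff.2 ⟨by simpa using hk.inv_tendsto_atTop.mul_const t,
      Eventually.of_forall fun n => ?_⟩
    exact mul_ne_zero (inv_ne_zero (hk0 n).ne') ht
  have h2 := ((tendsto_taylor hp).comp h1).mul_const (t ^ 2)
  refine h2.congr fun n => ?_
  have := (hk0 n).ne'
  simp only [Function.comp_apply]
  field_simp

/-- The product of `concFun p k` and the density of the measure, in the rescaled variable. -/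
def cutGauss (k t : ℝ) : ℝ :=
  (Set.Ioo (-(k / 2)) (k / 2)).indicator (fun t => Real.exp (-t ^ 2)) t

lemma concFun_mul_weight {p k : ℝ} (hk : 0 < k) (t : ℝ) :
    concFun p k (1 + k⁻¹ * t) * |1 + k⁻¹ * t| ^ ((p - 2) / 6) = cutGauss k t := by
  by_cases h : t ∈ Set.Ioo (-(k / 2)) (k / 2)
  · have h' := (mem_Ioo_affine hk t).2 h
    have hpos : 0 < |1 + k⁻¹ * t| ^ ((p - 2) / 6) := by
      have : 0 < |1 + k⁻¹ * t| := abs_pos.2 (by linarith [h'.1])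
      positivity
    have hkt : k * (1 + k⁻¹ * t - 1) = t := by field_simp; ring
    rw [concFun, cutGauss, Set.indicator_of_mem h', Set.indicator_of_mem h, mul_assoc,
      inv_mul_cancel₀ hpos.ne', mul_one, hkt]
  · rw [concFun, cutGauss, Set.indicator_of_notMem (fun h' => h ((mem_Ioo_affine hk t).1 h')),
      Set.indicator_of_notMem h, zero_mul]

lemma cutGauss_nonneg (k t : ℝ) : 0 ≤ cutGauss k t :=
  Set.indicator_nonneg (fun t _ => by positivity) t

lemma cutGauss_le (k t : ℝ) : cutGauss k t ≤ Real.exp (-t ^ 2) :=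
  Set.indicator_le' (s := Set.Ioo (-(k / 2)) (k / 2)) (g := fun t => Real.exp (-t ^ 2))
    (fun _ _ => le_rfl) (fun _ _ => by positivity) t

lemma measurable_cutGauss (k : ℝ) : Measurable (cutGauss k) :=
  Measurable.indicator (by fun_prop) measurableSet_Ioo

lemma tendsto_cutGauss (t : ℝ) {k : ℕ → ℝ} (hk : Tendsto k atTop atTop) :
    Tendsto (fun n => cutGauss (k n) t) atTop (𝓝 (Real.exp (-t ^ 2))) := by
  refine tendsto_const_nhds.congr' ?_
  filter_upwards [hk.eventually_gt_atTop (2 * |t|)] with n hn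
  rw [cutGauss, Set.indicator_of_mem]
  have := abs_lt.1 (show |t| < k n / 2 by linarith)
  exact this

/-- The second coordinate of the curve relative to its tangent at `1`, in the rescaled variable. -/
def rescaledCurve (p k t : ℝ) : ℝ := k ^ 2 * (|1 + k⁻¹ * t| ^ p - 1 - p * (k⁻¹ * t))

/-- The integrand of the pairing of the triple convolution of `concFun p k` with `concTest p k`, in
the rescaled variables. -/
def pairDensity (p k : ℝ) (t : ℝ × ℝ × ℝ) : ℝ :=
  cutGauss k t.1 * (cutGauss k t.2.1 * cutGauss k t.2.2) * parabolaFun (curvature p)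
    (t.1 + t.2.1 + t.2.2, rescaledCurve p k t.1 + rescaledCurve p k t.2.1 + rescaledCurve p k t.2.2)

lemma measurable_pairDensity (p k : ℝ) : Measurable (pairDensity p k) := by
  have h1 := measurable_cutGauss k
  have h2 : Measurable (rescaledCurve p k) := by unfold rescaledCurve; fun_prop
  have h3 := (measurable_parabolaFun (curvature p)).comp (by fun_prop :
    Measurable fun t : ℝ × ℝ × ℝ => (t.1 + t.2.1 + t.2.2,
      rescaledCurve p k t.1 + rescaledCurve p k t.2.1 + rescaledCurve p k t.2.2))
  exact ((h1.comp measurable_fst).mul ((h1.comp measurable_snd.fst).mul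
    (h1.comp measurable_snd.snd))).mul h3

lemma pairDensity_le {p : ℝ} (hp : 1 < p) (k : ℝ) (t : ℝ × ℝ × ℝ) :
    pairDensity p k t ≤
      Real.exp (-t.1 ^ 2) * (Real.exp (-t.2.1 ^ 2) * Real.exp (-t.2.2 ^ 2)) := by
  have h0 := cutGauss_nonneg k
  calc pairDensity p k t ≤ cutGauss k t.1 * (cutGauss k t.2.1 * cutGauss k t.2.2) * 1 :=
        mul_le_mul_of_nonneg_left (parabolaFun_le_one (curvature_pos hp) _)
          (mul_nonneg (h0 _) (mul_nonneg (h0 _) (h0 _)))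
    _ ≤ _ := by
        rw [mul_one]
        exact mul_le_mul (cutGauss_le _ _) (mul_le_mul (cutGauss_le _ _) (cutGauss_le _ _) (h0 _)
          (by positivity)) (mul_nonneg (h0 _) (h0 _)) (by positivity)

lemma pairDensity_eq (p : ℝ) {k : ℝ} (hk : 0 < k) (t : ℝ × ℝ × ℝ) (y : ℝ × ℝ × ℝ)
    (hy : y = (1 + k⁻¹ * t.1, 1 + k⁻¹ * t.2.1, 1 + k⁻¹ * t.2.2)) :
    concFun p k y.1 * (concFun p k y.2.1 * concFun p k y.2.2) *
      (concTest p k (curveSum p y) * weight p y) = pairDensity p k t := by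
  subst hy
  rw [pairDensity, ← concFun_mul_weight (p := p) hk t.1, ← concFun_mul_weight (p := p) hk t.2.1,
    ← concFun_mul_weight (p := p) hk t.2.2]
  have h1 : k * (1 + k⁻¹ * t.1 + (1 + k⁻¹ * t.2.1) + (1 + k⁻¹ * t.2.2) - 3) =
      t.1 + t.2.1 + t.2.2 := by field_simp; ring
  have h2 : ∀ a b c : ℝ, k ^ 2 * (a + b + c - 3 - p * (1 + k⁻¹ * t.1 + (1 + k⁻¹ * t.2.1) +
      (1 + k⁻¹ * t.2.2) - 3)) = k ^ 2 * (a - 1 - p * (k⁻¹ * t.1)) +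
        k ^ 2 * (b - 1 - p * (k⁻¹ * t.2.1)) + k ^ 2 * (c - 1 - p * (k⁻¹ * t.2.2)) :=
    fun a b c => by ring
  simp only [concTest, curveSum, weight, rescaledCurve, h1, h2]
  ring

lemma tendsto_pairDensity {p : ℝ} (hp : 1 < p) {k : ℕ → ℝ} (hk0 : ∀ n, 0 < k n)
    (hk : Tendsto k atTop atTop) {t : ℝ × ℝ × ℝ} (ht : t.2.1 ≠ t.2.2) :
    Tendsto (fun n => pairDensity p (k n) t) atTop
      (𝓝 (Real.exp (-2 * t.1 ^ 2) * (Real.exp (-2 * t.2.1 ^ 2) * Real.exp (-2 * t.2.2 ^ 2)))) := by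
  have hc := curvature_pos hp
  have h1 := (tendsto_cutGauss t.1 hk).mul ((tendsto_cutGauss t.2.1 hk).mul
    (tendsto_cutGauss t.2.2 hk))
  have h2 := ((tendsto_rescaled_curve hp hk0 hk t.1).add
    (tendsto_rescaled_curve hp hk0 hk t.2.1)).add (tendsto_rescaled_curve hp hk0 hk t.2.2)
  -- off the diagonal, the limit point lies strictly inside the region bounded by the parabola
  have hlt : curvature p * (t.1 + t.2.1 + t.2.2) ^ 2 / 3 <
      curvature p * t.1 ^ 2 + curvature p * t.2.1 ^ 2 + curvature p * t.2.2 ^ 2 := by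
    have h3 : 0 < (t.2.1 - t.2.2) ^ 2 := by
      have := sub_ne_zero.2 ht
      positivity
    have h4 : (t.1 + t.2.1 + t.2.2) ^ 2 / 3 < t.1 ^ 2 + t.2.1 ^ 2 + t.2.2 ^ 2 := by
      nlinarith [sq_nonneg (t.1 - t.2.1), sq_nonneg (t.1 - t.2.2)]
    calc _ = curvature p * ((t.1 + t.2.1 + t.2.2) ^ 2 / 3) := by ring
      _ < curvature p * (t.1 ^ 2 + t.2.1 ^ 2 + t.2.2 ^ 2) := by gcongr
      _ = _ := by ring
  have h5 := (Real.continuous_exp.tendsto _).comp (h2.neg.div_const (curvature p))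
  have h6 : Tendsto (fun n => parabolaFun (curvature p) (t.1 + t.2.1 + t.2.2,
      rescaledCurve p (k n) t.1 + rescaledCurve p (k n) t.2.1 + rescaledCurve p (k n) t.2.2)) atTop
      (𝓝 (Real.exp (-(curvature p * t.1 ^ 2 + curvature p * t.2.1 ^ 2 +
        curvature p * t.2.2 ^ 2) / curvature p))) := by
    refine h5.congr' ?_
    filter_upwards [h2.eventually (lt_mem_nhds hlt)] with n hn
    rw [parabolaFun, Set.indicator_of_mem]
    · rfl
    · exact hn.le
  have h7 : Real.exp (-2 * t.1 ^ 2) * (Real.exp (-2 * t.2.1 ^ 2) * Real.exp (-2 * t.2.2 ^ 2)) =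
      Real.exp (-t.1 ^ 2) * (Real.exp (-t.2.1 ^ 2) * Real.exp (-t.2.2 ^ 2)) *
        Real.exp (-(curvature p * t.1 ^ 2 + curvature p * t.2.1 ^ 2 +
          curvature p * t.2.2 ^ 2) / curvature p) := by
    rw [← Real.exp_add, ← Real.exp_add, ← Real.exp_add, ← Real.exp_add, ← Real.exp_add]
    congr 1
    field_simp
    ring
  rw [h7]
  exact h1.mul h6

lemma lintegral_gaussian_triple {b : ℝ} (hb : 0 < b) :
    ∫⁻ t : ℝ × ℝ × ℝ, ENNReal.ofReal (Real.exp (-b * t.1 ^ 2) * (Real.exp (-b * t.2.1 ^ 2) *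
      Real.exp (-b * t.2.2 ^ 2))) = ENNReal.ofReal (√(Real.pi / b) ^ 3) := by
  have h1 : ∀ t : ℝ × ℝ × ℝ, ENNReal.ofReal (Real.exp (-b * t.1 ^ 2) * (Real.exp (-b * t.2.1 ^ 2) *
      Real.exp (-b * t.2.2 ^ 2))) = ENNReal.ofReal (Real.exp (-b * t.1 ^ 2)) *
        (ENNReal.ofReal (Real.exp (-b * t.2.1 ^ 2)) * ENNReal.ofReal (Real.exp (-b * t.2.2 ^ 2))) :=
    fun t => by rw [ENNReal.ofReal_mul (by positivity), ENNReal.ofReal_mul (by positivity)]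
  simp_rw [h1]
  have h2 : Measurable fun s : ℝ => ENNReal.ofReal (Real.exp (-b * s ^ 2)) := by fun_prop
  rw [Measure.volume_eq_prod, lintegral_prod_mul
    (f := fun s : ℝ => ENNReal.ofReal (Real.exp (-b * s ^ 2)))
    (g := fun q : ℝ × ℝ => ENNReal.ofReal (Real.exp (-b * q.1 ^ 2)) *
      ENNReal.ofReal (Real.exp (-b * q.2 ^ 2))) h2.aemeasurable (by fun_prop),
    Measure.volume_eq_prod, lintegral_prod_mul
    (f := fun s : ℝ => ENNReal.ofReal (Real.exp (-b * s ^ 2)))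
    (g := fun s : ℝ => ENNReal.ofReal (Real.exp (-b * s ^ 2))) h2.aemeasurable h2.aemeasurable,
    lintegral_gaussian hb, ← ENNReal.ofReal_mul (by positivity), ← ENNReal.ofReal_mul (by positivity)]
  congr 1; ring

/-- Convergence of the rescaled pairing to its value on the osculating parabola. -/
lemma tendsto_pairing {p : ℝ} (hp : 1 < p) {k : ℕ → ℝ} (hk0 : ∀ n, 0 < k n)
    (hk : Tendsto k atTop atTop) :
    Tendsto (fun n => ∫⁻ t, ENNReal.ofReal (pairDensity p (k n) t)) atTop
      (𝓝 (ENNReal.ofReal (√(Real.pi / 2) ^ 3))) := by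
  rw [← lintegral_gaussian_triple (by norm_num)]
  refine tendsto_lintegral_of_dominated_convergence (fun t : ℝ × ℝ × ℝ => ENNReal.ofReal
    (Real.exp (-1 * t.1 ^ 2) * (Real.exp (-1 * t.2.1 ^ 2) * Real.exp (-1 * t.2.2 ^ 2))))
    (fun n => (measurable_pairDensity p (k n)).ennreal_ofReal)
    (fun n => Eventually.of_forall fun t => ENNReal.ofReal_le_ofReal ?_) ?_ ?_
  · simpa using pairDensity_le hp (k n) t
  · rw [lintegral_gaussian_triple one_pos]; exact ENNReal.ofReal_ne_top
  · filter_upwards [ae_generic] with t ht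
    exact (ENNReal.continuous_ofReal.tendsto _).comp (tendsto_pairDensity hp hk0 hk ht.2.2.2)

/-! ### The concentrating sequence -/

lemma lintegral_massDensity_ne_top (p : ℝ) {k : ℝ} (hk : 0 < k) :
    ∫⁻ t, ENNReal.ofReal (massDensity p k t) ≠ ∞ := by
  have h := lintegral_mono (μ := volume) fun t => ENNReal.ofReal_le_ofReal (massDensity_le p hk t)
  simp_rw [ENNReal.ofReal_mul (Real.exp_nonneg _)] at h
  rw [lintegral_mul_const _ (by fun_prop), lintegral_gaussian (by norm_num)] at h
  exact ne_top_of_le_ne_top (ENNReal.mul_ne_top (by simp) (by simp)) h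

lemma enorm_ofReal_of_nonneg {x : ℝ} (hx : 0 ≤ x) : ‖(x : ℂ)‖ₑ = ENNReal.ofReal x := by
  rw [← ofReal_norm, Complex.norm_real, Real.norm_of_nonneg hx]

lemma setLIntegral_concFun_sq (p : ℝ) {k : ℝ} (hk : 0 < k) (ρ : ℝ) :
    ∫⁻ y in {y | ρ ≤ |y - 1|}, ‖(concFun p k y : ℂ)‖ₑ ^ 2 = ENNReal.ofReal k⁻¹ *
      ∫⁻ t in {t | k * ρ ≤ |t|}, ENNReal.ofReal (massDensity p k t) := by
  have hS : ∀ a b : ℝ, MeasurableSet {t : ℝ | a ≤ |t - b|} := fun a b =>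
    measurableSet_le measurable_const (by fun_prop)
  have hS' : MeasurableSet {t : ℝ | k * ρ ≤ |t|} := by simpa using hS (k * ρ) 0
  have hm : Measurable fun y => ‖(concFun p k y : ℂ)‖ₑ ^ 2 :=
    (Complex.measurable_ofReal.comp (measurable_concFun p k)).enorm.pow_const 2
  rw [← lintegral_indicator (hS ρ 1), ← lintegral_indicator hS',
    lintegral_affine hk 1 (hm.indicator (hS ρ 1))]
  congr 1
  refine lintegral_congr fun t => ?_
  have hmem : 1 + k⁻¹ * t ∈ {y : ℝ | ρ ≤ |y - 1|} ↔ t ∈ {t : ℝ | k * ρ ≤ |t|} := by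
    show ρ ≤ |1 + k⁻¹ * t - 1| ↔ k * ρ ≤ |t|
    rw [add_sub_cancel_left, abs_mul, abs_of_pos (inv_pos.2 hk), ← div_eq_inv_mul, le_div_iff₀ hk,
      mul_comm]
  by_cases h : t ∈ {t : ℝ | k * ρ ≤ |t|}
  · rw [Set.indicator_of_mem h, Set.indicator_of_mem (hmem.2 h),
      enorm_ofReal_of_nonneg (concFun_nonneg _ _ _), ← ENNReal.ofReal_pow (concFun_nonneg _ _ _),
      concFun_sq hk]
  · rw [Set.indicator_of_notMem h, Set.indicator_of_notMem (fun h' => h (hmem.1 h'))]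

lemma lintegral_concFun_sq (p : ℝ) {k : ℝ} (hk : 0 < k) :
    ∫⁻ y, ‖(concFun p k y : ℂ)‖ₑ ^ 2 =
      ENNReal.ofReal k⁻¹ * ∫⁻ t, ENNReal.ofReal (massDensity p k t) := by
  have h := setLIntegral_concFun_sq p hk 0
  have h1 : {y : ℝ | 0 ≤ |y - 1|} = Set.univ := Set.eq_univ_of_forall fun y => abs_nonneg (y - 1)
  have h2 : {t : ℝ | k * 0 ≤ |t|} = Set.univ := by
    rw [mul_zero]; exact Set.eq_univ_of_forall fun t => abs_nonneg t
  rwa [h1, h2, Measure.restrict_univ] at h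

lemma memLp_concFun (p : ℝ) {k : ℝ} (hk : 0 < k) :
    MemLp (fun y => (concFun p k y : ℂ)) 2 volume := by
  refine memLp_two_of_lintegral
    (Complex.measurable_ofReal.comp (measurable_concFun p k)).aestronglyMeasurable ?_
  rw [lintegral_concFun_sq p hk]
  exact ENNReal.mul_ne_top ENNReal.ofReal_ne_top (lintegral_massDensity_ne_top p hk)

lemma enorm_concTest_sq {p : ℝ} (hp : 1 < p) {k : ℝ} (hk : 0 < k) :
    ∫⁻ u, ‖(concTest p k u : ℂ)‖ₑ ^ 2 =
      ENNReal.ofReal (k⁻¹ ^ 3 * (curvature p / 2 * √(Real.pi / (2 / 3)))) := by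
  rw [← lintegral_concTest_sq hp hk]
  exact lintegral_congr fun u => by rw [enorm_ofReal_of_nonneg (show 0 ≤ concTest p k u from parabolaFun_nonneg _ _)]

lemma memLp_concTest {p : ℝ} (hp : 1 < p) {k : ℝ} (hk : 0 < k) :
    MemLp (fun u => (concTest p k u : ℂ)) 2 volume := by
  refine memLp_two_of_lintegral
    (Complex.measurable_ofReal.comp (measurable_concTest p k)).aestronglyMeasurable ?_
  rw [enorm_concTest_sq hp hk]
  exact ENNReal.ofReal_ne_top

/-- The function `concFun p k` as an element of `L²`. -/
def concL2 (p : ℝ) {k : ℝ} (hk : 0 < k) : L2 ℝ := (memLp_concFun p hk).toLp _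

lemma coeFn_concL2 (p : ℝ) {k : ℝ} (hk : 0 < k) :
    concL2 p hk =ᵐ[volume] fun y => (concFun p k y : ℂ) := MemLp.coeFn_toLp _

lemma absL2_concL2 (p : ℝ) {k : ℝ} (hk : 0 < k) : absL2 (concL2 p hk) = concL2 p hk := by
  apply Lp.ext
  filter_upwards [coeFn_absL2 (concL2 p hk), coeFn_concL2 p hk] with y h1 h2
  rw [h1, h2, Complex.norm_real, Real.norm_of_nonneg (concFun_nonneg _ _ _)]

lemma enorm_concL2_sq (p : ℝ) {k : ℝ} (hk : 0 < k) : ‖concL2 p hk‖ₑ ^ 2 =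
    ENNReal.ofReal k⁻¹ * ∫⁻ t, ENNReal.ofReal (massDensity p k t) := by
  rw [concL2, enorm_toLp_sq, lintegral_concFun_sq p hk]

lemma norm_concL2_sq (p : ℝ) {k : ℝ} (hk : 0 < k) : ‖concL2 p hk‖ ^ 2 =
    k⁻¹ * (∫⁻ t, ENNReal.ofReal (massDensity p k t)).toReal := by
  have h := congrArg ENNReal.toReal (enorm_concL2_sq p hk)
  rwa [ENNReal.toReal_pow, toReal_enorm, ENNReal.toReal_mul,
    ENNReal.toReal_ofReal (by positivity)] at h

/-- The lower bound for the triple convolution obtained by duality. -/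
lemma pairing_sq_le {p : ℝ} (hp : 1 < p) {k : ℝ} (hk : 0 < k) :
    k⁻¹ ^ 3 * (∫⁻ t, ENNReal.ofReal (pairDensity p k t)).toReal ^ 2 ≤
      curvature p / 2 * √(Real.pi / (2 / 3)) *
        ‖tripleConv hp (concL2 p hk) (concL2 p hk) (concL2 p hk)‖ ^ 2 := by
  have hc := curvature_pos hp
  set ψ : L2 (ℝ × ℝ) := (memLp_concTest hp hk).toLp _ with hψ
  set D := curvature p / 2 * √(Real.pi / (2 / 3)) with hD
  have hψ1 : ‖ψ‖ ^ 2 = k⁻¹ ^ 3 * D := by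
    have h : ‖ψ‖ₑ ^ 2 = ENNReal.ofReal (k⁻¹ ^ 3 * D) := by
      rw [hψ, enorm_toLp_sq, enorm_concTest_sq hp hk]
    have h' := congrArg ENNReal.toReal h
    rwa [ENNReal.toReal_pow, toReal_enorm, ENNReal.toReal_ofReal (by positivity)] at h'
  have h1 := lintegral_tripleConv_le_absL2 hp ψ (concL2 p hk)
  rw [absL2_concL2] at h1
  have h2 : ∫⁻ y : ℝ × ℝ × ℝ, ‖concL2 p hk y.1‖ₑ * (‖concL2 p hk y.2.1‖ₑ *
      ‖concL2 p hk y.2.2‖ₑ) * ‖ψ (curveSum p y) * (weight p y : ℂ)‖ₑ =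
      ∫⁻ y : ℝ × ℝ × ℝ, ENNReal.ofReal (concFun p k y.1 * (concFun p k y.2.1 *
        concFun p k y.2.2) * (concTest p k (curveSum p y) * weight p y)) := by
    refine lintegral_congr_ae ?_
    have hf := coeFn_concL2 p hk
    have h12 : ∀ᵐ q : ℝ × ℝ, concL2 p hk q.1 = concFun p k q.1 :=
      Measure.quasiMeasurePreserving_fst.ae hf
    have h22 : ∀ᵐ q : ℝ × ℝ, concL2 p hk q.2 = concFun p k q.2 :=
      Measure.quasiMeasurePreserving_snd.ae hf
    have h2 : ∀ᵐ y : ℝ × ℝ × ℝ, concL2 p hk y.1 = concFun p k y.1 :=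
      Measure.quasiMeasurePreserving_fst.ae hf
    have h3 : ∀ᵐ y : ℝ × ℝ × ℝ, concL2 p hk y.2.1 = concFun p k y.2.1 :=
      Measure.quasiMeasurePreserving_snd.ae h12
    have h4 : ∀ᵐ y : ℝ × ℝ × ℝ, concL2 p hk y.2.2 = concFun p k y.2.2 :=
      Measure.quasiMeasurePreserving_snd.ae h22
    filter_upwards [h2, h3, h4, (quasiMeasurePreserving_curveSum hp).ae
      (MemLp.coeFn_toLp (memLp_concTest hp hk))] with y h2 h3 h4 h5
    have hn := concFun_nonneg p k
    have ht : 0 ≤ concTest p k (curveSum p y) := parabolaFun_nonneg _ _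
    have hw := weight_nonneg p y
    rw [h2, h3, h4, h5, ← Complex.ofReal_mul, enorm_ofReal_of_nonneg (hn _),
      enorm_ofReal_of_nonneg (hn _), enorm_ofReal_of_nonneg (hn _),
      enorm_ofReal_of_nonneg (mul_nonneg ht hw), ← ENNReal.ofReal_mul (hn _),
      ← ENNReal.ofReal_mul (hn _), ← ENNReal.ofReal_mul (mul_nonneg (hn _) (mul_nonneg (hn _) (hn _)))]
  have hmeas : Measurable fun y : ℝ × ℝ × ℝ => ENNReal.ofReal (concFun p k y.1 *
      (concFun p k y.2.1 * concFun p k y.2.2) * (concTest p k (curveSum p y) * weight p y)) := by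
    have m1 := measurable_concFun p k
    exact (((m1.comp measurable_fst).mul ((m1.comp measurable_snd.fst).mul
      (m1.comp measurable_snd.snd))).mul (((measurable_concTest p k).comp
        (measurable_curveSum p)).mul (measurable_weight p))).ennreal_ofReal
  rw [h2, lintegral_triple_affine hk 1 hmeas] at h1
  simp_rw [pairDensity_eq p hk _ _ rfl] at h1
  have h3 := ENNReal.toReal_mono (by finiteness) h1
  rw [ENNReal.toReal_mul, ENNReal.toReal_mul, toReal_enorm, toReal_enorm,
    ENNReal.toReal_ofReal (by positivity)] at h3
  set j := (∫⁻ t, ENNReal.ofReal (pairDensity p k t)).toReal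
  have h4 : (k⁻¹ ^ 3 * j) ^ 2 ≤ (‖tripleConv hp (concL2 p hk) (concL2 p hk) (concL2 p hk)‖ *
    ‖ψ‖) ^ 2 := by
    have : 0 ≤ j := ENNReal.toReal_nonneg
    gcongr
  rw [mul_pow, mul_pow _ ‖ψ‖, hψ1] at h4
  have hk3 : 0 < k⁻¹ ^ 3 := by positivity
  refine le_of_mul_le_mul_left ?_ hk3
  calc _ = (k⁻¹ ^ 3) ^ 2 * j ^ 2 := by ring
    _ ≤ _ := h4
    _ = _ := by ring

/-- The quotient for the Gaussian on the osculating parabola is `concConst p`. -/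
lemma gaussian_ratio {p : ℝ} (hp : 1 < p) : (√(Real.pi / 2) ^ 3) ^ 2 /
    (curvature p / 2 * √(Real.pi / (2 / 3)) * √(Real.pi / 2) ^ 3) = concConst p := by
  have hp' : 0 < p - 1 := by linarith
  have hp0 : 0 < p := by linarith
  have hπ := Real.pi_pos
  have h1 : √(Real.pi / (2 / 3)) = √3 * √(Real.pi / 2) := by
    rw [← Real.sqrt_mul (by norm_num)]; congr 1; ring
  have h2 : √(Real.pi / 2) ^ 2 = Real.pi / 2 := Real.sq_sqrt (by positivity)
  have h3 : 0 < √(Real.pi / 2) := by positivity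
  rw [h1, concConst, curvature, div_eq_div_iff (by positivity) (by positivity)]
  have h4 : (√(Real.pi / 2) ^ 3) ^ 2 = √(Real.pi / 2) ^ 2 * √(Real.pi / 2) ^ 4 := by ring
  rw [h4, h2]
  ring

/-- The quotients for the concentrating Gaussians are asymptotically at least `√(concConst p)`, and
at most `sharpConst p`. -/
lemma tendsto_ratio_concL2 {p : ℝ} (hp : 1 < p) (hC : sharpConst p ^ 2 = concConst p) {k : ℕ → ℝ}
    (hk0 : ∀ n, 0 < k n) (hk : Tendsto k atTop atTop) :
    (∀ᶠ n in atTop, concL2 p (hk0 n) ≠ 0) ∧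
    Tendsto (fun n => ‖tripleConv hp (concL2 p (hk0 n)) (concL2 p (hk0 n)) (concL2 p (hk0 n))‖ /
      ‖concL2 p (hk0 n)‖ ^ 3) atTop (𝓝 (sharpConst p)) := by
  have hc := curvature_pos hp
  have hπ := Real.pi_pos
  set j := fun n => (∫⁻ t, ENNReal.ofReal (pairDensity p (k n) t)).toReal
  set m := fun n => (∫⁻ t, ENNReal.ofReal (massDensity p (k n) t)).toReal
  set D := curvature p / 2 * √(Real.pi / (2 / 3)) with hD
  have hDpos : 0 < D := by positivity
  have hj : Tendsto j atTop (𝓝 (√(Real.pi / 2) ^ 3)) := by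
    have h := (ENNReal.tendsto_toReal ENNReal.ofReal_ne_top).comp (tendsto_pairing hp hk0 hk)
    rwa [ENNReal.toReal_ofReal (by positivity)] at h
  have hm : Tendsto m atTop (𝓝 √(Real.pi / 2)) := by
    have h := (ENNReal.tendsto_toReal ENNReal.ofReal_ne_top).comp (tendsto_mass p hk0 hk)
    rwa [ENNReal.toReal_ofReal (by positivity)] at h
  have hm0 : ∀ᶠ n in atTop, 0 < m n :=
    hm.eventually (lt_mem_nhds (Real.sqrt_pos.2 (by positivity)))
  have hlim : Tendsto (fun n => √(j n ^ 2 / (D * m n ^ 3))) atTop (𝓝 (sharpConst p)) := by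
    have h := ((hj.pow 2).div ((hm.pow 3).const_mul D) (by positivity)).sqrt
    rwa [hD, gaussian_ratio hp, ← hC, Real.sqrt_sq (sharpConst_nonneg p)] at h
  have hne : ∀ᶠ n in atTop, concL2 p (hk0 n) ≠ 0 := by
    filter_upwards [hm0] with n hn h0
    have h := norm_concL2_sq p (hk0 n)
    rw [h0, norm_zero, zero_pow two_ne_zero] at h
    exact (mul_pos (inv_pos.2 (hk0 n)) hn).ne h
  refine ⟨hne, tendsto_of_tendsto_of_tendsto_of_le_of_le' hlim tendsto_const_nhds ?_
    (Eventually.of_forall fun n => div_le_of_le_mul₀ (by positivity) (sharpConst_nonneg p)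
      (norm_tripleConv_self_le hp _))⟩
  filter_upwards [hm0] with n hn
  have h1 := pairing_sq_le hp (hk0 n)
  have h2 := norm_concL2_sq p (hk0 n)
  have hk' : 0 < (k n)⁻¹ := inv_pos.2 (hk0 n)
  refine Real.sqrt_le_iff.2 ⟨by positivity, ?_⟩
  have h3 : (‖concL2 p (hk0 n)‖ ^ 3) ^ 2 = (k n)⁻¹ ^ 3 * m n ^ 3 := by
    rw [← pow_mul, mul_comm 3 2, pow_mul, h2, mul_pow]
  rw [div_pow, h3, div_le_div_iff₀ (by positivity) (by positivity)]
  calc j n ^ 2 * ((k n)⁻¹ ^ 3 * m n ^ 3) = ((k n)⁻¹ ^ 3 * j n ^ 2) * m n ^ 3 := by ring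
    _ ≤ (D * ‖tripleConv hp (concL2 p (hk0 n)) (concL2 p (hk0 n)) (concL2 p (hk0 n))‖ ^ 2) *
        m n ^ 3 := by gcongr
    _ = _ := by ring

/-- The part of the mass of `f` at distance at least `ρ` from `y₀`. -/
def massOff (f : L2 ℝ) (y₀ ρ : ℝ) : ℝ≥0∞ := ∫⁻ y in {y : ℝ | ρ ≤ |y - y₀|}, ‖f y‖ₑ ^ 2

lemma tendsto_massOff_concL2 (p : ℝ) {k : ℕ → ℝ} (hk0 : ∀ n, 0 < k n) (hk : Tendsto k atTop atTop)
    {ρ : ℝ} (hρ : 0 < ρ) :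
    Tendsto (fun n => massOff (concL2 p (hk0 n)) 1 ρ / ‖concL2 p (hk0 n)‖ₑ ^ 2) atTop (𝓝 0) := by
  have h1 : ∀ n, massOff (concL2 p (hk0 n)) 1 ρ / ‖concL2 p (hk0 n)‖ₑ ^ 2 =
      (∫⁻ t in {t | k n * ρ ≤ |t|}, ENNReal.ofReal (massDensity p (k n) t)) /
        ∫⁻ t, ENNReal.ofReal (massDensity p (k n) t) := fun n => by
    have h2 : massOff (concL2 p (hk0 n)) 1 ρ = ENNReal.ofReal (k n)⁻¹ *
        ∫⁻ t in {t | k n * ρ ≤ |t|}, ENNReal.ofReal (massDensity p (k n) t) := by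
      rw [← setLIntegral_concFun_sq p (hk0 n)]
      refine lintegral_congr_ae ?_
      filter_upwards [ae_restrict_of_ae (coeFn_concL2 p (hk0 n))] with y hy
      rw [hy]
    have hpos := inv_pos.2 (hk0 n)
    rw [h2, enorm_concL2_sq, ENNReal.mul_div_mul_left _ _ (ENNReal.ofReal_pos.2 hpos).ne'
      ENNReal.ofReal_ne_top]
  simp_rw [h1]
  have h3 := ENNReal.Tendsto.div (tendsto_mass_off p hk0 hk hρ)
    (Or.inr (ENNReal.ofReal_pos.2 (Real.sqrt_pos.2 (by positivity))).ne') (tendsto_mass p hk0 hk)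
    (Or.inl ENNReal.ofReal_ne_top)
  simpa using h3

lemma concentratesAt_of_tendsto {f : ℕ → L2 ℝ} {y₀ : ℝ} (hf : ∀ n, f n ≠ 0)
    (h : ∀ ρ > 0, Tendsto (fun n => massOff (f n) y₀ ρ / ‖f n‖ₑ ^ 2) atTop (𝓝 0)) :
    ConcentratesAt f y₀ := by
  intro ε hε ρ hρ
  obtain ⟨N, hN⟩ := eventually_atTop.1
    ((h ρ hρ).eventually (gt_mem_nhds (ENNReal.ofReal_pos.2 hε)))
  refine ⟨N, fun n hn => ?_⟩
  have h0 : ‖f n‖ₑ ^ 2 ≠ 0 := pow_ne_zero 2 (enorm_ne_zero.2 (hf n))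
  have h1 := (ENNReal.div_lt_iff (Or.inl h0) (Or.inl (by finiteness))).1 (hN n hn)
  have hmeas : AEStronglyMeasurable (fun y => ‖f n y‖ ^ 2)
      (volume.restrict {y : ℝ | ρ ≤ |y - y₀|}) :=
    ((Lp.stronglyMeasurable (f n)).norm.pow 2).aestronglyMeasurable
  rw [integral_eq_lintegral_of_nonneg_ae (Eventually.of_forall fun y => by positivity) hmeas]
  have h2 : ∫⁻ y in {y : ℝ | ρ ≤ |y - y₀|}, ENNReal.ofReal (‖f n y‖ ^ 2) = massOff (f n) y₀ ρ :=
    lintegral_congr fun y => by rw [ENNReal.ofReal_pow (norm_nonneg _), ofReal_norm]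
  rw [h2, ← ENNReal.lt_ofReal_iff_toReal_lt (ne_top_of_lt h1), ENNReal.ofReal_mul hε.le,
    ENNReal.ofReal_pow (norm_nonneg _), ofReal_norm]
  exact h1

lemma massOff_dilate {a : ℝ} (ha : a ≠ 0) (f : L2 ℝ) (y₀ ρ : ℝ) :
    massOff (dilate ha f) y₀ ρ = massOff f (a * y₀) (|a| * ρ) := by
  have hS : ∀ b c : ℝ, MeasurableSet {t : ℝ | b ≤ |t - c|} := fun b c =>
    measurableSet_le measurable_const (by fun_prop)
  have hm : Measurable fun y => ‖f y‖ₑ ^ 2 := (Lp.stronglyMeasurable f).enorm.pow_const 2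
  unfold massOff
  rw [← lintegral_indicator (hS _ _), ← lintegral_indicator (hS _ _),
    lintegral_comp_mul ha (hm.indicator (hS _ _)),
    ← lintegral_const_mul' _ _ ENNReal.ofReal_ne_top]
  refine lintegral_congr_ae ?_
  filter_upwards [coeFn_dilate ha f] with y hy
  have hmem : a * y ∈ {t : ℝ | |a| * ρ ≤ |t - a * y₀|} ↔ y ∈ {t : ℝ | ρ ≤ |t - y₀|} := by
    show |a| * ρ ≤ |a * y - a * y₀| ↔ ρ ≤ |y - y₀|
    rw [← mul_sub, abs_mul, mul_le_mul_iff_right₀ (abs_pos.2 ha)]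
  by_cases h : y ∈ {t : ℝ | ρ ≤ |t - y₀|}
  · rw [Set.indicator_of_mem h, Set.indicator_of_mem (hmem.2 h), hy, enorm_mul, mul_pow,
      enorm_ofReal_of_nonneg (Real.sqrt_nonneg _), ← ENNReal.ofReal_pow (Real.sqrt_nonneg _),
      Real.sq_sqrt (abs_nonneg _)]
  · rw [Set.indicator_of_notMem h, Set.indicator_of_notMem (fun h' => h (hmem.1 h')), mul_zero]

lemma concentratesAt_dilate {g : ℕ → L2 ℝ} (hg : ∀ n, g n ≠ 0)
    (h : ∀ ρ > 0, Tendsto (fun n => massOff (g n) 1 ρ / ‖g n‖ₑ ^ 2) atTop (𝓝 0))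
    {a : ℕ → ℝ} (ha : ∀ n, a n ≠ 0) {y₀ : ℝ}
    (hy : ∀ ρ > 0, ∃ ρ' > 0, ∀ᶠ n in atTop, ∀ z, |a n| * ρ ≤ |z - a n * y₀| → ρ' ≤ |z - 1|) :
    ConcentratesAt (fun n => dilate (ha n) (g n)) y₀ := by
  refine concentratesAt_of_tendsto (fun n => ?_) fun ρ hρ => ?_
  · rw [← norm_ne_zero_iff, norm_dilate, norm_ne_zero_iff]
    exact hg n
  · obtain ⟨ρ', hρ', hev⟩ := hy ρ hρ
    refine tendsto_of_tendsto_of_tendsto_of_le_of_le' tendsto_const_nhds (h ρ' hρ')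
      (Eventually.of_forall fun _ => zero_le) ?_
    filter_upwards [hev] with n hn
    rw [massOff_dilate, enorm_dilate]
    exact ENNReal.div_le_div_right (lintegral_mono_set hn) _

/-- In the case of equality there are extremizing sequences which concentrate at a given point. -/
lemma exists_extremizing_concentratesAt {p : ℝ} (hp : 1 < p) (hC : sharpConst p ^ 2 = concConst p)
    (y₀ : ℝ) : ∃ f : ℕ → L2 ℝ, IsExtremizingSeq p f ∧ ConcentratesAt f y₀ := by
  have hpos : ∀ n : ℕ, (0 : ℝ) < n + 1 := fun n => by positivity
  have hlim : Tendsto (fun n : ℕ => (n : ℝ) + 1) atTop atTop :=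
    tendsto_atTop_add_const_right _ 1 tendsto_natCast_atTop_atTop
  obtain ⟨N, hN⟩ := eventually_atTop.1 (tendsto_ratio_concL2 hp hC hpos hlim).1
  have hk0 : ∀ n : ℕ, (0 : ℝ) < ((n + N : ℕ) : ℝ) + 1 := fun n => hpos (n + N)
  have hk : Tendsto (fun n : ℕ => ((n + N : ℕ) : ℝ) + 1) atTop atTop :=
    hlim.comp (tendsto_add_atTop_nat N)
  have hne : ∀ n, concL2 p (hk0 n) ≠ 0 := fun n => hN (n + N) (Nat.le_add_left N n)
  have hratio := (tendsto_ratio_concL2 hp hC hk0 hk).2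
  have hmass := fun ρ (hρ : 0 < ρ) => tendsto_massOff_concL2 p hk0 hk hρ
  have hext : ∀ {a : ℕ → ℝ} (ha : ∀ n, a n ≠ 0),
      IsExtremizingSeq p fun n => dilate (ha n) (concL2 p (hk0 n)) := fun ha => by
    refine (isExtremizingSeq_iff hp _).2 ⟨fun n => ?_, ?_⟩
    · rw [← norm_ne_zero_iff, norm_dilate, norm_ne_zero_iff]
      exact hne n
    · simp_rw [norm_tripleConv_dilate, norm_dilate]
      exact hratio
  rcases eq_or_ne y₀ 0 with rfl | hy
  · -- dilations by large factors move the concentration point `1` to `0`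
    have ha : ∀ n : ℕ, (n : ℝ) + 1 ≠ 0 := fun n => (hpos n).ne'
    refine ⟨_, hext ha, concentratesAt_dilate hne hmass ha fun ρ hρ => ⟨1, one_pos, ?_⟩⟩
    filter_upwards [(hlim.atTop_mul_const hρ).eventually_ge_atTop 2] with n hn z hz
    rw [abs_of_pos (hpos n), mul_zero, sub_zero] at hz
    have := abs_sub_abs_le_abs_sub z 1
    rw [abs_one] at this
    linarith
  · have ha : ∀ _ : ℕ, y₀⁻¹ ≠ 0 := fun _ => inv_ne_zero hy
    refine ⟨_, hext ha, concentratesAt_dilate hne hmass ha fun ρ hρ =>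
      ⟨|y₀⁻¹| * ρ, mul_pos (abs_pos.2 (inv_ne_zero hy)) hρ, Eventually.of_forall fun n z hz => ?_⟩⟩
    rwa [inv_mul_cancel₀ hy] at hz

end PowerCurve

end

theorem theorem2 (p : ℝ) (hp : 1 < p) :
    (ENNReal.ofReal (2 * Real.pi / (√3 * p * (p - 1))) < PowerCurve.optimalConst p ^ 6 →
      (∀ f : ℕ → Lp ℂ 2 (volume : Measure ℝ),
        PowerCurve.IsExtremizingSeq p f → PowerCurve.IsNonnegSeq f →
          PowerCurve.IsPrecompactModScaling f) ∧
      ∃ f : Lp ℂ 2 (volume : Measure ℝ), PowerCurve.IsExtremizer p f) ∧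
    (PowerCurve.optimalConst p ^ 6 = ENNReal.ofReal (2 * Real.pi / (√3 * p * (p - 1))) →
      ∀ y₀ : ℝ, ∃ f : ℕ → Lp ℂ 2 (volume : Measure ℝ),
        PowerCurve.IsExtremizingSeq p f ∧ PowerCurve.ConcentratesAt f y₀) := by
  rw [← PowerCurve.ofReal_sharpConst_sq hp]
  refine ⟨fun h => ?_, fun h => ?_⟩
  · have hD : PowerCurve.concConst p < PowerCurve.sharpConst p ^ 2 :=
      (ENNReal.ofReal_lt_ofReal_iff_of_nonneg (PowerCurve.concConst_pos hp).le).1 h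
    exact ⟨fun f hf hf0 => PowerCurve.isPrecompactModScaling_of_extremizing hp hD hf hf0,
      PowerCurve.exists_isExtremizer hp hD⟩
  · have hC : PowerCurve.sharpConst p ^ 2 = PowerCurve.concConst p :=
      (ENNReal.ofReal_eq_ofReal_iff (sq_nonneg _) (PowerCurve.concConst_pos hp).le).1 h
    exact PowerCurve.exists_extremizing_concentratesAt hp hC
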